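/- **Notation.** For complex $x,q$ and an integer $n\ge 0$ let $(x;q)_n=\prod_{i=0}^{n-1}(1-xq^i)$ and $(x_1,\dots,x_m;q)_n=(x_1;q)_n\cdots(x_m;q)_n$. Let $${}_{r+1}\phi_r\left[\begin{matrix}a_1,\dots,a_{r+1}\\ b_1,\dots,b_r\end{matrix};q,z\right]=\sum_{j\ge 0}\frac{(a_1,\dots,a_{r+1};q)_j}{(q,b_1,\dots,b_r;q)_j}z^j .$$ Let $a,k,q$ (and $\rho_1,\rho_2$ in (1)) be nonzero complex numbers and $n\ge0$ an integer. In each identity $\sqrt a,\sqrt k,\sqrt{k/a},\sqrt{qa/k},\sqrt{kq/a},\sqrt{aq}$ denote arbitrarily chosen (fixed) square roots, with $\sqrt{a/k}:=1/\sqrt{k/a}$. Put $$P_n(a,k,q)=\frac{(a^2q^2,\,a^2/k;q^2)_n\,(-k/a;q)_{2n}}{(k/a^2,\,k^2q^2/a^2;q^2)_n\,(-qa;q)_{2n}}\left(\frac{kq}{a^2}\right)^n,$$ $$w_{n,j}(a,k,q)=\frac{\left(1-\frac{k^2}{a^2}q^{4j}\right)(kq^{2n},\,q^{-2n};q^2)_j}{\left(1-\frac{k^2}{a^2}\right)\left(\frac{k^2q^{2n+2}}{a^2},\,\frac{kq^{2-2n}}{a^2};q^2\right)_j}.$$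 **Theorem.** Each of the following identities between terminating series holds whenever no factor vanishes in the denominators that occur in it. (In a series ${}_{r+1}\phi_r$ only the terms up to its termination index count: $j\le n$ in (1), (3), (7) and $j\le 2n$ in (8).) (1) $${}_{10}\phi_9\left[\begin{matrix}a,q\sqrt a,-q\sqrt a,\rho_1,\rho_2,\frac{a^3q}{k\rho_1\rho_2},\sqrt k q^n,-\sqrt kq^n,q^{-n},-q^{-n}\\ \sqrt a,-\sqrt a,\frac{aq}{\rho_1},\frac{aq}{\rho_2},\frac{k\rho_1\rho_2}{a^2},\frac{aq^{1-n}}{\sqrt k},-\frac{aq^{1-n}}{\sqrt k},aq^{n+1},-aq^{n+1}\end{matrix};q,q^2\right] =P_n(a,k,q)\sum_{j=0}^n w_{n,j}(a,k,q)\frac{\left(\frac{k\rho_1}{a^2},\frac{k\rho_2}{a^2},\frac ka,\frac{aq}{\rho_1\rho_2};q\right)_j}{\left(\frac{aq}{\rho_1},\frac{aq}{\rho_2},\frac{k\rho_1\rho_2}{a^2},q;q\right)_j}q^j.$$ (2) $$\sum_{j=0}^n\frac{\left(a,q\sqrt a,-q\sqrt a,\frac{k}{a^2q};q\right)_j(q^{-2n},kq^{2n};q^2)_j\left(\frac{qa^3}{k};q\right)_{2j}}{\left(\sqrt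 a,-\sqrt a,q,\frac{a^3q^2}{k};q\right)_j\left(\frac{a^2q^{2-2n}}{k},a^2q^{2n+2};q^2\right)_j\left(\frac ka;q\right)_{2j}}q^{2j} =P_n(a,k,q)\sum_{j=0}^n w_{n,j}(a,k,q)\frac{\left(\frac{k^2}{qa^4};q\right)_j}{(q;q)_j}q^j.$$ (3) $${}_{12}\phi_{11}\left[\begin{matrix}a,q\sqrt a,-q\sqrt a,a\sqrt{\frac{qa}{k}},-a\sqrt{\frac{qa}{k}},a\sqrt{\frac ak},-aq\sqrt{\frac ak},\frac{k}{a^2},q^{-n},-q^{-n},\sqrt kq^n,-\sqrt kq^n\\ \sqrt a,-\sqrt a,\sqrt{\frac{kq}{a}},-\sqrt{\frac{kq}{a}},q\sqrt{\frac ka},-\sqrt{\frac ka},\frac{qa^3}{k},\frac{aq^{1-n}}{\sqrt k},-\frac{aq^{1-n}}{\sqrt k},aq^{n+1},-aq^{n+1}\end{matrix};q,q^2\right] =P_n(a,k,q)\sum_{j=0}^n w_{n,j}(a,k,q)\frac{\left(\sqrt{\frac ka},\frac{k^2}{a^4};q\right)_j}{\left(q\sqrt{\frac ka},q;q\right)_j}q^j.$$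 (4) $$\sum_{j=0}^n\frac{(q^{-4n},kq^{4n};q^2)_{2j}\left(a,q^2\sqrt a,-q^2\sqrt a,\frac{a^4}{k^2};q^2\right)_j}{\left(\frac{a^2q^{2-4n}}{k},a^2q^{4n+2};q^2\right)_{2j}\left(q^2,\sqrt a,-\sqrt a,\frac{q^2k^2}{a^3};q^2\right)_j}q^{4j} =P_{2n}(a,k,q)\sum_{j=0}^{2n}w_{2n,j}(a,k,q)\frac{\left(\frac ka,\frac{k\sqrt{aq}}{a^2},-\frac{k\sqrt{aq}}{a^2},\frac{a^2}{k};q\right)_j}{\left(\sqrt{aq},-\sqrt{aq},\frac{qk^2}{a^3},q;q\right)_j}\left(\frac{-kq}{a^2}\right)^j.$$ (5) $$\sum_{j=0}^n\frac{(1-\sqrt a\,q^{2j})(q^{-4n},kq^{4n};q^4)_j\left(\sqrt a,\frac{a^2q}{k};q\right)_j}{(1-\sqrt a)\left(\frac{a^2q^{4-4n}}{k},a^2q^{4n+4};q^4\right)_j\left(q,\frac{k\sqrt a}{a^2};q\right)_j}q^{3j} =P_n(a,k,q^2)\sum_{j=0}^nw_{n,j}(a,k,q^2)\frac{\left(\frac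 ka,\frac{a^2q^2}{k};q^2\right)_j\left(\frac{-k\sqrt a}{a^2};q\right)_{2j}}{\left(q^2,\frac{k^2}{a^3};q^2\right)_j(-q\sqrt a;q)_{2j}}\left(\frac{kq}{a^2}\right)^j.$$ (6) $$\sum_{j=0}^n\frac{(1-aq^{4j})(q^{-4n},kq^{4n};q^4)_j\left(\sqrt a,\frac{a^2}{k};q\right)_j}{(1-a)\left(\frac{a^2q^{4-4n}}{k},a^2q^{4n+4};q^4\right)_j\left(q,\frac{kq\sqrt a}{a^2};q\right)_j}q^{3j} =P_n(a,k,q^2)\sum_{j=0}^nw_{n,j}(a,k,q^2)\frac{\left(\frac ka,\frac{a^2}{k},-\frac{kq\sqrt a}{a^2},-\frac{kq^2\sqrt a}{a^2};q^2\right)_j}{\left(q^2,\frac{q^2k^2}{a^3},-\sqrt a,-q\sqrt a;q^2\right)_j}\left(\frac{kq}{a^2}\right)^j.$$ (7) $${}_5\phi_4\left[\begin{matrix}\frac{qa^4}{k^2},q^{-n},-q^{-n},\sqrt kq^n,-\sqrt kq^n\\ \frac{aq^{1-n}}{\sqrt k},-\frac{aq^{1-n}}{\sqrt k},aq^{n+1},-aq^{n+1}\end{matrix};q,q^2\right]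 =P_n(a,k,q)\sum_{j=0}^nw_{n,j}(a,k,q)\frac{\left(\frac{qa^2}{k},\frac ka;q\right)_j\left(\frac{k^2}{a^3};q\right)_{2j}}{\left(\frac{k^2}{a^3},q;q\right)_j(aq;q)_{2j}}q^j.$$ (8) $${}_{10}\phi_9\left[\begin{matrix}a,q\sqrt a,-q\sqrt a,\frac{k}{a^2},a\sqrt{\frac{aq}{k}},-a\sqrt{\frac{aq}{k}},q^{-2n},-q^{-2n},\sqrt kq^{2n},-\sqrt kq^{2n}\\ \sqrt a,-\sqrt a,\frac{qa^3}{k},\sqrt{\frac{qk}{a}},-\sqrt{\frac{qk}{a}},\frac{aq^{1-2n}}{\sqrt k},-\frac{aq^{1-2n}}{\sqrt k},aq^{2n+1},-aq^{2n+1}\end{matrix};q,\frac{-q^2a^2}{k}\right] =P_{2n}(a,k,q)\sum_{j=0}^nw_{2n,2j}(a,k,q)\frac{\left(\frac ka,\frac{k^2}{a^4};q^2\right)_j}{\left(q^2,\frac{q^2a^3}{k};q^2\right)_j}q^{2j}.$$ -/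

import Mathlib

/-- The `q`-shifted factorial `(x; q)_n = (1 - x)(1 - x q) ⋯ (1 - x q^(n-1))`. -/
noncomputable def qPoch (x q : ℂ) (n : ℕ) : ℂ :=
  ∏ i ∈ Finset.range n, (1 - x * q ^ i)

/-- The multiple `q`-shifted factorial
`(x₁, …, x_m; q)_n = (x₁; q)_n ⋯ (x_m; q)_n`. -/
noncomputable def qPochs (xs : List ℂ) (q : ℂ) (n : ℕ) : ℂ :=
  (xs.map (fun x => qPoch x q n)).prod

/-- The basic hypergeometric series `_rφ_s[a₁, …, a_r; b₁, …, b_s; q, z]`, that is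
`∑_j (a₁, …, a_r; q)_j / (q, b₁, …, b_s; q)_j * ((-1)^j q^(j(j-1)/2))^(1+s-r) * z^j`,
where `r` and `s` are the lengths of the two parameter lists. -/
noncomputable def basicHyp (as bs : List ℂ) (q z : ℂ) : ℂ :=
  ∑' j : ℕ, qPochs as q j / (qPoch q q j * qPochs bs q j)
    * ((-1) ^ j * q ^ (j.choose 2)) ^ (1 + (bs.length : ℤ) - (as.length : ℤ)) * z ^ j

/-- The factor in front of the sum on the right-hand sides:
`(a²q², a²/k; q²)_n (-k/a; q)_{2n} / ((k/a², k²q²/a²; q²)_n (-qa; q)_{2n}) * (kq/a²)^n`. -/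
noncomputable def rhsFactor (a k q : ℂ) (n : ℕ) : ℂ :=
  qPochs [a ^ 2 * q ^ 2, a ^ 2 / k] (q ^ 2) n * qPoch (-k / a) q (2 * n)
    / (qPochs [k / a ^ 2, k ^ 2 * q ^ 2 / a ^ 2] (q ^ 2) n * qPoch (-q * a) q (2 * n))
    * (k * q / a ^ 2) ^ n

/-- The factor common to the summands on the right-hand sides:
`(1 - (k²/a²) q^{4j}) (kq^{2n}, q^{-2n}; q²)_j
  / ((1 - k²/a²) (k²q^{2n+2}/a², kq^{2-2n}/a²; q²)_j)`. -/
noncomputable def rhsWeight (a k q : ℂ) (n j : ℕ) : ℂ :=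
  (1 - k ^ 2 / a ^ 2 * q ^ (4 * j))
      * qPochs [k * q ^ (2 * n), q ^ (-2 * (n : ℤ))] (q ^ 2) j
    / ((1 - k ^ 2 / a ^ 2)
      * qPochs [k ^ 2 * q ^ (2 * n + 2) / a ^ 2, k * q ^ (2 - 2 * (n : ℤ)) / a ^ 2]
          (q ^ 2) j)

/-- No factor in the denominators of `rhsFactor a k q n` and of
`rhsWeight a k q n j`, `0 ≤ j ≤ n`, vanishes. -/
def RhsRegular (a k q : ℂ) (n : ℕ) : Prop :=
  qPochs [k / a ^ 2, k ^ 2 * q ^ 2 / a ^ 2] (q ^ 2) n ≠ 0 ∧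
  qPoch (-q * a) q (2 * n) ≠ 0 ∧
  1 - k ^ 2 / a ^ 2 ≠ 0 ∧
  qPochs [k ^ 2 * q ^ (2 * n + 2) / a ^ 2, k * q ^ (2 - 2 * (n : ℤ)) / a ^ 2]
    (q ^ 2) n ≠ 0

/-! All eight identities are instances of one transformation of WP-Bailey pairs. Let `β m = ∑_{j ≤
m} wpKernel a (k/a) q m j * α j`. Insert this in `∑_m w_{n,m} β m q^m` and interchange the sums.
With `m = j + i`, the coefficient of `α j` becomes a terminating series in `i` that mixes the bases
`q` and `q^2` and is very-well-poised in `q^2`. `quadratic_sum` evaluates it in closed form, and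
`P_n` is exactly the factor that turns its value into the weight of the left-hand side times `(q^2
a^2/k)^j` (`wpBailey_transformation`, with the bookkeeping in `rhsFactor_mul_quadratic_sum`).

It remains to exhibit eight pairs, each of which amounts to a summation theorem. Jackson's sum gives
`wpPair_singh`, and in base `q^2` it gives `wpPair_even`, whose `α` lives on even indices. The
`q`-Pfaff–Saalschütz sum gives `wpPair_saalschuetz`, and also `wpPair_chain`, which makes new pairs
out of old ones and leads from the first pair to `wpPair_bressoud` and `wpPair_sqrt`. The quadratic
sums give `wpPair_quadratic` and `wpPair_quadratic_sq`. A sum that vanishes for odd length gives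
`wpPair_parity`.

The summations rest on telescoping: the summands for two neighbouring sets of parameters satisfy a
first order relation up to a difference `G (j+1) - G j`, and `G` vanishes at both ends. Jackson's
and Saalschütz's sums follow by induction on the length, the parity sum by induction in steps of
two. The quadratic sum is compared in the same way with a special case of Jackson's.

These arguments divide by many factors that the theorem allows to vanish, so they are run for
generic parameters only, those whose absolute values are multiplicatively independent. Such
parameters accumulate at every point with nonzero coordinates (`exists_frequently_normIndep`). Both
sides are continuous wherever the denominators that actually occur are nonzero, so the identities
pass to the limit (`transformation_closure`). -/

/-! ### Elementary rules for `q`-shifted factorials and conditions of genericity -/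

theorem qPoch_zero (x q : ℂ) : qPoch x q 0 = 1 := by simp [qPoch]

theorem qPoch_succ (x q : ℂ) (n : ℕ) : qPoch x q (n + 1) = qPoch x q n * (1 - x * q ^ n) := by
  simp [qPoch, Finset.prod_range_succ]

theorem qPoch_add (x q : ℂ) (m n : ℕ) :
    qPoch x q (m + n) = qPoch x q m * qPoch (x * q ^ m) q n := by
  simp only [qPoch, Finset.prod_range_add]
  congr 1
  exact Finset.prod_congr rfl fun i _ => by ring

theorem qPoch_succ_left (x q : ℂ) (n : ℕ) :
    qPoch x q (n + 1) = (1 - x) * qPoch (x * q) q n := by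
  rw [add_comm, qPoch_add]; simp [qPoch]

theorem qPoch_shift (x q : ℂ) (n : ℕ) :
    (1 - x) * qPoch (x * q) q n = qPoch x q n * (1 - x * q ^ n) := by
  rw [← qPoch_succ_left, qPoch_succ]

theorem qPoch_mul_neg (x q : ℂ) (n : ℕ) :
    qPoch x q n * qPoch (-x) q n = qPoch (x ^ 2) (q ^ 2) n := by
  simp only [qPoch, ← Finset.prod_mul_distrib]
  exact Finset.prod_congr rfl fun i _ => by ring

theorem qPoch_two_mul (x q : ℂ) (n : ℕ) :
    qPoch x q (2 * n) = qPoch x (q ^ 2) n * qPoch (x * q) (q ^ 2) n := by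
  induction n with
  | zero => simp [qPoch]
  | succ n ih =>
    rw [show 2 * (n + 1) = 2 * n + 1 + 1 by ring, qPoch_succ, qPoch_succ, ih, qPoch_succ,
      qPoch_succ]
    ring

theorem qPoch_ne_zero_iff {x q : ℂ} {n : ℕ} :
    qPoch x q n ≠ 0 ↔ ∀ i < n, 1 - x * q ^ i ≠ 0 := by
  simp [qPoch, Finset.prod_ne_zero_iff]

theorem qPoch_ne_zero_of_le {x q : ℂ} {m n : ℕ} (h : qPoch x q n ≠ 0) (hmn : m ≤ n) :
    qPoch x q m ≠ 0 :=
  qPoch_ne_zero_iff.2 fun i hi => qPoch_ne_zero_iff.1 h i (hi.trans_le hmn)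

/-- Reversing the order of the factors in a quotient of two `q`-shifted factorials. -/
theorem qPoch_reverse {q : ℂ} (hq : q ≠ 0) {x y : ℂ} (hx : x ≠ 0) (hy : y ≠ 0) (n : ℕ) :
    qPoch (q ^ (1 - (n : ℤ)) / x) q n * qPoch y q n * x ^ n
      = qPoch (q ^ (1 - (n : ℤ)) / y) q n * qPoch x q n * y ^ n := by
  -- Since `(1 - q^(-i)/z) z = -q^(-i) (1 - z q^i)`, reversal costs a product that does not depend
  -- on `z`; it cancels between `x` and `y`.
  have key : ∀ z : ℂ, z ≠ 0 → qPoch (q ^ (1 - (n : ℤ)) / z) q n * z ^ n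
      = qPoch z q n * ∏ i ∈ Finset.range n, (-(q ^ i)⁻¹) := by
    intro z hz
    have h1 : qPoch (q ^ (1 - (n : ℤ)) / z) q n
        = ∏ i ∈ Finset.range n, (1 - (q ^ i)⁻¹ / z) := by
      rw [qPoch, ← Finset.prod_range_reflect]
      refine Finset.prod_congr rfl fun i hi => ?_
      have hi : i < n := Finset.mem_range.1 hi
      have : q ^ (1 - (n : ℤ)) * q ^ (n - 1 - i) = (q ^ i)⁻¹ := by
        rw [← zpow_natCast, ← zpow_natCast, ← zpow_neg, ← zpow_add₀ hq]
        congr 1; omega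
      rw [div_mul_eq_mul_div, this]
    have h2 : z ^ n = ∏ _i ∈ Finset.range n, z := by simp
    rw [h1, h2, qPoch, ← Finset.prod_mul_distrib, ← Finset.prod_mul_distrib]
    refine Finset.prod_congr rfl fun i _ => ?_
    have := pow_ne_zero i hq
    field_simp
    ring
  linear_combination qPoch y q n * key x hx - qPoch x q n * key y hy

/-- `x` does not belong to the multiplicative group generated by `q`. -/
def QFree (q x : ℂ) : Prop := ∀ i : ℤ, x * q ^ i ≠ 1

theorem QFree.sub_ne_zero {q x : ℂ} (h : QFree q x) {y : ℂ} (i : ℤ) (hy : y = x * q ^ i) :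
    1 - y ≠ 0 := by
  rw [hy]; exact fun e => h i (by linear_combination -e)

theorem QFree.qPoch_ne_zero {q x : ℂ} (hq : q ≠ 0) (h : QFree q x) {y : ℂ} (i : ℤ)
    (hy : y = x * q ^ i) (n : ℕ) : qPoch y q n ≠ 0 :=
  qPoch_ne_zero_iff.2 fun j _ => h.sub_ne_zero (i + j) (by
    rw [hy, zpow_add₀ hq, zpow_natCast]; ring)

theorem QFree.mul_zpow {q x : ℂ} (hq : q ≠ 0) (h : QFree q x) (i : ℤ) : QFree q (x * q ^ i) :=
  fun j => by rw [mul_assoc, ← zpow_add₀ hq]; exact h _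

/-- `q` is not a root of unity. -/
def QGeneric (q : ℂ) : Prop := ∀ i : ℤ, i ≠ 0 → q ^ i ≠ 1

theorem QGeneric.qPoch_ne_zero {q : ℂ} (h : QGeneric q) (n : ℕ) : qPoch q q n ≠ 0 :=
  qPoch_ne_zero_iff.2 fun j _ e => h (j + 1) (by omega) (by
    rw [show ((j : ℤ) + 1) = ((j + 1 : ℕ) : ℤ) by push_cast; rfl, zpow_natCast, pow_succ]
    linear_combination -e)

theorem QGeneric.sub_ne_zero {q : ℂ} (h : QGeneric q) {y : ℂ} (i : ℤ) (hi : i ≠ 0)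
    (hy : y = q ^ i) : 1 - y ≠ 0 := by
  rw [hy]; exact fun e => h i hi (by linear_combination -e)

theorem qPoch_eq_zero {q : ℂ} {m n : ℕ} (hq : q ≠ 0) (h : m < n) :
    qPoch (q ^ (-(m : ℤ))) q n = 0 := by
  refine Finset.prod_eq_zero (Finset.mem_range.2 h) ?_
  rw [zpow_neg, zpow_natCast, inv_mul_cancel₀ (pow_ne_zero m hq), sub_self]

/-! ### Telescoping -/

/-- Creative telescoping: a first order recurrence for a terminating sum. -/
theorem sum_recurrence {F₁ F₀ G : ℕ → ℂ} {r s : ℂ} {m n : ℕ} (hmn : m ≤ n)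
    (h : ∀ j, r * F₁ j - s * F₀ j = G (j + 1) - G j) (h0 : G 0 = 0) (hn : G n = 0)
    (hF : ∀ j, m ≤ j → F₀ j = 0) :
    r * ∑ j ∈ Finset.range n, F₁ j = s * ∑ j ∈ Finset.range m, F₀ j := by
  have e : ∑ j ∈ Finset.range m, F₀ j = ∑ j ∈ Finset.range n, F₀ j :=
    Finset.sum_subset (Finset.range_subset_range.2 hmn) fun j _ hj =>
      hF j (not_lt.1 fun hh => hj (Finset.mem_range.2 hh))
  rw [e, Finset.mul_sum, Finset.mul_sum, ← sub_eq_zero, ← Finset.sum_sub_distrib,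
    Finset.sum_congr rfl fun j _ => h j, Finset.sum_range_sub, h0, hn, sub_self]

/-- The certificates `G` below carry quotients `(1 - x q^(j-1)) / (x; q)_j`. At `j + 1` each
collapses to `1 / (x; q)_j`, the denominator shared by the two summands; at `j` it leaves the linear
factor in the numerator. -/
theorem div_qPoch_succ {x q y : ℂ} {j : ℕ} (h : 1 - x * q ^ j ≠ 0) (hy : y = x * q ^ j) :
    (1 - y) / qPoch x q (j + 1) = (qPoch x q j)⁻¹ := by
  rw [hy, qPoch_succ, div_mul_eq_div_div_swap, div_self h, one_div]

theorem qPoch_mul_right {x q : ℂ} (h : 1 - x ≠ 0) (n : ℕ) :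
    qPoch (x * q) q n = qPoch x q n * ((1 - x * q ^ n) / (1 - x)) := by
  rw [← mul_div_assoc, eq_div_iff h, mul_comm, qPoch_shift]

theorem inv_qPoch_of_mul_right {x q : ℂ} {n : ℕ} (h : 1 - x ≠ 0) (h' : 1 - x * q ^ n ≠ 0) :
    (qPoch x q n)⁻¹ = (qPoch (x * q) q n)⁻¹ * ((1 - x * q ^ n) / (1 - x)) := by
  rw [qPoch_mul_right h, mul_inv, mul_assoc, inv_mul_cancel₀ (div_ne_zero h' h), mul_one]

theorem inv_qPoch_mul_right {x q : ℂ} (h : 1 - x ≠ 0) (n : ℕ) :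
    (qPoch (x * q) q n)⁻¹ = (qPoch x q n)⁻¹ * ((1 - x) / (1 - x * q ^ n)) := by
  rw [qPoch_mul_right h, mul_inv, inv_div]

theorem qPoch_inv_pow_eq_zero {q : ℂ} {m n : ℕ} (hq : q ≠ 0) (h : m < n) :
    qPoch (q ^ m)⁻¹ q n = 0 := by
  rw [← zpow_natCast, ← zpow_neg]; exact qPoch_eq_zero hq h

theorem eq_div_of_mul_eq_mul_div {r s X n d : ℂ} (hr : r ≠ 0) (h : r * X = s * (n / d)) :
    X = n * s / (d * r) := by
  rw [div_mul_eq_div_div, eq_div_iff hr, mul_comm, h]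
  ring

/-- Lifts a rational identity in `x = q^j` to one between summands: `H` is the quotient of
`q`-shifted factorials common to all of them. -/
theorem mul_combination {r s x A B κ C D H E F : ℂ} (h : r * x * A - s * x * B = κ * (C - D))
    (hE : E = H * (κ * C)) (hF : F = H * (κ * D)) :
    r * (H * (x * A)) - s * (H * (x * B)) = E - F := by
  rw [hE, hF]; linear_combination H * h

theorem eq_div_mul_of_mul_eq_mul {r s X Y : ℂ} (hr : r ≠ 0) (h : r * X = s * Y) :
    X = s / r * Y := by
  rw [div_mul_eq_mul_div, eq_div_iff hr, mul_comm, h]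

/-! ### Jackson's sum -/

/-- The general term of a very-well-poised `₈φ₇` series with argument `q`. -/
noncomputable def vwpTerm (a b c d e f q : ℂ) (j : ℕ) : ℂ :=
  (1 - a * q ^ (2 * j)) / (1 - a)
    * (qPoch a q j * qPoch b q j * qPoch c q j * qPoch d q j * qPoch e q j * qPoch f q j)
    * ((qPoch q q j)⁻¹ * (qPoch (a * q / b) q j)⁻¹ * (qPoch (a * q / c) q j)⁻¹
      * (qPoch (a * q / d) q j)⁻¹ * (qPoch (a * q / e) q j)⁻¹ * (qPoch (a * q / f) q j)⁻¹) * q ^ j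

/-- The rational certificate behind Jackson's sum, with `Q = q^N` and `x = q^j`: what is left of the
telescoping relation between the lengths `N + 1` and `N` after division by the common `q`-shifted
factorials. -/
theorem jackson_telescope {a b c d q Q x e : ℂ} (ha : a ≠ 0) (hb : b ≠ 0) (hc : c ≠ 0)
    (hd : d ≠ 0) (hq : q ≠ 0) (hQ : Q ≠ 0) (h1 : 1 - a ≠ 0)
    (he : e = a ^ 2 * q * Q / (b * c * d)) (h2 : 1 - e ≠ 0)
    (h3 : 1 - b * c * d / (a * q * Q) ≠ 0) (h4 : 1 - a * q * Q * x ≠ 0)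
    (h5 : 1 - 1 / (q * Q) ≠ 0) :
    (1 - a * q * Q / b) * (1 - a * q * Q / c) * (1 - a * q * Q / d)
        * (1 - a * q * Q / (b * c * d)) * x
        * ((1 - a * x ^ 2) * (1 - e * x) * (1 - b * c * d / (a * q * Q) * x) * (1 - a * q * Q)
          / ((1 - a) * (1 - e) * (1 - b * c * d / (a * q * Q)) * (1 - a * q * Q * x)))
      - (1 - a * q * Q) * (1 - a * q * Q / (b * c)) * (1 - a * q * Q / (b * d))
        * (1 - a * q * Q / (c * d)) * x
        * ((1 - a * x ^ 2) * (1 - 1 / (q * Q) * x) / ((1 - a) * (1 - 1 / (q * Q))))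
    = -(a * q * Q / (b * c * d)) * (1 - e * q * Q) * (1 - a * q * Q)
        / ((1 - a) * (1 - e) * (1 - 1 / (q * Q)))
      * ((1 - a * x) * (1 - b * x) * (1 - c * x) * (1 - d * x) * (1 - e * x)
          * (1 - 1 / (q * Q) * x) / (1 - a * q * Q * x)
        - (1 - x) * (1 - a / b * x) * (1 - a / c * x) * (1 - a / d * x)
          * (1 - b * c * d / (a * q * Q) * x)) := by
  have h2' : b * c * d - a ^ 2 * q * Q ≠ 0 := fun h => h2 (by
    rw [he]; field_simp; rw [h, mul_zero])
  have h5' : q * Q - 1 ≠ 0 := fun h => h5 (by field_simp; rw [h, mul_zero])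
  have h3' : a * q * Q - b * c * d ≠ 0 := fun h => h3 (by field_simp; rw [h, mul_zero])
  subst he
  field_simp
  ring

/-- Jackson's summation of a terminating balanced very-well-poised `₈φ₇` series. -/
theorem jackson_sum {a b c d q : ℂ} (ha0 : a ≠ 0) (hb0 : b ≠ 0) (hc0 : c ≠ 0) (hd0 : d ≠ 0)
    (hq0 : q ≠ 0) (hq : QGeneric q) (ha : QFree q a) (hb : QFree q (a / b)) (hc : QFree q (a / c))
    (hd : QFree q (a / d)) (hbcd : QFree q (a / (b * c * d)))
    (he : QFree q (a ^ 2 / (b * c * d))) (N : ℕ) :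
    ∑ j ∈ Finset.range (N + 1), vwpTerm a b c d (a ^ 2 * q ^ (N + 1) / (b * c * d)) (q ^ N)⁻¹ q j
      = qPoch (a * q) q N * qPoch (a * q / (b * c)) q N * qPoch (a * q / (b * d)) q N
          * qPoch (a * q / (c * d)) q N
        / (qPoch (a * q / b) q N * qPoch (a * q / c) q N * qPoch (a * q / d) q N
          * qPoch (a * q / (b * c * d)) q N) := by
  have hbcd' : QFree q (b * c * d / a) := fun i h => hbcd (-i) (by
    rw [zpow_neg]
    have := zpow_ne_zero i hq0
    field_simp at h ⊢
    exact h.symm)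
  have hqn : ∀ n : ℕ, q ^ n ≠ 0 := fun n => pow_ne_zero n hq0
  have z1 : ∀ n : ℕ, q ^ ((n : ℤ) + 1) = q ^ n * q := fun n => by
    rw [zpow_add_one₀ hq0, zpow_natCast]
  have n1 : 1 - a ≠ 0 := ha.sub_ne_zero 0 (by simp)
  induction N with
  | zero => simp [vwpTerm, qPoch, div_self n1]
  | succ N ih =>
    obtain ⟨Q, hQ⟩ : ∃ Q, Q = q ^ N := ⟨_, rfl⟩
    have hQ0 : Q ≠ 0 := hQ ▸ hqn N
    obtain ⟨e, he_def⟩ : ∃ e, e = a ^ 2 * q * Q / (b * c * d) := ⟨_, rfl⟩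
    have n2 : 1 - e ≠ 0 := he.sub_ne_zero (N + 1) (by rw [z1, he_def, hQ]; ring)
    have n3 : 1 - b * c * d / (a * q * Q) ≠ 0 := hbcd'.sub_ne_zero (-(N + 1)) (by
      rw [zpow_neg, z1, ← hQ]; field_simp)
    have n5 : 1 - 1 / (q * Q) ≠ 0 := hq.sub_ne_zero (-(N + 1)) (by omega) (by
      rw [zpow_neg, z1, ← hQ]; field_simp)
    have n6 : 1 - a * q * Q / b ≠ 0 := hb.sub_ne_zero (N + 1) (by rw [z1, ← hQ]; ring)
    have n7 : 1 - a * q * Q / c ≠ 0 := hc.sub_ne_zero (N + 1) (by rw [z1, ← hQ]; ring)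
    have n8 : 1 - a * q * Q / d ≠ 0 := hd.sub_ne_zero (N + 1) (by rw [z1, ← hQ]; ring)
    have n9 : 1 - a * q * Q / (b * c * d) ≠ 0 :=
      hbcd.sub_ne_zero (N + 1) (by rw [z1, ← hQ]; ring)
    have n10 : 1 - a * q * Q ≠ 0 := ha.sub_ne_zero (N + 1) (by rw [z1, ← hQ]; ring)
    let κ : ℂ := -(a * q * Q / (b * c * d)) * (1 - e * q * Q) * (1 - a * q * Q)
        / ((1 - a) * (1 - e) * (1 - 1 / (q * Q)))
    -- The factor `1 - q^j` makes `G 0` vanish, and `(q^(-N-1); q)_j` makes `G (N + 2)` vanish.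
    let G : ℕ → ℂ := fun j => κ
      * (qPoch a q j * qPoch b q j * qPoch c q j * qPoch d q j * qPoch e q j
          * qPoch (1 / (q * Q)) q j)
      * ((1 - q ^ j) / qPoch q q j) * ((1 - a / b * q ^ j) / qPoch (a * q / b) q j)
      * ((1 - a / c * q ^ j) / qPoch (a * q / c) q j)
      * ((1 - a / d * q ^ j) / qPoch (a * q / d) q j)
      * ((1 - b * c * d / (a * q * Q) * q ^ j) / qPoch (b * c * d / (a * Q)) q j)
      * (qPoch (a * q * Q) q j)⁻¹
    have hrec : (1 - a * q * Q / b) * (1 - a * q * Q / c) * (1 - a * q * Q / d)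
          * (1 - a * q * Q / (b * c * d)) * ∑ j ∈ Finset.range (N + 1 + 1),
            vwpTerm a b c d (a ^ 2 * q ^ (N + 1 + 1) / (b * c * d)) (q ^ (N + 1))⁻¹ q j
        = (1 - a * q * Q) * (1 - a * q * Q / (b * c)) * (1 - a * q * Q / (b * d))
          * (1 - a * q * Q / (c * d)) * ∑ j ∈ Finset.range (N + 1),
            vwpTerm a b c d (a ^ 2 * q ^ (N + 1) / (b * c * d)) (q ^ N)⁻¹ q j := by
      refine sum_recurrence (G := G) (by omega) ?_ (by simp [G]) ?_ ?_
      · intro j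
        obtain ⟨x, hx⟩ : ∃ x, x = q ^ j := ⟨_, rfl⟩
        have n4 : 1 - a * q * Q * x ≠ 0 := ha.sub_ne_zero (N + 1 + j) (by
          rw [zpow_add₀ hq0, z1, zpow_natCast, ← hQ, ← hx]; ring)
        have n11 : 1 - b * c * d / (a * q * Q) * x ≠ 0 := hbcd'.sub_ne_zero (j - (N + 1)) (by
          rw [zpow_sub₀ hq0, z1, zpow_natCast, ← hQ, ← hx]; field_simp)
        have m1 : 1 - q * x ≠ 0 := hq.sub_ne_zero (j + 1) (by omega) (by rw [z1, hx]; ring)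
        have m2 : 1 - a * q / b * x ≠ 0 := hb.sub_ne_zero (j + 1) (by rw [z1, hx]; ring)
        have m3 : 1 - a * q / c * x ≠ 0 := hc.sub_ne_zero (j + 1) (by rw [z1, hx]; ring)
        have m4 : 1 - a * q / d * x ≠ 0 := hd.sub_ne_zero (j + 1) (by rw [z1, hx]; ring)
        have m5 : 1 - b * c * d / (a * Q) * x ≠ 0 := hbcd'.sub_ne_zero (j - N) (by
          rw [zpow_sub₀ hq0, zpow_natCast, zpow_natCast, ← hQ, ← hx]; field_simp)
        -- From `N` to `N + 1` the parameter `e` becomes `e q` and `q^(-N)` becomes `q^(-N-1)`. Both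
        -- summands are expressed through the same factorials: `e` and `q^(-N-1)` in the numerator,
        -- `aq/e = bcd/(aQ)` and `aqQ` in the denominator.
        have hF₁ : vwpTerm a b c d (a ^ 2 * q ^ (N + 1 + 1) / (b * c * d)) (q ^ (N + 1))⁻¹ q j
            = (qPoch a q j * qPoch b q j * qPoch c q j * qPoch d q j * qPoch e q j
                * qPoch (1 / (q * Q)) q j)
              * ((qPoch q q j)⁻¹ * (qPoch (a * q / b) q j)⁻¹ * (qPoch (a * q / c) q j)⁻¹
                * (qPoch (a * q / d) q j)⁻¹ * (qPoch (b * c * d / (a * Q)) q j)⁻¹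
                * (qPoch (a * q * Q) q j)⁻¹)
              * (x * ((1 - a * x ^ 2) * (1 - e * x) * (1 - b * c * d / (a * q * Q) * x)
                * (1 - a * q * Q)
                / ((1 - a) * (1 - e) * (1 - b * c * d / (a * q * Q)) * (1 - a * q * Q * x)))) := by
          rw [vwpTerm, show a ^ 2 * q ^ (N + 1 + 1) / (b * c * d) = e * q by rw [he_def, hQ]; ring,
            qPoch_mul_right n2,
            show a * q / (e * q) = b * c * d / (a * q * Q) by rw [he_def]; field_simp,
            inv_qPoch_of_mul_right n3 (by rwa [← hx]),
            show b * c * d / (a * q * Q) * q = b * c * d / (a * Q) by field_simp,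
            show a * q / (q ^ (N + 1))⁻¹ = a * q * Q * q by rw [hQ, pow_succ]; field_simp,
            inv_qPoch_mul_right n10,
            show (q ^ (N + 1))⁻¹ = 1 / (q * Q) by rw [hQ, pow_succ]; field_simp,
            show q ^ (2 * j) = x ^ 2 by rw [hx]; ring, ← hx]
          simp only [div_eq_mul_inv, mul_inv]
          ring
        have hF₀ : vwpTerm a b c d (a ^ 2 * q ^ (N + 1) / (b * c * d)) (q ^ N)⁻¹ q j
            = (qPoch a q j * qPoch b q j * qPoch c q j * qPoch d q j * qPoch e q j
                * qPoch (1 / (q * Q)) q j)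
              * ((qPoch q q j)⁻¹ * (qPoch (a * q / b) q j)⁻¹ * (qPoch (a * q / c) q j)⁻¹
                * (qPoch (a * q / d) q j)⁻¹ * (qPoch (b * c * d / (a * Q)) q j)⁻¹
                * (qPoch (a * q * Q) q j)⁻¹)
              * (x * ((1 - a * x ^ 2) * (1 - 1 / (q * Q) * x) / ((1 - a) * (1 - 1 / (q * Q))))) := by
          rw [vwpTerm, show a ^ 2 * q ^ (N + 1) / (b * c * d) = e by rw [he_def, hQ]; ring,
            show a * q / e = b * c * d / (a * Q) by rw [he_def]; field_simp, ← hQ,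
            show a * q / Q⁻¹ = a * q * Q by field_simp,
            show Q⁻¹ = 1 / (q * Q) * q by field_simp, qPoch_mul_right n5,
            show q ^ (2 * j) = x ^ 2 by rw [hx]; ring, ← hx]
          simp only [div_eq_mul_inv, mul_inv]
          ring
        have hG : G (j + 1) = (qPoch a q j * qPoch b q j * qPoch c q j * qPoch d q j * qPoch e q j
                * qPoch (1 / (q * Q)) q j)
              * ((qPoch q q j)⁻¹ * (qPoch (a * q / b) q j)⁻¹ * (qPoch (a * q / c) q j)⁻¹
                * (qPoch (a * q / d) q j)⁻¹ * (qPoch (b * c * d / (a * Q)) q j)⁻¹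
                * (qPoch (a * q * Q) q j)⁻¹)
              * (κ * ((1 - a * x) * (1 - b * x) * (1 - c * x) * (1 - d * x) * (1 - e * x)
                * (1 - 1 / (q * Q) * x) / (1 - a * q * Q * x))) := by
          simp only [G]
          rw [div_qPoch_succ (x := q) (by rwa [← hx]) (pow_succ' q j),
            div_qPoch_succ (x := a * q / b) (by rwa [← hx]) (by ring),
            div_qPoch_succ (x := a * q / c) (by rwa [← hx]) (by ring),
            div_qPoch_succ (x := a * q / d) (by rwa [← hx]) (by ring),
            div_qPoch_succ (x := b * c * d / (a * Q)) (by rwa [← hx]) (by rw [pow_succ]; field_simp),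
            qPoch_succ (a * q * Q)]
          simp only [qPoch_succ, ← hx]
          simp only [div_eq_mul_inv, mul_inv]
          ring
        rw [hF₁, hF₀, hG]
        simp only [G, ← hx]
        exact mul_combination (κ := κ) (jackson_telescope ha0 hb0 hc0 hd0 hq0 hQ0 n1 he_def n2 n3 n4 n5) rfl
          (by simp only [div_eq_mul_inv, mul_inv]; ring)
      · simp only [G]
        rw [show 1 / (q * Q) = (q ^ (N + 1))⁻¹ by rw [pow_succ, hQ]; field_simp,
          qPoch_inv_pow_eq_zero hq0 (by omega)]
        simp
      · intro j hj
        rw [vwpTerm, qPoch_inv_pow_eq_zero hq0 (by omega)]; simp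
    rw [ih] at hrec
    rw [eq_div_of_mul_eq_mul_div (mul_ne_zero (mul_ne_zero (mul_ne_zero n6 n7) n8) n9) hrec]
    simp only [qPoch_succ, ← hQ, div_eq_mul_inv, mul_inv]
    ring

/-! ### The `q`-Pfaff–Saalschütz sum -/

/-- The rational certificate for the step from `N` to `N + 1`, again with `Q = q^N` and `x = q^j`.
Only `q^(-N)` and the denominator parameter `abq/(c q^N)` change with `N`. -/
theorem saalschuetz_telescope {a b c q Q x : ℂ} (ha : a ≠ 0) (hb : b ≠ 0) (hc : c ≠ 0)
    (hq : q ≠ 0) (hQ : Q ≠ 0) (h1 : 1 - a * b / (c * Q) ≠ 0) (h2 : 1 - 1 / (q * Q) ≠ 0) :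
    (1 - c * Q) * (1 - c / (a * b) * Q) * x
        * ((1 - a * b / (c * Q) * x) / (1 - a * b / (c * Q)))
      - (1 - c / a * Q) * (1 - c / b * Q) * x * ((1 - 1 / (q * Q) * x) / (1 - 1 / (q * Q)))
    = -(c * Q / (a * b)) / (1 - 1 / (q * Q))
      * ((1 - a * x) * (1 - b * x) * (1 - 1 / (q * Q) * x)
        - (1 - x) * (1 - c / q * x) * (1 - a * b / (c * Q) * x)) := by
  have n1 : c * Q - a * b ≠ 0 := fun h => h1 (by field_simp; rw [h, mul_zero])
  have n2 : Q * q - 1 ≠ 0 := fun h => h2 (by field_simp; rw [mul_comm q, h, mul_zero])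
  field_simp
  ring

/-- The `q`-Pfaff–Saalschütz summation of a terminating balanced `₃φ₂` series. -/
theorem saalschuetz_sum {a b c q : ℂ} (ha0 : a ≠ 0) (hb0 : b ≠ 0) (hc0 : c ≠ 0)
    (hq0 : q ≠ 0) (hq : QGeneric q) (hc : QFree q c) (hab : QFree q (c / (a * b))) (N : ℕ) :
    ∑ j ∈ Finset.range (N + 1), qPoch a q j * qPoch b q j * qPoch (q ^ N)⁻¹ q j
        * ((qPoch q q j)⁻¹ * (qPoch c q j)⁻¹ * (qPoch (a * b * q / (c * q ^ N)) q j)⁻¹) * q ^ j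
      = qPoch (c / a) q N * qPoch (c / b) q N / (qPoch c q N * qPoch (c / (a * b)) q N) := by
  have hab' : QFree q (a * b / c) := fun i h => hab (-i) (by
    rw [zpow_neg]
    have := zpow_ne_zero i hq0
    field_simp at h ⊢
    exact h.symm)
  have hqn : ∀ n : ℕ, q ^ n ≠ 0 := fun n => pow_ne_zero n hq0
  have z1 : ∀ n : ℕ, q ^ ((n : ℤ) + 1) = q ^ n * q := fun n => by
    rw [zpow_add_one₀ hq0, zpow_natCast]
  induction N with
  | zero => simp [qPoch]
  | succ N ih =>
    obtain ⟨Q, hQ⟩ : ∃ Q, Q = q ^ N := ⟨_, rfl⟩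
    have hQ0 : Q ≠ 0 := hQ ▸ hqn N
    have n3 : 1 - a * b / (c * Q) ≠ 0 := hab'.sub_ne_zero (-N) (by
      rw [zpow_neg, zpow_natCast, ← hQ]; field_simp)
    have n5 : 1 - 1 / (q * Q) ≠ 0 := hq.sub_ne_zero (-(N + 1)) (by omega) (by
      rw [zpow_neg, z1, ← hQ]; field_simp)
    have n6 : 1 - c * Q ≠ 0 := hc.sub_ne_zero N (by rw [zpow_natCast, ← hQ])
    have n7 : 1 - c / (a * b) * Q ≠ 0 := hab.sub_ne_zero N (by rw [zpow_natCast, ← hQ])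
    let κ : ℂ := -(c * Q / (a * b)) / (1 - 1 / (q * Q))
    let G : ℕ → ℂ := fun j => κ * (qPoch a q j * qPoch b q j * qPoch (1 / (q * Q)) q j)
      * ((1 - q ^ j) / qPoch q q j) * ((1 - c / q * q ^ j) / qPoch c q j)
      * ((1 - a * b / (c * Q) * q ^ j) / qPoch (a * b * q / (c * Q)) q j)
    have hrec : (1 - c * Q) * (1 - c / (a * b) * Q) * ∑ j ∈ Finset.range (N + 1 + 1),
          qPoch a q j * qPoch b q j * qPoch (q ^ (N + 1))⁻¹ q j
            * ((qPoch q q j)⁻¹ * (qPoch c q j)⁻¹ * (qPoch (a * b * q / (c * q ^ (N + 1))) q j)⁻¹)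
            * q ^ j
        = (1 - c / a * Q) * (1 - c / b * Q) * ∑ j ∈ Finset.range (N + 1),
          qPoch a q j * qPoch b q j * qPoch (q ^ N)⁻¹ q j
            * ((qPoch q q j)⁻¹ * (qPoch c q j)⁻¹ * (qPoch (a * b * q / (c * q ^ N)) q j)⁻¹)
            * q ^ j := by
      refine sum_recurrence (G := G) (by omega) ?_ (by simp [G]) ?_ ?_
      · intro j
        obtain ⟨x, hx⟩ : ∃ x, x = q ^ j := ⟨_, rfl⟩
        have n11 : 1 - a * b / (c * Q) * x ≠ 0 := hab'.sub_ne_zero (j - N) (by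
          rw [zpow_sub₀ hq0, zpow_natCast, zpow_natCast, ← hQ, ← hx]; field_simp)
        have m1 : 1 - q * x ≠ 0 := hq.sub_ne_zero (j + 1) (by omega) (by rw [z1, hx]; ring)
        have m2 : 1 - c * x ≠ 0 := hc.sub_ne_zero j (by rw [zpow_natCast, hx])
        have m5 : 1 - a * b * q / (c * Q) * x ≠ 0 := hab'.sub_ne_zero (j + 1 - N) (by
          rw [zpow_sub₀ hq0, z1, zpow_natCast, ← hQ, ← hx]; field_simp)
        have e₁ : qPoch (q ^ (N + 1))⁻¹ q j = qPoch (1 / (q * Q)) q j := by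
          rw [hQ, pow_succ]; congr 1; field_simp
        have e₂ : (qPoch (a * b * q / (c * q ^ (N + 1))) q j)⁻¹
            = (qPoch (a * b * q / (c * Q)) q j)⁻¹
              * ((1 - a * b / (c * Q) * x) / (1 - a * b / (c * Q))) := by
          rw [show a * b * q / (c * q ^ (N + 1)) = a * b / (c * Q) by
            rw [hQ, pow_succ]; field_simp, inv_qPoch_of_mul_right n3 (by rwa [← hx]), ← hx,
            div_mul_eq_mul_div]
        have e₃ : qPoch (q ^ N)⁻¹ q j
            = qPoch (1 / (q * Q)) q j * ((1 - 1 / (q * Q) * x) / (1 - 1 / (q * Q))) := by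
          rw [← hQ, show Q⁻¹ = 1 / (q * Q) * q by field_simp, qPoch_mul_right n5, ← hx]
        have hG : G (j + 1) = (qPoch a q j * qPoch b q j * qPoch (1 / (q * Q)) q j)
              * ((qPoch q q j)⁻¹ * (qPoch c q j)⁻¹ * (qPoch (a * b * q / (c * Q)) q j)⁻¹)
              * (κ * ((1 - a * x) * (1 - b * x) * (1 - 1 / (q * Q) * x))) := by
          simp only [G]
          rw [div_qPoch_succ (x := q) (by rwa [← hx]) (pow_succ' q j),
            div_qPoch_succ (x := c) (by rwa [← hx]) (by rw [pow_succ]; field_simp),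
            div_qPoch_succ (x := a * b * q / (c * Q)) (by rwa [← hx]) (by rw [pow_succ]; ring)]
          simp only [qPoch_succ, ← hx]
          ring
        rw [e₁, e₂, e₃, hG, ← hQ]
        simp only [G, ← hx]
        linear_combination (qPoch a q j * qPoch b q j * qPoch (1 / (q * Q)) q j)
          * ((qPoch q q j)⁻¹ * (qPoch c q j)⁻¹ * (qPoch (a * b * q / (c * Q)) q j)⁻¹)
          * saalschuetz_telescope (x := x) ha0 hb0 hc0 hq0 hQ0 n3 n5
      · simp only [G]
        rw [show 1 / (q * Q) = (q ^ (N + 1))⁻¹ by rw [pow_succ, hQ]; field_simp,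
          qPoch_inv_pow_eq_zero hq0 (by omega)]
        simp
      · intro j hj
        rw [qPoch_inv_pow_eq_zero hq0 (by omega)]; simp
    rw [ih] at hrec
    rw [eq_div_of_mul_eq_mul_div (mul_ne_zero n6 n7) hrec]
    simp only [qPoch_succ, ← hQ, div_eq_mul_inv, mul_inv]
    ring

/-! ### Quadratic sums in the bases `q` and `q^2` -/

/-- The common factor of the terms of the quadratic sums with one base `q` and one base `q ^ 2`. -/
noncomputable def quadTerm (A B C D q : ℂ) (j : ℕ) : ℂ :=
  (qPoch A q j * qPoch B q j * qPoch C (q ^ 2) j * qPoch D (q ^ 2) j)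
    * ((qPoch q q j)⁻¹ * (qPoch (A * q / B) q j)⁻¹ * (qPoch (A ^ 2 * q ^ 2 / C) (q ^ 2) j)⁻¹
      * (qPoch (A ^ 2 * q ^ 2 / D) (q ^ 2) j)⁻¹) * q ^ j

theorem sq_zpow (q : ℂ) (i : ℤ) : (q ^ 2) ^ i = (q ^ i) ^ 2 := by
  rw [← zpow_natCast q 2, ← zpow_mul, ← zpow_natCast (q ^ i), ← zpow_mul, mul_comm]

theorem QGeneric.zpow_ne_neg_one {q : ℂ} (h : QGeneric q) (i : ℤ) : q ^ i ≠ -1 := by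
  intro e
  rcases eq_or_ne i 0 with rfl | hi
  · norm_num at e
  · refine h (i * 2) (by omega) ?_
    rw [zpow_mul, e]; norm_num

/-- Opposite parameters merge: `(x; q)_j (-x; q)_j = (x^2; q^2)_j`, in the numerator and, because
the series is well-poised, in the denominator as well. -/
theorem vwpTerm_eq_quadTerm (A B γ f q : ℂ) (j : ℕ) :
    vwpTerm A B γ (-γ) (-f) f q j
      = (1 - A * q ^ (2 * j)) / (1 - A) * quadTerm A B (γ ^ 2) (f ^ 2) q j := by
  simp only [vwpTerm, quadTerm]
  rw [← qPoch_mul_neg γ, ← qPoch_mul_neg f,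
    show A ^ 2 * q ^ 2 / γ ^ 2 = (A * q / γ) ^ 2 by ring,
    show A ^ 2 * q ^ 2 / f ^ 2 = (A * q / f) ^ 2 by ring, ← qPoch_mul_neg, ← qPoch_mul_neg,
    show A * q / -γ = -(A * q / γ) by ring, show A * q / -f = -(A * q / f) by ring]
  simp only [mul_inv]
  ring

/-- Jackson's sum with parameters `c, -c` and `-q ^ (-N)`, written in the bases `q` and `q ^ 2`. -/
theorem jackson_quadratic {A B C q : ℂ} {N : ℕ} (hA0 : A ≠ 0) (hB0 : B ≠ 0) (hC0 : C ≠ 0)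
    (hq0 : q ≠ 0) (hq : QGeneric q) (hBC : B * C = A ^ 2 * q ^ (2 * N + 1)) (hA : QFree q A)
    (hAB : QFree q (A / B)) (hAC : QFree (q ^ 2) (A ^ 2 / C)) (hABC : QFree q (-A / (B * C))) :
    ∑ j ∈ Finset.range (N + 1),
        (1 - A * q ^ (2 * j)) / (1 - A) * quadTerm A B C (q ^ (2 * N))⁻¹ q j
      = qPoch (A * q) q N * qPoch (-A * q / C) q N * qPoch (A ^ 2 * q ^ 2 / (B ^ 2 * C)) (q ^ 2) N
        / (qPoch (A * q / B) q N * qPoch (A ^ 2 * q ^ 2 / C) (q ^ 2) N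
          * qPoch (-A * q / (B * C)) q N) := by
  obtain ⟨γ, hγ⟩ := IsAlgClosed.exists_pow_nat_eq C two_pos
  subst hγ
  have hγ0 : γ ≠ 0 := fun h => hC0 (by simp [h])
  have hqN : q ^ N ≠ 0 := pow_ne_zero N hq0
  have sq : ∀ z : ℂ, z ^ 2 = A ^ 2 / γ ^ 2 → QFree q z := fun z hz i h => hAC i (by
    rw [← hz, sq_zpow, ← mul_pow, h, one_pow])
  have J := jackson_sum (c := γ) (d := -γ) hA0 hB0 hγ0 (neg_ne_zero.2 hγ0) hq0 hq hA hAB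
    (sq _ (by ring)) (sq _ (by ring))
    (by rwa [show A / (B * γ * -γ) = -A / (B * γ ^ 2) by
      rw [show B * γ * -γ = -(B * γ ^ 2) by ring, div_neg, neg_div]])
    -- Here the balancing condition gives `a^2/(bcd) = -q^(-2N-1)`, and no power of a generic `q`
    -- equals `-1`.
    (fun i h => hq.zpow_ne_neg_one (i - (2 * N + 1)) (by
      rw [show B * γ * -γ = -(B * γ ^ 2) by ring, hBC] at h
      rw [zpow_sub₀ hq0, show (2 * (N : ℤ) + 1) = ((2 * N + 1 : ℕ) : ℤ) by push_cast; rfl,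
        zpow_natCast]
      have := pow_ne_zero (2 * N + 1) hq0
      field_simp at h ⊢
      linear_combination -h)) N
  rw [Finset.sum_congr rfl fun j _ => by
    rw [show A ^ 2 * q ^ (N + 1) / (B * γ * -γ) = -(q ^ N)⁻¹ by
      rw [show B * γ * -γ = -(B * γ ^ 2) by ring, hBC]; field_simp; ring,
      vwpTerm_eq_quadTerm A B γ _ q]] at J
  rw [show (q ^ (2 * N))⁻¹ = ((q ^ N)⁻¹) ^ 2 by rw [inv_pow, ← pow_mul, mul_comm], J]
  rw [show A ^ 2 * q ^ 2 / (B ^ 2 * γ ^ 2) = (A * q / (B * γ)) ^ 2 by ring,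
    show A ^ 2 * q ^ 2 / γ ^ 2 = (A * q / γ) ^ 2 by ring, ← qPoch_mul_neg, ← qPoch_mul_neg,
    show A * q / (B * -γ) = -(A * q / (B * γ)) by rw [mul_neg, div_neg],
    show A * q / (γ * -γ) = -A * q / γ ^ 2 by rw [mul_neg, div_neg]; ring,
    show A * q / -γ = -(A * q / γ) by rw [div_neg],
    show A * q / (B * γ * -γ) = -A * q / (B * γ ^ 2) by rw [mul_neg, div_neg]; ring]
  ring

/-- The sum that is very-well-poised in `q^2` and Jackson's sum with `B q` in place of `B` have
summands which differ, up to constants, only in a rational function of `x = q^j`. This is the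
certificate for their difference, with `Q = q^N` and `C = A^2 Q^2/B`. -/
theorem quadratic_telescope {A B Q x : ℂ} (hB0 : B ≠ 0) (hQ : Q ≠ 0)
    (h1 : 1 - A ≠ 0) (h2 : 1 - B ≠ 0) (h3 : 1 - A / B ≠ 0) (h4 : 1 + A ≠ 0) :
    (1 - B * Q ^ 2) * (1 + A) * (1 - A ^ 2 * Q ^ 2 / B ^ 2) * x
        * ((1 - A ^ 2 * x ^ 4) / (1 - A ^ 2))
      - (1 - B) * (1 + A * Q ^ 2) * (1 + A * Q ^ 2 / B) * (1 - A / B) * x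
        * ((1 - A * x ^ 2) / (1 - A)
          * ((1 - B * x) / (1 - B) * ((1 - A / B * x) / (1 - A / B))))
    = -((B + A / B) * Q ^ 2 / ((1 - A) * (1 - B)))
      * ((1 - A * x) * (1 - B * x) * (1 - A ^ 2 * Q ^ 2 / B * x ^ 2) * (1 - 1 / Q ^ 2 * x ^ 2)
        - (1 - x) * (1 - A / B * x) * (1 - B / Q ^ 2 * x ^ 2) * (1 - A ^ 2 * Q ^ 2 * x ^ 2)) := by
  have n3 : B - A ≠ 0 := fun h => h3 (by field_simp; rw [h, mul_zero])
  have n4 : 1 - A ^ 2 ≠ 0 := by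
    rw [show 1 - A ^ 2 = (1 - A) * (1 + A) by ring]; exact mul_ne_zero h1 h4
  rw [show (1 - A ^ 2 * x ^ 4) / (1 - A ^ 2) = (1 - A ^ 2 * x ^ 4) / ((1 - A) * (1 + A)) by
    congr 1; ring]
  field_simp
  ring

/-- The factorials are abstracted to letters. Each relation is solved for one letter, so that after
elimination only a cancellation of monomials remains and no linear factor is ever expanded. -/
theorem quadratic_product_aux {f₁ f₂ f₃ f₄ f₅ f₆ f₇ f₈ f₉ p p₀ v v₀ e A₂ u y E W w g S b c d t B : ℂ}
    (h₂ : f₂ ≠ 0) (h₃ : f₃ ≠ 0) (h₄ : f₄ ≠ 0) (h₁ : f₁ ≠ 0) (h₅ : f₅ ≠ 0)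
    (h₆ : f₆ ≠ 0) (h₇ : f₇ ≠ 0) (h₈ : f₈ ≠ 0) (h₉ : f₉ ≠ 0) (hp₀ : p₀ ≠ 0) (hv₀ : v₀ ≠ 0)
    (hu : u ≠ 0) (hE : E ≠ 0) (hg : g ≠ 0) (hS : S ≠ 0) (hd : d ≠ 0) (ht : t ≠ 0)
    (R₁ : p * y = p₀ * w * t) (R₂ : v * d * t ^ 2 = v₀ * b) (u₁ : e * u * f₉ = A₂ * f₆)
    (u₂ : E * f₂ = u * f₉ * y) (u₃ : W * f₈ * g = S * w * f₃) (u₄ : g * f₄ = c * f₇)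
    (u₅ : b * f₁ = B * f₅) :
    f₁ * f₂ * f₃ * f₄ / (f₅ * f₆ * (f₇ * f₈)) * (e * p * v / (c * v₀ * p₀))
      = B * A₂ * W / (S * d * E * t) := by
  have hy : y ≠ 0 := fun h => mul_ne_zero hE h₂ (by rw [u₂, h, mul_zero])
  obtain rfl : p = p₀ * w * t / y := by rw [eq_div_iff hy, R₁]
  obtain rfl : v = v₀ * b / (d * t ^ 2) := by
    rw [eq_div_iff (mul_ne_zero hd (pow_ne_zero 2 ht)), ← R₂]; ring
  obtain rfl : e = A₂ * f₆ / (u * f₉) := by rw [eq_div_iff (mul_ne_zero hu h₉), ← u₁]; ring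
  obtain rfl : y = E * f₂ / (u * f₉) := by rw [eq_div_iff (mul_ne_zero hu h₉), u₂]; ring
  obtain rfl : w = W * f₈ * g / (S * f₃) := by rw [eq_div_iff (mul_ne_zero hS h₃), u₃]; ring
  obtain rfl : c = g * f₄ / f₇ := by rw [eq_div_iff h₇, u₄]
  obtain rfl : b = B * f₅ / f₁ := by rw [eq_div_iff h₁, u₅]
  field_simp

/-- Brings the value inherited from Jackson's sum to closed form. The factorials whose parameters
contain `q^(-2N)` are reversed (`R₁`, `R₂`); the remaining relations either shift a factorial by one
factor or merge `(x; q)` and `(-x; q)` into base `q^2`. -/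
theorem quadratic_product {A B q : ℂ} (N : ℕ) (hA0 : A ≠ 0) (hB0 : B ≠ 0) (hq0 : q ≠ 0)
    (hA : QFree q (-A)) (hB : QFree (q ^ 2) B) (hAB : QFree q (A / B))
    (hAB' : QFree q (-(A / B))) :
    (1 - B) * (1 + A * (q ^ N) ^ 2) * (1 + A * (q ^ N) ^ 2 / B) * (1 - A / B)
      / ((1 - B * (q ^ N) ^ 2) * (1 + A) * (1 - A ^ 2 * (q ^ N) ^ 2 / B ^ 2))
      * (qPoch (A * q) q N * qPoch (-B * q / (A * q ^ (2 * N))) q N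
        * qPoch (1 / (B * q ^ (2 * N))) (q ^ 2) N
        / (qPoch (A / B) q N * qPoch (B * q ^ 2 / q ^ (2 * N)) (q ^ 2) N
          * qPoch (-1 / (A * q ^ (2 * N))) q N))
    = qPoch B (q ^ 2) N * qPoch (A ^ 2 * q ^ 2) (q ^ 2) N * qPoch (-(q * A / B)) q (2 * N)
      / (qPoch (A ^ 2 * q ^ 2 / B ^ 2) (q ^ 2) N * qPoch (1 / B) (q ^ 2) N * qPoch (-A) q (2 * N)
        * (B * q) ^ N) := by
  obtain ⟨Q, hQ⟩ : ∃ Q, Q = q ^ N := ⟨_, rfl⟩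
  have hQ0 : Q ≠ 0 := hQ ▸ pow_ne_zero N hq0
  have hQ2 : q ^ (2 * N) = Q ^ 2 := by rw [hQ]; ring
  have zN : q ^ (1 - (N : ℤ)) = q / Q := by
    rw [zpow_sub₀ hq0, zpow_one, zpow_natCast, hQ]
  have zN2 : (q ^ 2) ^ (1 - (N : ℤ)) = q ^ 2 / Q ^ 2 := by rw [sq_zpow, zN]; ring
  have R₁ := qPoch_reverse hq0 (x := -(A / B) * Q) (y := -A * Q * q) (by simp; tauto)
    (by simp; tauto) N
  have R₂ := qPoch_reverse (pow_ne_zero 2 hq0) (x := B * q ^ 2) (y := 1 / B) (by simp; tauto)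
    (by simp; tauto) N
  rw [zN, show q / Q / (-(A / B) * Q) = -B * q / (A * Q ^ 2) by field_simp,
    show q / Q / (-A * Q * q) = -1 / (A * Q ^ 2) by field_simp,
    show (-A * Q * q) ^ N = (-(A / B) * Q) ^ N * (B * q) ^ N by
      rw [← mul_pow]; congr 1; field_simp] at R₁
  rw [zN2, show q ^ 2 / Q ^ 2 / (B * q ^ 2) = 1 / (B * Q ^ 2) by field_simp,
    show q ^ 2 / Q ^ 2 / (1 / B) = B * q ^ 2 / Q ^ 2 by field_simp,
    show (B * q ^ 2) ^ N = (1 / B) ^ N * ((B * q) ^ 2) ^ N by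
      rw [← mul_pow]; congr 1; field_simp] at R₂
  have u₁ : qPoch (A * q) q N * qPoch (-A) q N * (1 + A * Q)
      = qPoch (A ^ 2 * q ^ 2) (q ^ 2) N * (1 + A) := by
    rw [show A ^ 2 * q ^ 2 = (A * q) ^ 2 by ring, ← qPoch_mul_neg]
    have := qPoch_shift (-A) q N
    rw [← hQ] at this
    rw [show -(A * q) = -A * q by ring]
    linear_combination -qPoch (A * q) q N * this
  have u₂ : qPoch (-A) q (2 * N) * (1 + A * Q ^ 2)
      = qPoch (-A) q N * (1 + A * Q) * qPoch (-A * Q * q) q N := by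
    rw [two_mul, qPoch_add, ← hQ]
    have := qPoch_shift (-A * Q) q N
    rw [← hQ] at this
    linear_combination -qPoch (-A) q N * this
  have u₃ : qPoch (-(q * A / B)) q (2 * N) * (1 + A * Q / B) * qPoch (A * q / B) q N
      = qPoch (A ^ 2 * q ^ 2 / B ^ 2) (q ^ 2) N * qPoch (-(A / B) * Q) q N
        * (1 + A * Q ^ 2 / B) := by
    rw [two_mul, qPoch_add, ← hQ, show A ^ 2 * q ^ 2 / B ^ 2 = (A * q / B) ^ 2 by ring,
      ← qPoch_mul_neg, show -(q * A / B) * Q = -(A / B) * Q * q by ring,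
      show -(A * q / B) = -(q * A / B) by ring]
    have := qPoch_shift (-(A / B) * Q) q N
    rw [← hQ] at this
    linear_combination qPoch (-(q * A / B)) q N * qPoch (A * q / B) q N * this
  have u₄ : qPoch (A * q / B) q N * (1 - A / B) = qPoch (A / B) q N * (1 - A * Q / B) := by
    have := qPoch_shift (A / B) q N
    rw [← hQ, show A / B * q = A * q / B by ring] at this
    linear_combination this
  have u₅ : qPoch (B * q ^ 2) (q ^ 2) N * (1 - B) = qPoch B (q ^ 2) N * (1 - B * Q ^ 2) := by
    have := qPoch_shift B (q ^ 2) N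
    rw [show (q ^ 2) ^ N = Q ^ 2 by rw [hQ]; ring] at this
    linear_combination this
  have n0 : ∀ i : ℤ, q ^ i ≠ 0 := fun i => zpow_ne_zero i hq0
  have zQ : q ^ (N : ℤ) = Q := by rw [zpow_natCast, hQ]
  have d₁ : qPoch (-A) q N ≠ 0 := hA.qPoch_ne_zero hq0 0 (by simp) N
  have d₂ : qPoch (-A) q (2 * N) ≠ 0 := hA.qPoch_ne_zero hq0 0 (by simp) _
  have d₃ : qPoch (-A * Q * q) q N ≠ 0 := hA.qPoch_ne_zero hq0 (N + 1) (by
    rw [zpow_add_one₀ hq0, zQ]; ring) N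
  have d₄ : qPoch (A * q / B) q N ≠ 0 := hAB.qPoch_ne_zero hq0 1 (by rw [zpow_one]; ring) N
  have d₅ : qPoch (A / B) q N ≠ 0 := hAB.qPoch_ne_zero hq0 0 (by simp) N
  have d₆ : qPoch (A ^ 2 * q ^ 2 / B ^ 2) (q ^ 2) N ≠ 0 := by
    rw [show A ^ 2 * q ^ 2 / B ^ 2 = (A * q / B) ^ 2 by ring, ← qPoch_mul_neg]
    exact mul_ne_zero d₄ (hAB'.qPoch_ne_zero hq0 1 (by rw [zpow_one]; ring) N)
  have hx0 : (-(A / B) * Q) ^ N ≠ 0 := pow_ne_zero _ (by simp; tauto)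
  have hy0 : (1 / B) ^ N ≠ 0 := pow_ne_zero _ (by simp; tauto)
  have q20 : q ^ 2 ≠ 0 := pow_ne_zero 2 hq0
  have zQ2 : (q ^ 2) ^ (N : ℤ) = Q ^ 2 := by rw [sq_zpow, zQ]
  have hB' : QFree (q ^ 2) (1 / B) := fun i h => hB (-i) (by
    rw [zpow_neg]
    have := zpow_ne_zero i q20
    field_simp at h ⊢
    exact h.symm)
  rw [hQ2, show 1 - A ^ 2 * (q ^ N) ^ 2 / B ^ 2 = (1 - A * Q / B) * (1 + A * Q / B) by
    rw [hQ]; ring, ← hQ]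
  refine quadratic_product_aux ?_ ?_ ?_ ?_ ?_ ?_ ?_ ?_ ?_ ?_ ?_ d₁ d₂ d₄ d₆ ?_
    (pow_ne_zero N (mul_ne_zero hB0 hq0)) (mul_left_cancel₀ hx0 ?_) (mul_left_cancel₀ hy0 ?_)
    u₁ u₂ u₃ u₄ u₅
  · simpa using hA.sub_ne_zero (2 * N) (y := -(A * Q ^ 2)) (by
      rw [mul_comm 2, zpow_mul, zQ]; norm_cast; ring)
  · rw [show 1 + A * Q ^ 2 / B = 1 - -(A / B) * Q ^ 2 by ring]
    exact hAB'.sub_ne_zero (2 * N) (by rw [mul_comm 2, zpow_mul, zQ]; norm_cast)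
  · exact hAB.sub_ne_zero 0 (by simp)
  · exact hB.sub_ne_zero 0 (by simp)
  · exact hB.sub_ne_zero N (by rw [zQ2])
  · simpa using hA.sub_ne_zero 0 (y := -A) (by simp)
  · exact hAB.sub_ne_zero N (by rw [zQ]; ring)
  · rw [show 1 + A * Q / B = 1 - -(A / B) * Q by ring]
    exact hAB'.sub_ne_zero N (by rw [zQ])
  · simpa using hA.sub_ne_zero N (y := -(A * Q)) (by rw [zQ]; ring)
  · refine qPoch_ne_zero_iff.2 fun i _ h => hA (2 * N - i) ?_
    rw [zpow_sub₀ hq0, mul_comm 2, zpow_mul, zQ, zpow_natCast]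
    have := pow_ne_zero i hq0
    norm_cast
    field_simp at h ⊢
    linear_combination -h
  · exact hB.qPoch_ne_zero q20 (1 - N) (by rw [zN2]; ring) N
  · exact hB'.qPoch_ne_zero q20 0 (by simp) N
  · linear_combination R₁
  · rw [← pow_mul, mul_comm N 2, pow_mul]
    linear_combination R₂

/-- A quadratic summation formula, very-well-poised in the base `q ^ 2`. -/
theorem quadratic_sum {A B C q : ℂ} {N : ℕ} (hA0 : A ≠ 0) (hB0 : B ≠ 0)
    (hq0 : q ≠ 0) (hq : QGeneric q) (hBC : B * C = A ^ 2 * q ^ (2 * N)) (hA : QFree q A)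
    (hA' : QFree q (-A)) (hB : QFree (q ^ 2) B) (hAB : QFree q (A / B))
    (hAB' : QFree q (-(A / B))) (hA2 : QFree (q ^ 2) (A ^ 2)) :
    ∑ j ∈ Finset.range (N + 1),
        (1 - A ^ 2 * q ^ (4 * j)) / (1 - A ^ 2) * quadTerm A B C (q ^ (2 * N))⁻¹ q j
      = qPoch B (q ^ 2) N * qPoch (A ^ 2 * q ^ 2) (q ^ 2) N * qPoch (-(q * A / B)) q (2 * N)
      / (qPoch (A ^ 2 * q ^ 2 / B ^ 2) (q ^ 2) N * qPoch (1 / B) (q ^ 2) N * qPoch (-A) q (2 * N)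
        * (B * q) ^ N) := by
  obtain ⟨Q, hQ⟩ : ∃ Q, Q = q ^ N := ⟨_, rfl⟩
  have hQ0 : Q ≠ 0 := hQ ▸ pow_ne_zero N hq0
  have hQ2 : q ^ (2 * N) = Q ^ 2 := by rw [hQ]; ring
  have hC : C = A ^ 2 * Q ^ 2 / B := by rw [← hQ2, ← hBC]; field_simp
  have n1 : 1 - A ≠ 0 := hA.sub_ne_zero 0 (by simp)
  have n2 : 1 - B ≠ 0 := hB.sub_ne_zero 0 (by simp)
  have n3 : 1 - A / B ≠ 0 := hAB.sub_ne_zero 0 (by simp)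
  have n4 : 1 + A ≠ 0 := by simpa using hA'.sub_ne_zero 0 (y := -A) (by simp)
  have n5 : 1 - B * Q ^ 2 ≠ 0 := hB.sub_ne_zero N (by rw [sq_zpow, zpow_natCast, hQ])
  have n6 : 1 - A ^ 2 * Q ^ 2 / B ^ 2 ≠ 0 := by
    rw [show 1 - A ^ 2 * Q ^ 2 / B ^ 2 = (1 - A / B * Q) * (1 - -(A / B) * Q) by ring]
    exact mul_ne_zero (hAB.sub_ne_zero N (by rw [zpow_natCast, hQ]))
      (hAB'.sub_ne_zero N (by rw [zpow_natCast, hQ]))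
  -- With `B q` instead of `B` the balancing condition becomes `(Bq) C = A^2 q^(2N+1)`, the one
  -- required by Jackson's sum.
  have J := jackson_quadratic (B := B * q) (C := C) (N := N) hA0 (mul_ne_zero hB0 hq0)
    (by rw [hC]; simp; tauto) hq0 hq (by rw [pow_succ q (2 * N)]; linear_combination q * hBC) hA
    (by
      rw [show A / (B * q) = A / B * q ^ (-1 : ℤ) by rw [zpow_neg_one]; field_simp]
      exact hAB.mul_zpow hq0 _)
    (by
      rw [show A ^ 2 / C = B * (q ^ 2) ^ (-(N : ℤ)) by
        rw [hC, zpow_neg, sq_zpow, zpow_natCast, ← hQ]; field_simp]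
      exact hB.mul_zpow (pow_ne_zero 2 hq0) _)
    (fun i h => hA' (2 * N + 1 - i) (by
      rw [show (2 * (N : ℤ) + 1) = ((2 * N + 1 : ℕ) : ℤ) by push_cast; rfl,
        zpow_sub₀ hq0, zpow_natCast, pow_succ, hQ2]
      have := zpow_ne_zero i hq0
      rw [hC] at h
      field_simp at h ⊢
      linear_combination h))
  -- Both sums have the same length, so a single comparison suffices and no induction is needed.
  have hrec := sum_recurrence (m := N + 1) (n := N + 1)
    (F₁ := fun j => (1 - A ^ 2 * q ^ (4 * j)) / (1 - A ^ 2) * quadTerm A B C (q ^ (2 * N))⁻¹ q j)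
    (F₀ := fun j => (1 - A * q ^ (2 * j)) / (1 - A) * quadTerm A (B * q) C (q ^ (2 * N))⁻¹ q j)
    (G := fun j => -((B + A / B) * Q ^ 2 / ((1 - A) * (1 - B)))
      * (qPoch A q j * qPoch B q j * qPoch C (q ^ 2) j * qPoch (q ^ (2 * N))⁻¹ (q ^ 2) j)
      * ((1 - q ^ j) / qPoch q q j) * ((1 - A / B * q ^ j) / qPoch (A * q / B) q j)
      * ((1 - B / Q ^ 2 * (q ^ 2) ^ j) / qPoch (A ^ 2 * q ^ 2 / C) (q ^ 2) j)
      * ((1 - A ^ 2 * Q ^ 2 * (q ^ 2) ^ j) / qPoch (A ^ 2 * q ^ 2 * Q ^ 2) (q ^ 2) j))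
    (r := (1 - B * Q ^ 2) * (1 + A) * (1 - A ^ 2 * Q ^ 2 / B ^ 2))
    (s := (1 - B) * (1 + A * Q ^ 2) * (1 + A * Q ^ 2 / B) * (1 - A / B)) le_rfl ?_ (by simp) ?_ ?_
  · rw [J] at hrec
    rw [eq_div_mul_of_mul_eq_mul (mul_ne_zero (mul_ne_zero n5 n4) n6) hrec,
      ← quadratic_product N hA0 hB0 hq0 hA' hB hAB hAB', hC, hQ2, ← hQ,
      show -A * q / (A ^ 2 * Q ^ 2 / B) = -B * q / (A * Q ^ 2) by field_simp,
      show A ^ 2 * q ^ 2 / ((B * q) ^ 2 * (A ^ 2 * Q ^ 2 / B)) = 1 / (B * Q ^ 2) by field_simp,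
      show A * q / (B * q) = A / B by field_simp,
      show A ^ 2 * q ^ 2 / (A ^ 2 * Q ^ 2 / B) = B * q ^ 2 / Q ^ 2 by field_simp,
      show -A * q / (B * q * (A ^ 2 * Q ^ 2 / B)) = -1 / (A * Q ^ 2) by field_simp]
  · intro j
    obtain ⟨x, hx⟩ : ∃ x, x = q ^ j := ⟨_, rfl⟩
    have z1 : q ^ ((j : ℤ) + 1) = x * q := by rw [zpow_add_one₀ hq0, zpow_natCast, hx]
    have m0 : 1 - A / B * q ^ j ≠ 0 := hAB.sub_ne_zero j (by rw [zpow_natCast])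
    have m1 : 1 - q * x ≠ 0 := hq.sub_ne_zero (j + 1) (by omega) (by rw [z1]; ring)
    have m2 : 1 - A * q / B * x ≠ 0 := hAB.sub_ne_zero (j + 1) (by rw [z1]; ring)
    have m3 : 1 - A ^ 2 * q ^ 2 / C * x ^ 2 ≠ 0 := hB.sub_ne_zero (j + 1 - N) (by
      rw [sq_zpow, zpow_sub₀ hq0, z1, zpow_natCast, ← hQ, hC]; field_simp)
    have m4 : 1 - A ^ 2 * q ^ 2 * Q ^ 2 * x ^ 2 ≠ 0 := hA2.sub_ne_zero (j + 1 + N) (by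
      rw [sq_zpow, zpow_add₀ hq0, z1, zpow_natCast, ← hQ]; ring)
    have hx2 : (q ^ 2) ^ j = x ^ 2 := by rw [hx]; ring
    have e₁ : (1 - A ^ 2 * q ^ (4 * j)) / (1 - A ^ 2) * quadTerm A B C (q ^ (2 * N))⁻¹ q j
        = (qPoch A q j * qPoch B q j * qPoch C (q ^ 2) j * qPoch (q ^ (2 * N))⁻¹ (q ^ 2) j)
          * ((qPoch q q j)⁻¹ * (qPoch (A * q / B) q j)⁻¹ * (qPoch (A ^ 2 * q ^ 2 / C) (q ^ 2) j)⁻¹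
            * (qPoch (A ^ 2 * q ^ 2 * Q ^ 2) (q ^ 2) j)⁻¹)
          * (x * ((1 - A ^ 2 * x ^ 4) / (1 - A ^ 2))) := by
      rw [quadTerm, hQ2, div_inv_eq_mul, show q ^ (4 * j) = x ^ 4 by rw [hx]; ring, ← hx]
      ring
    have e₂ : (1 - A * q ^ (2 * j)) / (1 - A) * quadTerm A (B * q) C (q ^ (2 * N))⁻¹ q j
        = (qPoch A q j * qPoch B q j * qPoch C (q ^ 2) j * qPoch (q ^ (2 * N))⁻¹ (q ^ 2) j)
          * ((qPoch q q j)⁻¹ * (qPoch (A * q / B) q j)⁻¹ * (qPoch (A ^ 2 * q ^ 2 / C) (q ^ 2) j)⁻¹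
            * (qPoch (A ^ 2 * q ^ 2 * Q ^ 2) (q ^ 2) j)⁻¹)
          * (x * ((1 - A * x ^ 2) / (1 - A)
          * ((1 - B * x) / (1 - B) * ((1 - A / B * x) / (1 - A / B))))) := by
      rw [quadTerm, hQ2, div_inv_eq_mul, show q ^ (2 * j) = x ^ 2 by rw [hx]; ring,
        qPoch_mul_right n2, show A * q / (B * q) = A / B by field_simp,
        inv_qPoch_of_mul_right n3 m0, show A / B * q = A * q / B by ring, ← hx]
      ring
    simp only [e₁, e₂]
    refine mul_combination (quadratic_telescope (x := x) hB0 hQ0 n1 n2 n3 n4) ?_ ?_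
    · rw [div_qPoch_succ (x := q) (by rwa [← hx]) (pow_succ' q j),
        div_qPoch_succ (x := A * q / B) (by rwa [← hx]) (by ring),
        div_qPoch_succ (x := A ^ 2 * q ^ 2 / C) (by rwa [hx2]) (by rw [hC]; field_simp; ring),
        div_qPoch_succ (x := A ^ 2 * q ^ 2 * Q ^ 2) (by rwa [hx2]) (by ring)]
      simp only [qPoch_succ, ← hx, hx2]
      rw [hQ2, hC]
      ring
    · rw [← hx, hx2]
      ring
  · rw [show (q ^ (2 * N))⁻¹ = ((q ^ 2) ^ N)⁻¹ by rw [pow_mul],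
      qPoch_inv_pow_eq_zero (pow_ne_zero 2 hq0) (by omega)]
    simp
  · intro j hj
    rw [quadTerm, show (q ^ (2 * N))⁻¹ = ((q ^ 2) ^ N)⁻¹ by rw [pow_mul],
      qPoch_inv_pow_eq_zero (pow_ne_zero 2 hq0) (by omega)]
    simp

/-! ### WP-Bailey pairs and their transformation -/

theorem QFree.base_sq {q x : ℂ} (h : QFree q x) : QFree (q ^ 2) x := fun i => by
  rw [show (q ^ 2) ^ i = q ^ (2 * i) by rw [zpow_mul, zpow_ofNat]]; exact h _

theorem QFree.inv {q x : ℂ} (h : QFree q x) : QFree q x⁻¹ := fun i e => h (-i) (by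
  rw [zpow_neg, ← inv_inj, mul_inv, inv_inv, e, inv_one])

theorem QFree.sq {q x : ℂ} (h : QFree q x) (h' : QFree q (-x)) : QFree (q ^ 2) (x ^ 2) :=
  fun i e => by
    rw [sq_zpow, ← mul_pow] at e
    exact (sq_eq_sq_iff_eq_or_eq_neg.1 (e.trans (one_pow 2).symm)).elim (h i) fun e => h' i (by rw [neg_mul, e, neg_neg])

/-- The kernel of a WP-Bailey pair relative to `a` and `k`. -/
noncomputable def wpKernel (a k q : ℂ) (m j : ℕ) : ℂ :=
  qPoch (k / a) q (m - j) * qPoch k q (m + j) / (qPoch q q (m - j) * qPoch (a * q) q (m + j))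

/-- The form of the kernel suited to summation over `m = j + i` for fixed `j`, as needed after
interchanging sums. -/
theorem wpKernel_add (a k q : ℂ) (i j : ℕ) :
    wpKernel a k q (j + i) j
      = qPoch k q (2 * j) / qPoch (a * q) q (2 * j) * (qPoch (k / a) q i * qPoch (k * q ^ (2 * j)) q i
        * ((qPoch q q i)⁻¹ * (qPoch (a * q * q ^ (2 * j)) q i)⁻¹)) := by
  rw [wpKernel, Nat.add_sub_cancel_left, show j + i + j = 2 * j + i by ring, qPoch_add, qPoch_add]
  simp only [div_eq_mul_inv, mul_inv]
  ring

/-- The last `j` factors of `(x; q)_m` and of `(q; q)_m` are split off and their order is reversed.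
Taking the quotient removes the powers of `q` and the signs that each reversal produces separately.
-/
theorem qPoch_sub_div {x q : ℂ} (hx : x ≠ 0) (hq0 : q ≠ 0) (hq : QGeneric q)
    (h : QFree q x) {m j : ℕ} (hj : j ≤ m) :
    qPoch x q (m - j) / qPoch q q (m - j) = qPoch x q m / qPoch q q m
      * (qPoch (q ^ m)⁻¹ q j * (qPoch (q / (x * q ^ m)) q j)⁻¹ * (q / x) ^ j) := by
  obtain ⟨i, rfl⟩ := Nat.exists_eq_add_of_le' hj
  have hqi : ∀ n : ℕ, q ^ n ≠ 0 := fun n => pow_ne_zero n hq0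
  have hz : q ^ (1 - (j : ℤ)) = q / q ^ j := by rw [zpow_sub₀ hq0, zpow_one, zpow_natCast]
  have R := qPoch_reverse hq0 (x := q / (x * q ^ (i + j))) (y := (q ^ (i + j))⁻¹)
    (div_ne_zero hq0 (mul_ne_zero hx (hqi _))) (inv_ne_zero (hqi _)) j
  have e₁ : q ^ (1 - (j : ℤ)) / (q / (x * q ^ (i + j))) = x * q ^ i := by
    rw [hz, pow_add]; have := hqi i; have := hqi j; field_simp
  have e₂ : q ^ (1 - (j : ℤ)) / (q ^ (i + j))⁻¹ = q * q ^ i := by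
    rw [hz, pow_add]; have := hqi j; field_simp
  rw [e₁, e₂] at R
  have e₃ : (q / (x * q ^ (i + j))) ^ j = (q / x) ^ j * ((q ^ (i + j))⁻¹) ^ j := by
    rw [← mul_pow]; congr 1; field_simp
  have d₀ : ((q ^ (i + j))⁻¹) ^ j ≠ 0 := pow_ne_zero _ (inv_ne_zero (hqi _))
  have R' : qPoch (x * q ^ i) q j * qPoch (q ^ (i + j))⁻¹ q j * (q / x) ^ j
      = qPoch (q * q ^ i) q j * qPoch (q / (x * q ^ (i + j))) q j :=
    mul_right_cancel₀ d₀ (by rw [e₃] at R; linear_combination R)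
  have d₁ : qPoch (q / (x * q ^ (i + j))) q j ≠ 0 :=
    h.inv.qPoch_ne_zero hq0 (1 - (i + j : ℕ)) (by
      rw [zpow_sub₀ hq0, zpow_one, zpow_natCast]; have := hqi (i + j); field_simp) j
  have d₂ : qPoch q q (i + j) ≠ 0 := hq.qPoch_ne_zero _
  rw [Nat.add_sub_cancel, qPoch_add q q i j, qPoch_add x q i j]
  rw [qPoch_add q q i j] at d₂
  rw [div_mul_eq_mul_div, div_eq_div_iff (left_ne_zero_of_mul d₂) d₂, ← div_eq_mul_inv,
    show qPoch x q i * qPoch (x * q ^ i) q j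
        * (qPoch (q ^ (i + j))⁻¹ q j / qPoch (q / (x * q ^ (i + j))) q j * (q / x) ^ j)
          * qPoch q q i
      = qPoch x q i * qPoch q q i * ((qPoch (x * q ^ i) q j * qPoch (q ^ (i + j))⁻¹ q j
        * (q / x) ^ j) / qPoch (q / (x * q ^ (i + j))) q j) by ring, R',
    mul_div_cancel_right₀ _ d₁]
  ring

/-- The form suited to summation over `j` for fixed `m`: the kernel contributes the parameters `k
q^m` and `q^(-m)` of a terminating well-poised series, together with `(aq/k)^j`. A factor `(k/a)^j`
in `α` therefore produces the argument `q`. -/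
theorem wpKernel_eq {a k q : ℂ} (ha : a ≠ 0) (hk : k ≠ 0) (hq0 : q ≠ 0) (hq : QGeneric q)
    (h : QFree q (k / a)) {m j : ℕ} (hj : j ≤ m) :
    wpKernel a k q m j = qPoch (k / a) q m * qPoch k q m / (qPoch q q m * qPoch (a * q) q m)
      * (qPoch (k * q ^ m) q j * qPoch (q ^ m)⁻¹ q j
        * ((qPoch (a * q / (k * q ^ m)) q j)⁻¹ * (qPoch (a * q * q ^ m) q j)⁻¹)
        * (a * q / k) ^ j) := by
  rw [wpKernel, mul_div_mul_comm, qPoch_sub_div (div_ne_zero hk ha) hq0 hq h hj, qPoch_add k q m j,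
    qPoch_add (a * q) q m j, show q / (k / a * q ^ m) = a * q / (k * q ^ m) by field_simp,
    show q / (k / a) = a * q / k by field_simp]
  simp only [div_eq_mul_inv, mul_inv]
  ring

/-- `(α, β)` is a WP-Bailey pair relative to `a` and `k`. -/
def IsWPBaileyPair (a k q : ℂ) (α β : ℕ → ℂ) : Prop :=
  ∀ m, β m = ∑ j ∈ Finset.range (m + 1), wpKernel a k q m j * α j

theorem qPochs_two (x y q : ℂ) (n : ℕ) : qPochs [x, y] q n = qPoch x q n * qPoch y q n := by
  simp [qPochs]

/-- The factor common to the summands on the left-hand sides. -/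
noncomputable def lhsWeight (a k q : ℂ) (n j : ℕ) : ℂ :=
  qPoch (k * q ^ (2 * n)) (q ^ 2) j * qPoch (q ^ (-2 * (n : ℤ))) (q ^ 2) j
    / (qPoch (a ^ 2 * q ^ (2 - 2 * (n : ℤ)) / k) (q ^ 2) j
      * qPoch (a ^ 2 * q ^ (2 * n + 2)) (q ^ 2) j)

/-- Elimination in abstract letters, as for the quadratic product: each relation determines one
factor in terms of the others. -/
theorem rhsFactor_aux {A₁ A₂ I M₁ B₀ K₁ M₂ bn h h₀ p r K₂ X κ α x bN S₁ W S₂ IN W₂ t Y z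
    Aj Kj m m' i b c : ℂ} (hA₂ : A₂ ≠ 0) (hS₂ : S₂ ≠ 0) (hK₂ : K₂ ≠ 0) (hS₁ : S₁ ≠ 0)
    (hKj : Kj ≠ 0) (hAj : Aj ≠ 0) (hm : m ≠ 0) (hm' : m' ≠ 0) (hW : W ≠ 0) (hW₂ : W₂ ≠ 0)
    (hb : b ≠ 0) (hbN : bN ≠ 0) (hIN : IN ≠ 0) (hX : X ≠ 0) (hY : Y ≠ 0) (hc : c ≠ 0)
    (hx : x ≠ 0) (ht : t ≠ 0) (hh : h ≠ 0) (hh₀ : h₀ ≠ 0)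
    (g₁ : A₁ * A₂ = Aj * S₂) (g₂ : K₁ * K₂ = Kj * S₁) (g₃ : M₁ = m * W₂) (g₄ : M₂ = m' * W)
    (g₅ : I = IN * i) (g₆ : B₀ = bN * b) (g₇ : κ * m * h = h₀ * Kj) (g₈ : α * m' = Aj)
    (g₉ : i * Y * c * x = b * X * z) (g₁₀ : bn = c * t) :
    A₁ * I * M₁ / (B₀ * K₁ * M₂) * bn * (h / h₀ * (p * r * (K₂⁻¹ * X⁻¹)) * (κ / α) * x)
      * (bN * S₁ * W / (S₂ * IN * W₂ * t)) = p * r / (Y * A₂) * z := by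
  obtain rfl : A₁ = Aj * S₂ / A₂ := by rw [eq_div_iff hA₂, g₁]
  obtain rfl : K₁ = Kj * S₁ / K₂ := by rw [eq_div_iff hK₂, g₂]
  obtain rfl : κ = h₀ * Kj / (m * h) := by rw [eq_div_iff (mul_ne_zero hm hh), ← g₇]; ring
  obtain rfl : α = Aj / m' := by rw [eq_div_iff hm', g₈]
  obtain rfl : i = b * X * z / (Y * c * x) := by
    rw [eq_div_iff (mul_ne_zero (mul_ne_zero hY hc) hx), ← g₉]; ring
  subst g₃ g₄ g₅ g₆ g₁₀
  field_simp

/-- Here `n = j + N`. The three factors are the prefactor, the part of the weight and kernel that is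
constant in the inner sum, and the value of that sum. Factorials of length `j + N` or `2j + 2N`
split so that the pieces depending on `N` alone cancel; what survives after one reversal (`R'`) is
the left-hand weight. -/
theorem rhsFactor_mul_quadratic_sum {a k q B K : ℂ} (ha : a ≠ 0) (hk : k ≠ 0) (hq0 : q ≠ 0)
    (hKdef : K = k / a) (hBdef : B = k / a ^ 2) (hfa : QFree q a) (hfa' : QFree q (-a))
    (hK : QFree q K) (hK' : QFree q (-K)) (hB : QFree q B) (N j : ℕ) :
    rhsFactor a k q (j + N)
      * ((1 - K ^ 2 * q ^ (4 * j)) / (1 - K ^ 2)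
        * (qPoch (k * q ^ (2 * (j + N))) (q ^ 2) j
            * qPoch (q ^ (-2 * ((j + N : ℕ) : ℤ))) (q ^ 2) j
          * ((qPoch (K ^ 2 * q ^ (2 * (j + N) + 2)) (q ^ 2) j)⁻¹
            * (qPoch (B * q ^ (2 - 2 * ((j + N : ℕ) : ℤ))) (q ^ 2) j)⁻¹))
        * (qPoch K q (2 * j) / qPoch (a * q) q (2 * j)) * q ^ j)
      * (qPoch B (q ^ 2) N * qPoch ((K * q ^ (2 * j)) ^ 2 * q ^ 2) (q ^ 2) N
          * qPoch (-(q * (K * q ^ (2 * j)) / B)) q (2 * N)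
        / (qPoch ((K * q ^ (2 * j)) ^ 2 * q ^ 2 / B ^ 2) (q ^ 2) N * qPoch (1 / B) (q ^ 2) N
          * qPoch (-(K * q ^ (2 * j))) q (2 * N) * (B * q) ^ N))
      = lhsWeight a k q (j + N) j * (q ^ 2 * a ^ 2 / k) ^ j := by
  have hB0 : B ≠ 0 := by rw [hBdef]; exact div_ne_zero hk (pow_ne_zero 2 ha)
  have hK0 : K ≠ 0 := by rw [hKdef]; exact div_ne_zero hk ha
  have q20 : q ^ 2 ≠ 0 := pow_ne_zero 2 hq0
  have hqi : ∀ n : ℕ, q ^ n ≠ 0 := fun n => pow_ne_zero n hq0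
  have zq : ∀ m : ℕ, q ^ (2 - 2 * (m : ℤ)) = q ^ 2 / q ^ (2 * m) := fun m => by
    rw [zpow_sub₀ hq0, zpow_ofNat, zpow_mul, zpow_ofNat, zpow_natCast, pow_mul]
  have R := qPoch_reverse q20 (x := B * q ^ (2 - 2 * ((j + N : ℕ) : ℤ)))
    (y := a ^ 2 * q ^ (2 - 2 * ((j + N : ℕ) : ℤ)) / k)
    (mul_ne_zero hB0 (zpow_ne_zero _ hq0))
    (div_ne_zero (mul_ne_zero (pow_ne_zero 2 ha) (zpow_ne_zero _ hq0)) hk) j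
  have e₁ : (q ^ 2) ^ (1 - (j : ℤ)) / (B * q ^ (2 - 2 * ((j + N : ℕ) : ℤ)))
      = 1 / B * (q ^ 2) ^ N := by
    rw [sq_zpow, zq, zpow_sub₀ hq0, zpow_one, zpow_natCast]
    have := hqi (2 * (j + N)); have := hqi j
    field_simp
    ring
  have e₂ : (q ^ 2) ^ (1 - (j : ℤ)) / (a ^ 2 * q ^ (2 - 2 * ((j + N : ℕ) : ℤ)) / k)
      = B * (q ^ 2) ^ N := by
    rw [sq_zpow, zq, zpow_sub₀ hq0, zpow_one, zpow_natCast, hBdef]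
    have := hqi (2 * (j + N)); have := hqi j
    field_simp
    ring
  rw [e₁, e₂] at R
  have R' : qPoch (1 / B * (q ^ 2) ^ N) (q ^ 2) j
        * qPoch (a ^ 2 * q ^ (2 - 2 * ((j + N : ℕ) : ℤ)) / k) (q ^ 2) j * (B * q) ^ j * q ^ j
      = qPoch (B * (q ^ 2) ^ N) (q ^ 2) j * qPoch (B * q ^ (2 - 2 * ((j + N : ℕ) : ℤ))) (q ^ 2) j
        * (q ^ 2 * a ^ 2 / k) ^ j := by
    have e₃ : (a ^ 2 * q ^ (2 - 2 * ((j + N : ℕ) : ℤ)) / k) ^ j * ((B * q) ^ j * q ^ j)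
        = (B * q ^ (2 - 2 * ((j + N : ℕ) : ℤ))) ^ j * (q ^ 2 * a ^ 2 / k) ^ j := by
      rw [← mul_pow, ← mul_pow, ← mul_pow, hBdef]; congr 1; field_simp
    refine mul_left_cancel₀ (pow_ne_zero j (mul_ne_zero hB0 (zpow_ne_zero
      (2 - 2 * ((j + N : ℕ) : ℤ)) hq0))) ?_
    linear_combination ((B * q) ^ j * q ^ j) * R + qPoch (B * (q ^ 2) ^ N) (q ^ 2) j
      * qPoch (B * q ^ (2 - 2 * ((j + N : ℕ) : ℤ))) (q ^ 2) j * e₃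
  have hB2 := hB.base_sq
  have hBi : QFree (q ^ 2) (1 / B) := by rw [one_div]; exact hB2.inv
  have hK2 := hK.sq hK'
  have ha2 := hfa.sq hfa'
  have w1 : ∀ m : ℕ, (q ^ 2) ^ (m : ℤ) = q ^ (2 * m) := fun m => by rw [zpow_natCast, pow_mul]
  have w2 : ∀ m : ℕ, (q ^ 2) ^ ((m : ℤ) + 1) = q ^ (2 * m + 2) := fun m => by
    rw [zpow_add_one₀ q20, w1, pow_add]
  have e₄ : (K * q ^ (2 * j)) ^ 2 * q ^ 2 / B ^ 2 = a ^ 2 * q ^ 2 * (q ^ 2) ^ (2 * j) := by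
    rw [hKdef, hBdef]; field_simp; ring
  have e₅ : -(q * (K * q ^ (2 * j)) / B) = -q * a * q ^ (2 * j) := by
    rw [hKdef, hBdef]; field_simp
  have e₆ : (K * q ^ (2 * j)) ^ 2 * q ^ 2 = K ^ 2 * q ^ 2 * (q ^ 2) ^ (2 * j) := by ring
  have g₇ : qPoch K q (2 * j) * qPoch (-K) q (2 * j) * (1 - K ^ 2 * q ^ (4 * j))
      = (1 - K ^ 2) * qPoch (K ^ 2 * q ^ 2) (q ^ 2) (2 * j) := by
    rw [qPoch_shift, qPoch_mul_neg]; congr 2; ring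
  have g₈ : qPoch (a * q) q (2 * j) * qPoch (-q * a) q (2 * j)
      = qPoch (a ^ 2 * q ^ 2) (q ^ 2) (2 * j) := by
    rw [show -q * a = -(a * q) by ring, qPoch_mul_neg]; congr 1; ring
  rw [rhsFactor, lhsWeight, qPochs_two, qPochs_two, show a ^ 2 / k = 1 / B by rw [hBdef]; field_simp,
    show -k / a = -K by rw [hKdef]; ring, show k ^ 2 * q ^ 2 / a ^ 2 = K ^ 2 * q ^ 2 by
      rw [hKdef]; ring, ← hBdef, show k * q / a ^ 2 = B * q by rw [hBdef]; ring, e₄, e₅, e₆]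
  refine rhsFactor_aux ?_ ?_ ?_ ?_ ?_ ?_ ?_ ?_ ?_ ?_ ?_ ?_ ?_ ?_ ?_ (pow_ne_zero _
    (mul_ne_zero hB0 hq0)) (hqi j) (pow_ne_zero _ (mul_ne_zero hB0 hq0)) ?_ ?_ ?_ ?_ ?_ ?_ ?_ ?_
    g₇ g₈ R' (pow_add _ _ _)
  · exact ha2.qPoch_ne_zero q20 ((j + N : ℕ) + 1) (by rw [w2]) _
  · exact ha2.qPoch_ne_zero q20 ((2 * j : ℕ) + 1) (by rw [w2]; ring) _
  · exact hK2.qPoch_ne_zero q20 ((j + N : ℕ) + 1) (by rw [w2]) _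
  · exact hK2.qPoch_ne_zero q20 ((2 * j : ℕ) + 1) (by rw [w2]; ring) _
  · exact hK2.qPoch_ne_zero q20 1 (by rw [zpow_one]) _
  · exact ha2.qPoch_ne_zero q20 1 (by rw [zpow_one]) _
  · exact hK'.qPoch_ne_zero hq0 0 (by simp) _
  · exact hfa'.qPoch_ne_zero hq0 1 (by rw [zpow_one]; ring) _
  · exact hfa'.qPoch_ne_zero hq0 ((2 * j : ℕ) + 1) (by
      rw [zpow_add_one₀ hq0, zpow_natCast]; ring) _
  · exact hK'.qPoch_ne_zero hq0 (2 * j : ℕ) (by rw [zpow_natCast]; ring) _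
  · exact hB2.qPoch_ne_zero q20 N (by rw [zpow_natCast]) _
  · exact hB2.qPoch_ne_zero q20 0 (by simp) _
  · exact hBi.qPoch_ne_zero q20 0 (by simp) _
  · exact hB2.qPoch_ne_zero q20 (1 - (j + N : ℕ)) (by
      rw [zq, zpow_sub₀ q20, zpow_one, w1]) _
  · exact hBi.qPoch_ne_zero q20 (1 - (j + N : ℕ)) (by
      rw [zq, zpow_sub₀ q20, zpow_one, w1, hBdef]; field_simp) _
  · exact hK2.sub_ne_zero (2 * j : ℕ) (by rw [w1]; ring)
  · exact hK2.sub_ne_zero 0 (by simp)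
  · rw [show a ^ 2 * q ^ (2 * (j + N) + 2) = a ^ 2 * q ^ 2 * (q ^ 2) ^ (j + N) by ring,
      ← qPoch_add, ← qPoch_add]
    congr 1; ring
  · rw [show K ^ 2 * q ^ (2 * (j + N) + 2) = K ^ 2 * q ^ 2 * (q ^ 2) ^ (j + N) by ring,
      ← qPoch_add, ← qPoch_add]
    congr 1; ring
  · rw [mul_add, qPoch_add, neg_mul]
  · rw [mul_add, qPoch_add]
  · rw [add_comm, qPoch_add]
  · rw [add_comm, qPoch_add]

/-- The transformation of a WP-Bailey pair. -/
theorem wpBailey_transformation {a k q : ℂ} (ha : a ≠ 0) (hk : k ≠ 0) (hq0 : q ≠ 0)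
    (hq : QGeneric q) (hfa : QFree q a) (hfa' : QFree q (-a)) (hK : QFree q (k / a))
    (hK' : QFree q (-(k / a))) (hB : QFree q (k / a ^ 2)) {α β : ℕ → ℂ}
    (hβ : IsWPBaileyPair a (k / a) q α β) (n : ℕ) :
    ∑ j ∈ Finset.range (n + 1), lhsWeight a k q n j * (q ^ 2 * a ^ 2 / k) ^ j * α j
      = rhsFactor a k q n * ∑ m ∈ Finset.range (n + 1), rhsWeight a k q n m * β m * q ^ m := by
  -- The coefficient of `α j` after interchanging the sums.
  have inner : ∀ j ≤ n, rhsFactor a k q n * ∑ i ∈ Finset.range (n + 1 - j),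
      rhsWeight a k q n (j + i) * q ^ (j + i) * wpKernel a (k / a) q (j + i) j
      = lhsWeight a k q n j * (q ^ 2 * a ^ 2 / k) ^ j := by
    intro j hj
    obtain ⟨N, rfl⟩ := Nat.exists_eq_add_of_le hj
    obtain ⟨K, hKd⟩ : ∃ K, K = k / a := ⟨_, rfl⟩
    obtain ⟨B, hBd⟩ : ∃ B, B = k / a ^ 2 := ⟨_, rfl⟩
    rw [← hKd] at hK hK'
    rw [← hBd] at hB
    have hB0 : B ≠ 0 := by rw [hBd]; exact div_ne_zero hk (pow_ne_zero 2 ha)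
    have hK0 : K ≠ 0 := by rw [hKd]; exact div_ne_zero hk ha
    have hqi : ∀ n : ℕ, q ^ n ≠ 0 := fun n => pow_ne_zero n hq0
    have q20 : q ^ 2 ≠ 0 := pow_ne_zero 2 hq0
    have zq : ∀ m : ℕ, q ^ (2 - 2 * (m : ℤ)) = q ^ 2 / q ^ (2 * m) := fun m => by
      rw [zpow_sub₀ hq0, zpow_ofNat, zpow_mul, zpow_ofNat, zpow_natCast, pow_mul]
    have zq' : ∀ m : ℕ, q ^ (-2 * (m : ℤ)) = (q ^ (2 * m))⁻¹ := fun m => by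
      rw [neg_mul, zpow_neg, ← zpow_natCast]; push_cast; rfl
    have hf : ∀ {x : ℂ}, QFree q x → QFree q (x * q ^ (2 * j)) := fun {x} h => by
      rw [← zpow_natCast]; exact h.mul_zpow hq0 _
    have hAB : K * q ^ (2 * j) / B = a * q ^ (2 * j) := by rw [hKd, hBd]; field_simp
    -- Put `K = k/a` and `B = K/a`. The kernel supplies `A = K q^(2j)` and `B` in base `q`; the
    -- weight supplies `C = k q^(2n+2j)` and `q^(-2N)` in base `q^2`. The balancing condition `B C =
    -- A^2 q^(2N)` holds because `B k = K^2`.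
    have S := quadratic_sum (A := K * q ^ (2 * j)) (B := B) (C := k * q ^ (2 * (j + N) + 2 * j))
      (N := N) (mul_ne_zero hK0 (hqi _)) hB0 hq0 hq (by rw [hKd, hBd]; field_simp; ring)
      (hf hK) (by rw [← neg_mul]; exact hf hK') hB.base_sq (by rw [hAB]; exact hf hfa)
      (by rw [hAB, ← neg_mul]; exact hf hfa') (QFree.sq (hf hK) (by rw [← neg_mul]; exact hf hK'))
    rw [← rhsFactor_mul_quadratic_sum ha hk hq0 hKd hBd hfa hfa' hK hK' hB, ← S, mul_assoc]
    congr 1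
    rw [Finset.mul_sum, show j + N + 1 - j = N + 1 by omega]
    refine Finset.sum_congr rfl fun i _ => ?_
    have n0 : 1 - K ^ 2 * q ^ (4 * j) ≠ 0 := (hK.sq hK').sub_ne_zero (2 * j : ℕ) (by
      rw [zpow_natCast]; ring)
    rw [rhsWeight, wpKernel_add, quadTerm, qPochs_two, qPochs_two, ← hKd,
      show K / a = B by rw [hKd, hBd]; field_simp,
      show k ^ 2 / a ^ 2 = K ^ 2 by rw [hKd]; ring,
      show k ^ 2 * q ^ (2 * (j + N) + 2) / a ^ 2 = K ^ 2 * q ^ (2 * (j + N) + 2) by rw [hKd]; ring,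
      show k * q ^ (2 - 2 * ((j + N : ℕ) : ℤ)) / a ^ 2 = B * q ^ (2 - 2 * ((j + N : ℕ) : ℤ)) by
        rw [hBd]; ring,
      qPoch_add _ _ j i, qPoch_add _ _ j i, qPoch_add _ _ j i, qPoch_add _ _ j i,
      show k * q ^ (2 * (j + N)) * (q ^ 2) ^ j = k * q ^ (2 * (j + N) + 2 * j) by ring,
      show q ^ (-2 * ((j + N : ℕ) : ℤ)) * (q ^ 2) ^ j = (q ^ (2 * N))⁻¹ by
        rw [zq', mul_add, pow_add]; have := hqi (2 * j); have := hqi (2 * N); field_simp; ring,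
      show K ^ 2 * q ^ (2 * (j + N) + 2) * (q ^ 2) ^ j
        = (K * q ^ (2 * j)) ^ 2 * q ^ 2 / (q ^ (2 * N))⁻¹ by rw [div_inv_eq_mul]; ring,
      show B * q ^ (2 - 2 * ((j + N : ℕ) : ℤ)) * (q ^ 2) ^ j
        = (K * q ^ (2 * j)) ^ 2 * q ^ 2 / (k * q ^ (2 * (j + N) + 2 * j)) by
        rw [zq, hKd, hBd]; have := hqi (2 * (j + N)); field_simp; ring,
      show a * q * q ^ (2 * j) = K * q ^ (2 * j) * q / B by rw [hKd, hBd]; field_simp,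
      show (K * q ^ (2 * j)) ^ 2 = K ^ 2 * q ^ (4 * j) by ring,
      show q ^ (4 * (j + i)) = q ^ (4 * j) * q ^ (4 * i) by ring, pow_add q j i]
    have aux : ∀ D x y z w E T : ℂ, D ≠ 0 →
        D / x * y * z * w * (E / D * T) = E / x * y * z * w * T := fun D x y z w E T hD => by
      rw [show D / x * y * z * w * (E / D * T) = E / x * y * z * w * T * (D / D) by ring,
        div_self hD, mul_one]
    rw [aux _ _ _ _ _ _ _ n0]
    simp only [div_eq_mul_inv, mul_inv]
    ring
  rw [Finset.mul_sum]
  -- The triangle `j ≤ m ≤ n` is summed in the other order, with `i = m - j` as inner variable.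
  have swap := Finset.sum_range_diag_flip (n + 1)
    (fun j i => rhsFactor a k q n * (rhsWeight a k q n (j + i) * q ^ (j + i)
      * wpKernel a (k / a) q (j + i) j) * α j)
  have e : ∀ m ∈ Finset.range (n + 1), rhsFactor a k q n * (rhsWeight a k q n m * β m * q ^ m)
      = ∑ j ∈ Finset.range (m + 1), rhsFactor a k q n * (rhsWeight a k q n (j + (m - j))
        * q ^ (j + (m - j)) * wpKernel a (k / a) q (j + (m - j)) j) * α j := by
    intro m _
    rw [hβ m, Finset.mul_sum, Finset.sum_mul, Finset.mul_sum]
    refine Finset.sum_congr rfl fun j hj => ?_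
    rw [Nat.add_sub_cancel' (by simpa [Nat.lt_succ_iff] using hj)]
    ring
  rw [Finset.sum_congr rfl e, swap]
  refine Finset.sum_congr rfl fun j hj => ?_
  rw [← inner j (by simpa [Nat.lt_succ_iff] using hj), ← Finset.sum_mul, ← Finset.mul_sum]

/-! ### WP-Bailey pairs from the sums of Jackson and Saalschütz -/

/-- Jackson's sum with `b = ρ₁`, `c = ρ₂`, `d = a^2 q/(k ρ₁ ρ₂)`: this `d` is the choice for which
the balancing parameter `e` equals `k q^m`, the one already present in the kernel. -/
theorem wpPair_singh {a k q ρ₁ ρ₂ : ℂ} (ha : a ≠ 0) (hk : k ≠ 0) (hq0 : q ≠ 0) (hρ₁ : ρ₁ ≠ 0)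
    (hρ₂ : ρ₂ ≠ 0) (hq : QGeneric q) (hfa : QFree q a) (hfk : QFree q k) (hka : QFree q (k / a))
    (h₁ : QFree q (a / ρ₁)) (h₂ : QFree q (a / ρ₂)) (h₃ : QFree q (k * ρ₁ * ρ₂ / a)) :
    IsWPBaileyPair a k q
      (fun j => (1 - a * q ^ (2 * j)) / (1 - a)
        * (qPoch a q j * qPoch ρ₁ q j * qPoch ρ₂ q j * qPoch (a ^ 2 * q / (k * ρ₁ * ρ₂)) q j
          * ((qPoch q q j)⁻¹ * (qPoch (a * q / ρ₁) q j)⁻¹ * (qPoch (a * q / ρ₂) q j)⁻¹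
            * (qPoch (k * ρ₁ * ρ₂ / a) q j)⁻¹)) * (k / a) ^ j)
      (fun m => qPoch (k * ρ₁ / a) q m * qPoch (k * ρ₂ / a) q m * qPoch k q m
          * qPoch (a * q / (ρ₁ * ρ₂)) q m
        / (qPoch (a * q / ρ₁) q m * qPoch (a * q / ρ₂) q m * qPoch (k * ρ₁ * ρ₂ / a) q m
          * qPoch q q m)) := by
  intro m
  have hqm : q ^ m ≠ 0 := pow_ne_zero m hq0
  have h₃' : QFree q (a / (a ^ 2 * q / (k * ρ₁ * ρ₂))) := by
    rw [show a / (a ^ 2 * q / (k * ρ₁ * ρ₂)) = k * ρ₁ * ρ₂ / a * q ^ (-1 : ℤ) by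
      rw [zpow_neg_one]; field_simp]
    exact h₃.mul_zpow hq0 _
  have J := jackson_sum (b := ρ₁) (c := ρ₂) (d := a ^ 2 * q / (k * ρ₁ * ρ₂)) ha hρ₁ hρ₂
    (by simp; tauto) hq0 hq hfa h₁ h₂ h₃'
    (by
      rw [show a / (ρ₁ * ρ₂ * (a ^ 2 * q / (k * ρ₁ * ρ₂))) = k / a * q ^ (-1 : ℤ) by
        rw [zpow_neg_one]; field_simp]
      exact hka.mul_zpow hq0 _)
    (by
      rw [show a ^ 2 / (ρ₁ * ρ₂ * (a ^ 2 * q / (k * ρ₁ * ρ₂))) = k * q ^ (-1 : ℤ) by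
        rw [zpow_neg_one]; field_simp]
      exact hfk.mul_zpow hq0 _) m
  have e : ∀ j ∈ Finset.range (m + 1), wpKernel a k q m j * ((1 - a * q ^ (2 * j)) / (1 - a)
        * (qPoch a q j * qPoch ρ₁ q j * qPoch ρ₂ q j * qPoch (a ^ 2 * q / (k * ρ₁ * ρ₂)) q j
          * ((qPoch q q j)⁻¹ * (qPoch (a * q / ρ₁) q j)⁻¹ * (qPoch (a * q / ρ₂) q j)⁻¹
            * (qPoch (k * ρ₁ * ρ₂ / a) q j)⁻¹)) * (k / a) ^ j)
      = qPoch (k / a) q m * qPoch k q m / (qPoch q q m * qPoch (a * q) q m)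
        * vwpTerm a ρ₁ ρ₂ (a ^ 2 * q / (k * ρ₁ * ρ₂))
          (a ^ 2 * q ^ (m + 1) / (ρ₁ * ρ₂ * (a ^ 2 * q / (k * ρ₁ * ρ₂)))) (q ^ m)⁻¹ q j := by
    intro j hj
    rw [wpKernel_eq ha hk hq0 hq hka (by simpa [Nat.lt_succ_iff] using hj), vwpTerm,
      show a ^ 2 * q ^ (m + 1) / (ρ₁ * ρ₂ * (a ^ 2 * q / (k * ρ₁ * ρ₂))) = k * q ^ m by
        field_simp; ring,
      show a * q / (a ^ 2 * q / (k * ρ₁ * ρ₂)) = k * ρ₁ * ρ₂ / a by field_simp,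
      div_inv_eq_mul, show q ^ j = (a * q / k) ^ j * (k / a) ^ j by
        rw [← mul_pow]; congr 1; field_simp]
    ring
  have d₁ : qPoch (k / a) q m ≠ 0 := hka.qPoch_ne_zero hq0 0 (by simp) _
  have d₂ : qPoch (a * q) q m ≠ 0 := hfa.qPoch_ne_zero hq0 1 (by rw [zpow_one]) _
  rw [Finset.sum_congr rfl e, ← Finset.mul_sum, J,
    show a * q / (a ^ 2 * q / (k * ρ₁ * ρ₂)) = k * ρ₁ * ρ₂ / a by field_simp,
    show a * q / (ρ₁ * (a ^ 2 * q / (k * ρ₁ * ρ₂))) = k * ρ₂ / a by field_simp,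
    show a * q / (ρ₂ * (a ^ 2 * q / (k * ρ₁ * ρ₂))) = k * ρ₁ / a by field_simp,
    show a * q / (ρ₁ * ρ₂ * (a ^ 2 * q / (k * ρ₁ * ρ₂))) = k / a by field_simp]
  rw [show ∀ P K Q A x y z u v w : ℂ, P * K / (Q * A) * (A * x * y * z / (u * v * w * P))
    = (P / P) * (A / A) * (z * y * K * x / (u * v * w * Q)) from fun _ _ _ _ _ _ _ _ _ _ => by ring,
    div_self d₁, div_self d₂, one_mul, one_mul]

/-- After the sums are interchanged, the coefficient of `α j` is a terminating `₃φ₂`. The values of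
`c` and `w`, for which `c w = k`, make it balanced, so the Saalschütz sum applies and reproduces the
kernel relative to `k`. -/
theorem wpPair_chain {a k c w q : ℂ} (ha : a ≠ 0) (hk : k ≠ 0) (hq0 : q ≠ 0) (hq : QGeneric q)
    (hc : c = q * a ^ 2 / k) (hw : w = k ^ 2 / (q * a ^ 2)) (hfa : QFree q a) (hfk : QFree q k)
    (hfw : QFree q w) {α β : ℕ → ℂ} (h : IsWPBaileyPair a c q α β) :
    IsWPBaileyPair a k q (fun j => qPoch c q (2 * j) / qPoch k q (2 * j) * w ^ j * α j)
      (fun m => ∑ r ∈ Finset.range (m + 1), qPoch w q (m - r) / qPoch q q (m - r) * w ^ r * β r) := by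
  have hc0 : c ≠ 0 := by rw [hc]; exact div_ne_zero (mul_ne_zero hq0 (pow_ne_zero 2 ha)) hk
  have hw0 : w ≠ 0 := by
    rw [hw]; exact div_ne_zero (pow_ne_zero 2 hk) (mul_ne_zero hq0 (pow_ne_zero 2 ha))
  have hqi : ∀ n : ℕ, q ^ n ≠ 0 := fun n => pow_ne_zero n hq0
  intro m
  have inner : ∀ j ≤ m, ∑ i ∈ Finset.range (m + 1 - j), qPoch w q (m - (j + i))
        / qPoch q q (m - (j + i)) * w ^ (j + i) * wpKernel a c q (j + i) j
      = wpKernel a k q m j * (qPoch c q (2 * j) / qPoch k q (2 * j) * w ^ j) := by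
    intro j hj
    obtain ⟨N, rfl⟩ := Nat.exists_eq_add_of_le hj
    have S := saalschuetz_sum (a := c / a) (b := c * q ^ (2 * j)) (c := a * q * q ^ (2 * j))
      (div_ne_zero hc0 ha) (mul_ne_zero hc0 (hqi _)) (mul_ne_zero (mul_ne_zero ha hq0) (hqi _)) hq0
      hq (by
        rw [mul_assoc, ← pow_succ', ← zpow_natCast]; exact hfa.mul_zpow hq0 _)
      (by
        rw [show a * q * q ^ (2 * j) / (c / a * (c * q ^ (2 * j))) = w by
          rw [hc, hw]; have := hqi (2 * j); field_simp]
        exact hfw) N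
    have e : ∀ i ∈ Finset.range (N + 1), qPoch w q (j + N - (j + i))
          / qPoch q q (j + N - (j + i)) * w ^ (j + i) * wpKernel a c q (j + i) j
        = qPoch c q (2 * j) / qPoch (a * q) q (2 * j) * w ^ j * (qPoch w q N / qPoch q q N)
          * (qPoch (c / a) q i * qPoch (c * q ^ (2 * j)) q i * qPoch (q ^ N)⁻¹ q i
            * ((qPoch q q i)⁻¹ * (qPoch (a * q * q ^ (2 * j)) q i)⁻¹
              * (qPoch (c / a * (c * q ^ (2 * j)) * q / (a * q * q ^ (2 * j) * q ^ N)) q i)⁻¹)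
            * q ^ i) := by
      intro i hi
      rw [Nat.add_sub_add_left, qPoch_sub_div hw0 hq0 hq hfw
        (by simpa [Nat.lt_succ_iff] using hi), wpKernel_add, pow_add,
        show c / a * (c * q ^ (2 * j)) * q / (a * q * q ^ (2 * j) * q ^ N) = q / (w * q ^ N) by
          rw [hc, hw]; have := hqi (2 * j); have := hqi N; field_simp,
        show q ^ i = (q / w) ^ i * w ^ i by rw [← mul_pow]; congr 1; field_simp]
      ring
    have d₁ : qPoch k q (2 * j) ≠ 0 := hfk.qPoch_ne_zero hq0 0 (by simp) _
    have d₂ : qPoch w q N ≠ 0 := hfw.qPoch_ne_zero hq0 0 (by simp) _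
    rw [show j + N + 1 - j = N + 1 by omega, Finset.sum_congr rfl e, ← Finset.mul_sum, S,
      show a * q * q ^ (2 * j) / (c / a) = k * q ^ (2 * j) by rw [hc]; field_simp,
      show a * q * q ^ (2 * j) / (c * q ^ (2 * j)) = k / a by
        rw [hc]; have := hqi (2 * j); field_simp,
      show a * q * q ^ (2 * j) / (c / a * (c * q ^ (2 * j))) = w by
        rw [hc, hw]; have := hqi (2 * j); field_simp, wpKernel_add]
    generalize qPoch k q (2 * j) = p₁ at *
    generalize qPoch w q N = p₂ at *
    rw [show ∀ C A W q₀ x y z : ℂ, C / A * W * (p₂ / q₀) * (x * y / (z * p₂))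
      = p₂ / p₂ * (C / A * W * (x * y * (q₀⁻¹ * z⁻¹))) from fun _ _ _ _ _ _ _ => by ring,
      div_self d₂, show ∀ C A W X : ℂ, p₁ / A * X * (C / p₁ * W) = p₁ / p₁ * (C / A * W * X) from
      fun _ _ _ _ => by ring, div_self d₁]
    ring
  have swap := Finset.sum_range_diag_flip (m + 1)
    (fun j i => qPoch w q (m - (j + i)) / qPoch q q (m - (j + i)) * w ^ (j + i)
      * wpKernel a c q (j + i) j * α j)
  have e : ∀ r ∈ Finset.range (m + 1), qPoch w q (m - r) / qPoch q q (m - r) * w ^ r * β r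
      = ∑ j ∈ Finset.range (r + 1), qPoch w q (m - (j + (r - j))) / qPoch q q (m - (j + (r - j)))
        * w ^ (j + (r - j)) * wpKernel a c q (j + (r - j)) j * α j := by
    intro r _
    rw [h r, Finset.mul_sum]
    refine Finset.sum_congr rfl fun j hj => ?_
    rw [Nat.add_sub_cancel' (by simpa [Nat.lt_succ_iff] using hj)]
    ring
  simp only
  rw [Finset.sum_congr rfl e, swap]
  refine Finset.sum_congr rfl fun j hj => ?_
  rw [← Finset.sum_mul, inner j (by simpa [Nat.lt_succ_iff] using hj), mul_assoc]

theorem sum_range_eq_zero_term {F : ℕ → ℂ} (m : ℕ) (h : ∀ r, r ≠ 0 → F r = 0) :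
    ∑ r ∈ Finset.range (m + 1), F r = F 0 :=
  Finset.sum_eq_single 0 (fun r _ hr => h r hr) (by simp)

/-- The chain applied to the unit pair. With `ρ₁ ρ₂ = aq` the first pair has `β r` proportional to
`(1; q)_r`, which is zero for `r > 0`, so only one term of the new `β` is left. The auxiliary `ρ`
cancels from `α`. -/
theorem wpPair_bressoud {a k q ρ : ℂ} (ha : a ≠ 0) (hk : k ≠ 0) (hq0 : q ≠ 0) (hρ : ρ ≠ 0)
    (hq : QGeneric q) (hfa : QFree q a) (hfk : QFree q k)
    (hak : QFree q (a / k)) (hak2 : QFree q (a ^ 2 / k)) (hfw : QFree q (k ^ 2 / a ^ 2))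
    (hfρ : QFree q ρ) (hfaρ : QFree q (a / ρ)) :
    IsWPBaileyPair a k q
      (fun j => (1 - a * q ^ (2 * j)) / (1 - a)
        * (qPoch a q j * qPoch (k / (a * q)) q j * qPoch (q * a ^ 2 / k) q (2 * j)
          / (qPoch q q j * qPoch (a ^ 2 * q ^ 2 / k) q j * qPoch k q (2 * j))) * (k / a) ^ j)
      (fun m => qPoch (k ^ 2 / (q * a ^ 2)) q m / qPoch q q m) := by
  have hc0 : q * a ^ 2 / k ≠ 0 := div_ne_zero (mul_ne_zero hq0 (pow_ne_zero 2 ha)) hk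
  have S := wpPair_singh (k := q * a ^ 2 / k) (ρ₁ := ρ) (ρ₂ := a * q / ρ) ha hc0 hq0 hρ
    (by simp; tauto) hq hfa
    (by
      rw [show q * a ^ 2 / k = a ^ 2 / k * q ^ (1 : ℤ) by rw [zpow_one]; ring]
      exact hak2.mul_zpow hq0 _)
    (by
      rw [show q * a ^ 2 / k / a = a / k * q ^ (1 : ℤ) by rw [zpow_one]; field_simp]
      exact hak.mul_zpow hq0 _)
    hfaρ
    (by
      rw [show a / (a * q / ρ) = ρ * q ^ (-1 : ℤ) by rw [zpow_neg_one]; field_simp]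
      exact hfρ.mul_zpow hq0 _)
    (by
      rw [show q * a ^ 2 / k * ρ * (a * q / ρ) / a = a ^ 2 / k * q ^ (2 : ℤ) by
        rw [zpow_ofNat]; field_simp]
      exact hak2.mul_zpow hq0 _)
  have C := wpPair_chain ha hk hq0 hq rfl rfl hfa hfk
    (by
      rw [show k ^ 2 / (q * a ^ 2) = k ^ 2 / a ^ 2 * q ^ (-1 : ℤ) by rw [zpow_neg_one]; field_simp]
      exact hfw.mul_zpow hq0 _) S
  intro m
  refine Eq.trans ?_ ((C m).trans (Finset.sum_congr rfl fun j _ => ?_))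
  · simp only
    rw [sum_range_eq_zero_term]
    · simp [qPoch_zero]
    · intro r hr
      rw [show a * q / (ρ * (a * q / ρ)) = 1 by field_simp,
        show qPoch 1 q r = 0 from Finset.prod_eq_zero
          (Finset.mem_range.2 (Nat.pos_of_ne_zero hr)) (by simp)]
      simp
  · simp only
    have d₁ : qPoch ρ q j ≠ 0 := hfρ.qPoch_ne_zero hq0 0 (by simp) _
    have d₂ : qPoch (a * q / ρ) q j ≠ 0 := hfaρ.qPoch_ne_zero hq0 1 (by rw [zpow_one]; ring) _
    rw [show a * q / (a * q / ρ) = ρ by field_simp,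
      show a ^ 2 * q / (q * a ^ 2 / k * ρ * (a * q / ρ)) = k / (a * q) by field_simp,
      show q * a ^ 2 / k * ρ * (a * q / ρ) / a = a ^ 2 * q ^ 2 / k by field_simp,
      show (k / a) ^ j = (k ^ 2 / (q * a ^ 2)) ^ j * (q * a ^ 2 / k / a) ^ j by
        rw [← mul_pow]; congr 1; field_simp]
    generalize qPoch ρ q j = p₁ at *
    generalize qPoch (a * q / ρ) q j = p₂ at *
    congr 1
    rw [show ∀ x y z u v w s t : ℂ, x * y * (z * (u * p₁ * p₂ * v * (w * p₂⁻¹ * p₁⁻¹ * s)) * t)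
      = x * y * (z * (u * v * (w * s)) * t) * (p₁ / p₁) * (p₂ / p₂) from
        fun _ _ _ _ _ _ _ _ => by ring, div_self d₁, div_self d₂]
    simp only [div_eq_mul_inv, mul_inv]
    ring

/-- The chain applied to the first pair with `ρ₁ = r^2/a` and `ρ₂ = r`, where `r` is a square root
of the second parameter of the new pair. Enough factors cancel for the new `β` to be again a
Saalschütz sum. -/
theorem wpPair_sqrt {a r q : ℂ} (ha : a ≠ 0) (hr : r ≠ 0) (hq0 : q ≠ 0)
    (hq : QGeneric q) (hfa : QFree q a) (hfr : QFree q r)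
    (hk : QFree q (r ^ 2)) (hka : QFree q (r ^ 2 / a)) (hak2 : QFree q (a ^ 2 / r ^ 2))
    (har : QFree q (a / r)) (hfw : QFree q (r ^ 4 / a ^ 2)) :
    IsWPBaileyPair a (r ^ 2) q
      (fun j => (1 - a * q ^ (2 * j)) / (1 - a)
        * (qPoch a q j * qPoch (a ^ 2 * q / r ^ 2) (q ^ 2) j * qPoch (a / r) q j
            * qPoch (-(a * q / r)) q j * qPoch (r ^ 2 / a) q j
          / (qPoch q q j * qPoch (r ^ 2 * q) (q ^ 2) j * qPoch (q * r) q j * qPoch (-r) q j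
            * qPoch (q * a ^ 2 / r ^ 2) q j)) * (r ^ 2 / a) ^ j)
      (fun m => qPoch r q m * qPoch (r ^ 4 / a ^ 2) q m / (qPoch (q * r) q m * qPoch q q m)) := by
  have r20 : r ^ 2 ≠ 0 := pow_ne_zero 2 hr
  have hc0 : q * a ^ 2 / r ^ 2 ≠ 0 := div_ne_zero (mul_ne_zero hq0 (pow_ne_zero 2 ha)) r20
  have S := wpPair_singh (k := q * a ^ 2 / r ^ 2) (ρ₁ := r ^ 2 / a) (ρ₂ := r) ha hc0 hq0
    (div_ne_zero r20 ha) hr hq hfa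
    (by
      rw [show q * a ^ 2 / r ^ 2 = a ^ 2 / r ^ 2 * q ^ (1 : ℤ) by rw [zpow_one]; ring]
      exact hak2.mul_zpow hq0 _)
    (by
      rw [show q * a ^ 2 / r ^ 2 / a = (r ^ 2 / a)⁻¹ * q ^ (1 : ℤ) by rw [zpow_one]; field_simp]
      exact hka.inv.mul_zpow hq0 _)
    (by rwa [show a / (r ^ 2 / a) = a ^ 2 / r ^ 2 by field_simp])
    har
    (by
      rw [show q * a ^ 2 / r ^ 2 * (r ^ 2 / a) * r / a = r * q ^ (1 : ℤ) by
        rw [zpow_one]; field_simp]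
      exact hfr.mul_zpow hq0 _)
  have hw : QFree q ((r ^ 2) ^ 2 / (q * a ^ 2)) := by
    rw [show (r ^ 2) ^ 2 / (q * a ^ 2) = r ^ 4 / a ^ 2 * q ^ (-1 : ℤ) by
      rw [zpow_neg_one]; field_simp]
    exact hfw.mul_zpow hq0 _
  have C := wpPair_chain ha r20 hq0 hq rfl rfl hfa hk hw S
  have hw0 : (r ^ 2) ^ 2 / (q * a ^ 2) ≠ 0 :=
    div_ne_zero (pow_ne_zero 2 r20) (mul_ne_zero hq0 (pow_ne_zero 2 ha))
  intro m
  have hqm : q ^ m ≠ 0 := pow_ne_zero m hq0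
  refine Eq.trans ?_ ((C m).trans (Finset.sum_congr rfl fun j _ => ?_))
  -- The numerator parameter `q` is what `k ρ₁/a` becomes for the pair fed into the chain.
  · have Z := saalschuetz_sum (a := q) (b := q * a ^ 2 / r ^ 3) (c := q * r) hq0
      (div_ne_zero (mul_ne_zero hq0 (pow_ne_zero 2 ha)) (pow_ne_zero 3 hr)) (mul_ne_zero hq0 hr)
      hq0 hq (by rw [mul_comm, ← zpow_one q]; simpa using hfr.mul_zpow hq0 1)
      (by
        rw [show q * r / (q * (q * a ^ 2 / r ^ 3)) = (r ^ 2) ^ 2 / (q * a ^ 2) by field_simp]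
        exact hw) m
    have e : ∀ i ∈ Finset.range (m + 1), qPoch ((r ^ 2) ^ 2 / (q * a ^ 2)) q (m - i)
          / qPoch q q (m - i) * ((r ^ 2) ^ 2 / (q * a ^ 2)) ^ i
          * (qPoch (q * a ^ 2 / r ^ 2 * (r ^ 2 / a) / a) q i
            * qPoch (q * a ^ 2 / r ^ 2 * r / a) q i * qPoch (q * a ^ 2 / r ^ 2) q i
            * qPoch (a * q / (r ^ 2 / a * r)) q i
            / (qPoch (a * q / (r ^ 2 / a)) q i * qPoch (a * q / r) q i
              * qPoch (q * a ^ 2 / r ^ 2 * (r ^ 2 / a) * r / a) q i * qPoch q q i))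
        = qPoch ((r ^ 2) ^ 2 / (q * a ^ 2)) q m / qPoch q q m
          * (qPoch q q i * qPoch (q * a ^ 2 / r ^ 3) q i * qPoch (q ^ m)⁻¹ q i
            * ((qPoch q q i)⁻¹ * (qPoch (q * r) q i)⁻¹
              * (qPoch (q * (q * a ^ 2 / r ^ 3) * q / (q * r * q ^ m)) q i)⁻¹) * q ^ i) := by
      intro i hi
      rw [qPoch_sub_div hw0 hq0 hq hw (by simpa [Nat.lt_succ_iff] using hi),
        show q * a ^ 2 / r ^ 2 * (r ^ 2 / a) / a = q by field_simp,
        show q * a ^ 2 / r ^ 2 * r / a = a * q / r by field_simp,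
        show a * q / (r ^ 2 / a * r) = q * a ^ 2 / r ^ 3 by field_simp,
        show a * q / (r ^ 2 / a) = q * a ^ 2 / r ^ 2 by field_simp,
        show q * a ^ 2 / r ^ 2 * (r ^ 2 / a) * r / a = q * r by field_simp,
        show q * (q * a ^ 2 / r ^ 3) * q / (q * r * q ^ m)
          = q / ((r ^ 2) ^ 2 / (q * a ^ 2) * q ^ m) by field_simp,
        show q ^ i = (q / ((r ^ 2) ^ 2 / (q * a ^ 2))) ^ i * ((r ^ 2) ^ 2 / (q * a ^ 2)) ^ i by
          rw [← mul_pow]; congr 1; field_simp]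
      have d₁ : qPoch (a * q / r) q i ≠ 0 := har.qPoch_ne_zero hq0 1 (by rw [zpow_one]; ring) _
      have d₂ : qPoch (q * a ^ 2 / r ^ 2) q i ≠ 0 :=
        hak2.qPoch_ne_zero hq0 1 (by rw [zpow_one]; ring) _
      generalize qPoch (a * q / r) q i = p₁ at *
      generalize qPoch (q * a ^ 2 / r ^ 2) q i = p₂ at *
      rw [show ∀ x y z u : ℂ, x * p₁ * p₂ * y / (p₂ * p₁ * z * u)
        = x * y / (z * u) * (p₁ / p₁) * (p₂ / p₂) from fun _ _ _ _ => by ring, div_self d₁,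
        div_self d₂]
      simp only [div_eq_mul_inv, mul_inv]
      ring
    have d₁ : qPoch ((r ^ 2) ^ 2 / (q * a ^ 2)) q m ≠ 0 := hw.qPoch_ne_zero hq0 0 (by simp) _
    simp only
    rw [Finset.sum_congr rfl e, ← Finset.mul_sum, Z, show q * r / q = r by field_simp,
      show q * r / (q * a ^ 2 / r ^ 3) = r ^ 4 / a ^ 2 by field_simp,
      show q * r / (q * (q * a ^ 2 / r ^ 3)) = (r ^ 2) ^ 2 / (q * a ^ 2) by field_simp]
    generalize qPoch ((r ^ 2) ^ 2 / (q * a ^ 2)) q m = p₁ at *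
    rw [show ∀ x y z u : ℂ, p₁ / x * (y * z / (u * p₁)) = y * z / (u * x) * (p₁ / p₁) from
      fun _ _ _ _ => by ring, div_self d₁, mul_one]
  · simp only
    have d₁ : qPoch r q j ≠ 0 := hfr.qPoch_ne_zero hq0 0 (by simp) _
    have d₂ : qPoch (a * q / r) q j ≠ 0 := har.qPoch_ne_zero hq0 1 (by rw [zpow_one]; ring) _
    rw [qPoch_two_mul, qPoch_two_mul, ← qPoch_mul_neg r,
      show q * a ^ 2 / r ^ 2 * q = (a * q / r) ^ 2 by ring, ← qPoch_mul_neg (a * q / r),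
      show a ^ 2 * q / (q * a ^ 2 / r ^ 2 * (r ^ 2 / a) * r) = a / r by field_simp,
      show a * q / (r ^ 2 / a) = q * a ^ 2 / r ^ 2 by field_simp,
      show q * a ^ 2 / r ^ 2 * (r ^ 2 / a) * r / a = q * r by field_simp,
      show (r ^ 2 / a) ^ j = ((r ^ 2) ^ 2 / (q * a ^ 2)) ^ j * (q * a ^ 2 / r ^ 2 / a) ^ j by
        rw [← mul_pow]; congr 1; field_simp, show a ^ 2 * q / r ^ 2 = q * a ^ 2 / r ^ 2 by ring]
    generalize qPoch r q j = p₁ at *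
    generalize qPoch (a * q / r) q j = p₂ at *
    congr 1
    rw [show ∀ x y z u v w s t A B c d : ℂ,
      x * (p₂ * A) / (p₁ * B * y) * z * (u * (v * w * p₁ * s * (t * p₂⁻¹ * c)) * d)
      = x * A / (B * y) * z * (u * (v * w * s * (t * c)) * d) * (p₁ / p₁) * (p₂ / p₂) from
        fun _ _ _ _ _ _ _ _ _ _ _ _ => by ring, div_self d₁, div_self d₂]
    simp only [div_eq_mul_inv, mul_inv]
    ring

theorem qPoch_reverse_div {q u v x y : ℂ} {n : ℕ} (hq : q ≠ 0) (hx : x ≠ 0) (hy : y ≠ 0)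
    (hu : u * x * q ^ n = q) (hv : v * y * q ^ n = q) (hv0 : qPoch v q n ≠ 0)
    (hy0 : qPoch y q n ≠ 0) :
    qPoch u q n / qPoch v q n = qPoch x q n / qPoch y q n * (y / x) ^ n := by
  have hqn : q ^ n ≠ 0 := pow_ne_zero n hq
  have e : ∀ u x : ℂ, x ≠ 0 → u * x * q ^ n = q → q ^ (1 - (n : ℤ)) / x = u := fun u x hx h => by
    rw [zpow_sub₀ hq, zpow_one, zpow_natCast, div_div, div_eq_iff (mul_ne_zero hqn hx)]
    linear_combination -h
  have R := qPoch_reverse hq hx hy n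
  rw [e u x hx hu, e v y hy hv] at R
  rw [div_pow, div_mul_div_comm, div_eq_div_iff hv0 (mul_ne_zero hy0 (pow_ne_zero n hx))]
  linear_combination R

/-- The kernel brings two numerator and two denominator parameters, so this `α`, without a
very-well-poised part, makes the sum a `₃φ₂`. The numerator parameter `q a^2/k^2` is the one that
balances it. -/
theorem wpPair_saalschuetz {a k q : ℂ} (ha : a ≠ 0) (hk : k ≠ 0) (hq0 : q ≠ 0)
    (hq : QGeneric q) (hfa : QFree q a) (hka : QFree q (k / a)) (hk2 : QFree q (k ^ 2 / a)) :
    IsWPBaileyPair a k q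
      (fun j => qPoch (q * a ^ 2 / k ^ 2) q j / qPoch q q j * (k / a) ^ j)
      (fun m => qPoch (q * a / k) q m * qPoch k q m * qPoch (k ^ 2 / a) q (2 * m)
        / (qPoch (k ^ 2 / a) q m * qPoch q q m * qPoch (a * q) q (2 * m))) := by
  intro m
  have hqm : q ^ m ≠ 0 := pow_ne_zero m hq0
  have S := saalschuetz_sum (a := q * a ^ 2 / k ^ 2) (b := k * q ^ m) (c := a * q * q ^ m)
    (by simp; tauto) (mul_ne_zero hk hqm) (by simp; tauto) hq0 hq
    (by
      rw [show a * q * q ^ m = a * q ^ ((m : ℤ) + 1) by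
        rw [zpow_add_one₀ hq0, zpow_natCast]; ring]
      exact hfa.mul_zpow hq0 _)
    (by rwa [show a * q * q ^ m / (q * a ^ 2 / k ^ 2 * (k * q ^ m)) = k / a by field_simp]) m
  have e : ∀ j ∈ Finset.range (m + 1), wpKernel a k q m j
        * (qPoch (q * a ^ 2 / k ^ 2) q j / qPoch q q j * (k / a) ^ j)
      = qPoch (k / a) q m * qPoch k q m / (qPoch q q m * qPoch (a * q) q m)
        * (qPoch (q * a ^ 2 / k ^ 2) q j * qPoch (k * q ^ m) q j * qPoch (q ^ m)⁻¹ q j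
        * ((qPoch q q j)⁻¹ * (qPoch (a * q * q ^ m) q j)⁻¹
          * (qPoch (q * a ^ 2 / k ^ 2 * (k * q ^ m) * q / (a * q * q ^ m * q ^ m)) q j)⁻¹)
          * q ^ j) := by
    intro j hj
    rw [wpKernel_eq ha hk hq0 hq hka (by simpa [Nat.lt_succ_iff] using hj),
      show q * a ^ 2 / k ^ 2 * (k * q ^ m) * q / (a * q * q ^ m * q ^ m) = a * q / (k * q ^ m) by
        field_simp,
      show q ^ j = (a * q / k) ^ j * (k / a) ^ j by rw [← mul_pow]; congr 1; field_simp]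
    ring
  have d₁ : qPoch (k / a) q m ≠ 0 := hka.qPoch_ne_zero hq0 0 (by simp) _
  have d₂ : qPoch (k ^ 2 / a) q m ≠ 0 := hk2.qPoch_ne_zero hq0 0 (by simp) _
  simp only
  rw [Finset.sum_congr rfl e, ← Finset.mul_sum, S,
    show a * q * q ^ m / (q * a ^ 2 / k ^ 2) = k ^ 2 / a * q ^ m by field_simp,
    show a * q * q ^ m / (k * q ^ m) = q * a / k by field_simp,
    show a * q * q ^ m / (q * a ^ 2 / k ^ 2 * (k * q ^ m)) = k / a by field_simp,
    two_mul, qPoch_add (k ^ 2 / a), qPoch_add (a * q)]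
  generalize qPoch (k / a) q m = p₁ at *
  generalize qPoch (k ^ 2 / a) q m = p₂ at *
  rw [show ∀ x y z u v w : ℂ, x * y * (p₂ * z) / (p₂ * u * (v * w))
    = x * y * z / (u * (v * w)) * (p₂ / p₂) from fun _ _ _ _ _ _ => by ring, div_self d₂,
    show ∀ x y z u v w : ℂ, p₁ * x / (y * z) * (u * v / (w * p₁)) = x / (y * z) * (u * v / w)
      * (p₁ / p₁) from fun _ _ _ _ _ _ => by ring, div_self d₁]
  simp only [div_eq_mul_inv, mul_inv]
  ring

/-! ### WP-Bailey pairs in base `q^2` from the quadratic sums -/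

/-- The kernel in base `q^2` relative to `s^2` provides the two parameters of that base, and `α`
provides those of base `q`. The factor `v` is left free because the two pairs below differ in their
very-well-poised part. -/
theorem wpKernel_mul_quadTerm {s k q : ℂ} (hs : s ≠ 0) (hk : k ≠ 0) (hq0 : q ≠ 0)
    (hq : QGeneric q) (hks : QFree (q ^ 2) (k / s ^ 2)) (B v : ℂ) {m j : ℕ} (hj : j ≤ m) :
    wpKernel (s ^ 2) k (q ^ 2) m j * (v * (qPoch s q j * qPoch B q j
      * ((qPoch q q j)⁻¹ * (qPoch (s * q / B) q j)⁻¹)) * (k / (s ^ 2 * q)) ^ j)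
      = qPoch (k / s ^ 2) (q ^ 2) m * qPoch k (q ^ 2) m
        / (qPoch (q ^ 2) (q ^ 2) m * qPoch (s ^ 2 * q ^ 2) (q ^ 2) m)
        * (v * quadTerm s B (k * q ^ (2 * m)) (q ^ (2 * m))⁻¹ q j) := by
  have hq2 : QGeneric (q ^ 2) := fun i hi => by
    rw [show (q ^ 2) ^ i = q ^ (2 * i) by rw [zpow_mul, zpow_ofNat]]; exact hq _ (by omega)
  rw [wpKernel_eq (pow_ne_zero 2 hs) hk (pow_ne_zero 2 hq0) hq2 hks hj, quadTerm, div_inv_eq_mul,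
    ← pow_mul q 2 m,
    show q ^ j = (s ^ 2 * q ^ 2 / k) ^ j * (k / (s ^ 2 * q)) ^ j by
      rw [← mul_pow]; congr 1; field_simp]
  ring

/-- Jackson's sum in mixed bases: since `C = k q^(2m)` is dictated by the kernel, `B = s^2 q/k` is
forced by `B C = s^2 q^(2m+1)`. The reversals `r₁` and `r₂` then remove the negative powers of `q`
from its value. -/
theorem wpPair_quadratic {s k q : ℂ} (hs : s ≠ 0) (hk : k ≠ 0) (hq0 : q ≠ 0)
    (hq : QGeneric q) (hfs : QFree q s) (hfs' : QFree q (-s)) (hks : QFree q (k / s))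
    (hks' : QFree q (-(k / s))) (hks2 : QFree q (k / s ^ 2)) :
    IsWPBaileyPair (s ^ 2) k (q ^ 2)
      (fun j => (1 - s * q ^ (2 * j)) / (1 - s) * (qPoch s q j * qPoch (s ^ 2 * q / k) q j
        * ((qPoch q q j)⁻¹ * (qPoch (k / s) q j)⁻¹)) * (k / (s ^ 2 * q)) ^ j)
      (fun m => qPoch k (q ^ 2) m * qPoch (s ^ 2 * q ^ 2 / k) (q ^ 2) m
          * qPoch (-(k / s)) q (2 * m)
        / (qPoch (q ^ 2) (q ^ 2) m * qPoch (k ^ 2 / s ^ 2) (q ^ 2) m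
          * qPoch (-(q * s)) q (2 * m)) * (k / (s ^ 2 * q)) ^ m) := by
  intro m
  have q20 : q ^ 2 ≠ 0 := pow_ne_zero 2 hq0
  have hqm : q ^ m ≠ 0 := pow_ne_zero m hq0
  have hq2m : q ^ (2 * m) ≠ 0 := pow_ne_zero _ hq0
  have hb : s * q / (s ^ 2 * q / k) = k / s := by field_simp
  have hABC : -s / (s ^ 2 * q / k * (k * q ^ (2 * m))) = (-s)⁻¹ * q ^ (-(2 * m + 1 : ℕ) : ℤ) := by
    rw [zpow_neg, zpow_natCast, pow_succ]; field_simp; ring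
  have hAC : s ^ 2 / (k * q ^ (2 * m)) = (k / s ^ 2)⁻¹ * (q ^ 2) ^ (-(m : ℤ)) := by
    rw [zpow_neg, zpow_natCast, ← pow_mul]; field_simp
  have J := jackson_quadratic (A := s) (B := s ^ 2 * q / k) (C := k * q ^ (2 * m)) (N := m) hs
    (by simp; tauto) (mul_ne_zero hk hq2m) hq0 hq (by field_simp; ring) hfs
    (by
      rw [show s / (s ^ 2 * q / k) = k / s * q ^ (-1 : ℤ) by rw [zpow_neg_one]; field_simp]
      exact hks.mul_zpow hq0 _)
    (by rw [hAC]; exact hks2.base_sq.inv.mul_zpow q20 _)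
    (by rw [hABC]; exact hfs'.inv.mul_zpow hq0 _)
  have d₁ : qPoch (k / s ^ 2) (q ^ 2) m ≠ 0 := hks2.base_sq.qPoch_ne_zero q20 0 (by simp) _
  have d₂ : qPoch (s * q) q m ≠ 0 := hfs.qPoch_ne_zero hq0 1 (by rw [zpow_one]) _
  have d₃ : qPoch (-(k / s)) q m ≠ 0 := hks'.qPoch_ne_zero hq0 0 (by simp) _
  have r₁ := qPoch_reverse_div (u := -s * q / (k * q ^ (2 * m)))
    (v := -s * q / (s ^ 2 * q / k * (k * q ^ (2 * m)))) (x := -(k / s) * q ^ m)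
    (y := -(q * s) * q ^ m) (n := m) hq0 (by simp; tauto) (by simp; tauto)
    (by rw [two_mul, pow_add]; field_simp) (by rw [two_mul, pow_add]; field_simp)
    (hfs'.inv.qPoch_ne_zero hq0 (-(2 * m + 1 : ℕ) + 1) (by
      rw [zpow_add_one₀ hq0, ← mul_assoc (-s)⁻¹, ← hABC]; ring) _)
    (hfs'.qPoch_ne_zero hq0 (m + 1) (by rw [zpow_add_one₀ hq0, zpow_natCast]; ring) _)
  have r₂ := qPoch_reverse_div (u := s ^ 2 * q ^ 2 / ((s ^ 2 * q / k) ^ 2 * (k * q ^ (2 * m))))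
    (v := s ^ 2 * q ^ 2 / (k * q ^ (2 * m))) (x := s ^ 2 * q ^ 2 / k)
    (y := k / s ^ 2) (q := q ^ 2) (n := m) q20 (by simp; tauto) (by simp; tauto)
    (by rw [pow_mul]; field_simp) (by rw [pow_mul]; field_simp)
    (hks2.base_sq.inv.qPoch_ne_zero q20 (-(m : ℤ) + 1) (by
      rw [zpow_add_one₀ q20, ← mul_assoc (k / s ^ 2)⁻¹, ← hAC]; ring) _) d₁
  have e : ∀ j ∈ Finset.range (m + 1), _ := fun j hj => wpKernel_mul_quadTerm hs hk hq0 hq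
    hks2.base_sq (s ^ 2 * q / k) ((1 - s * q ^ (2 * j)) / (1 - s))
    (m := m) (by simpa [Nat.lt_succ_iff] using hj)
  rw [hb] at e J
  simp only
  rw [Finset.sum_congr rfl e, ← Finset.mul_sum, J,
    show ∀ y z u v w : ℂ, qPoch (s * q) q m * y * z / (u * v * w)
      = qPoch (s * q) q m / u * (y / w) * (z / v) from fun _ _ _ _ _ => by ring, r₁, r₂, two_mul, qPoch_add (-(k / s)), qPoch_add (-(q * s)),
    ← div_pow k s 2, ← qPoch_mul_neg (k / s), ← mul_pow s q 2, ← qPoch_mul_neg (s * q),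
    show -(s * q) = -(q * s) by ring,
    show (k / (s ^ 2 * q)) ^ m = (-(q * s) * q ^ m / (-(k / s) * q ^ m)) ^ m
      * (k / s ^ 2 / ((s * q) ^ 2 / k)) ^ m by rw [← mul_pow]; congr 1; field_simp]
  generalize qPoch (k / s ^ 2) (q ^ 2) m = p₁ at *
  generalize qPoch (s * q) q m = p₂ at *
  generalize qPoch (-(k / s)) q m = p₃ at *
  rw [show ∀ x y z u v w t A B : ℂ, x * y * (p₃ * z) / (u * (v * p₃) * (w * t)) * (A * B)
    = x * y * z / (u * v * (w * t)) * (A * B) * (p₃ / p₃) from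
      fun _ _ _ _ _ _ _ _ _ => by ring, div_self d₃,
    show ∀ x y z u v w A B : ℂ, p₁ * x / (y * (p₂ * z)) * (p₂ / u * (v * A) * (w / p₁ * B))
    = x / (y * z) * (1 / u * (v * A) * (w * B)) * (p₁ / p₁) * (p₂ / p₂) from
      fun _ _ _ _ _ _ _ _ => by ring, div_self d₁, div_self d₂]
  simp only [div_eq_mul_inv, mul_inv]
  ring

/-- The companion with very-well-poised part in base `q^2`: here `B C = s^2 q^(2m)` forces `B =
s^2/k`. -/
theorem wpPair_quadratic_sq {s k q : ℂ} (hs : s ≠ 0) (hk : k ≠ 0) (hq0 : q ≠ 0)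
    (hq : QGeneric q) (hfs : QFree q s) (hfs' : QFree q (-s)) (hks : QFree q (k / s))
    (hks' : QFree q (-(k / s))) (hks2 : QFree q (k / s ^ 2)) :
    IsWPBaileyPair (s ^ 2) k (q ^ 2)
      (fun j => (1 - s ^ 2 * q ^ (4 * j)) / (1 - s ^ 2) * (qPoch s q j * qPoch (s ^ 2 / k) q j
        * ((qPoch q q j)⁻¹ * (qPoch (k * q / s) q j)⁻¹)) * (k / (s ^ 2 * q)) ^ j)
      (fun m => qPoch k (q ^ 2) m * qPoch (s ^ 2 / k) (q ^ 2) m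
          * qPoch (-(k * q / s)) q (2 * m)
        / (qPoch (q ^ 2) (q ^ 2) m * qPoch (q ^ 2 * k ^ 2 / s ^ 2) (q ^ 2) m
          * qPoch (-s) q (2 * m)) * (k / (s ^ 2 * q)) ^ m) := by
  intro m
  have q20 : q ^ 2 ≠ 0 := pow_ne_zero 2 hq0
  have hs2 : QFree (q ^ 2) (s ^ 2) := hfs.sq hfs'
  have hb : s * q / (s ^ 2 / k) = k * q / s := by field_simp
  have hb' : s / (s ^ 2 / k) = k / s := by field_simp
  have J := quadratic_sum (A := s) (B := s ^ 2 / k) (C := k * q ^ (2 * m)) (N := m) hs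
    (by simp; tauto) hq0 hq (by field_simp) hfs hfs'
    (by rw [← inv_div]; exact hks2.base_sq.inv) (by rwa [hb']) (by rwa [hb']) hs2
  have d₁ : qPoch (k / s ^ 2) (q ^ 2) m ≠ 0 := hks2.base_sq.qPoch_ne_zero q20 0 (by simp) _
  have d₂ : qPoch (s ^ 2 * q ^ 2) (q ^ 2) m ≠ 0 := hs2.qPoch_ne_zero q20 1 (by rw [zpow_one]) _
  have e : ∀ j ∈ Finset.range (m + 1), _ := fun j hj => wpKernel_mul_quadTerm hs hk hq0 hq
    hks2.base_sq (s ^ 2 / k) ((1 - s ^ 2 * q ^ (4 * j)) / (1 - s ^ 2))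
    (m := m) (by simpa [Nat.lt_succ_iff] using hj)
  rw [hb] at e
  simp only
  rw [Finset.sum_congr rfl e, ← Finset.mul_sum, J,
    show q * s / (s ^ 2 / k) = k * q / s by field_simp,
    show s ^ 2 * q ^ 2 / (s ^ 2 / k) ^ 2 = q ^ 2 * k ^ 2 / s ^ 2 by field_simp,
    show 1 / (s ^ 2 / k) = k / s ^ 2 by field_simp,
    show k / (s ^ 2 * q) = (s ^ 2 / k * q)⁻¹ by field_simp, inv_pow]
  generalize qPoch (k / s ^ 2) (q ^ 2) m = p₁ at *
  generalize qPoch (s ^ 2 * q ^ 2) (q ^ 2) m = p₂ at *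
  rw [show ∀ x y z u v w t : ℂ, p₁ * x / (y * p₂) * (z * p₂ * u / (v * p₁ * w * t))
    = x / y * (z * u / (v * w * t)) * (p₁ / p₁) * (p₂ / p₂) from
      fun _ _ _ _ _ _ _ => by ring, div_self d₁, div_self d₂]
  simp only [div_eq_mul_inv, mul_inv]
  ring

/-! ### The pair whose `α` is supported on even indices -/

theorem QGeneric.sq {q : ℂ} (hq : QGeneric q) : QGeneric (q ^ 2) := fun i hi => by
  rw [show (q ^ 2) ^ i = q ^ (2 * i) by rw [zpow_mul, zpow_ofNat]]; exact hq _ (by omega)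

theorem QGeneric.free_odd {q : ℂ} (hq0 : q ≠ 0) (hq : QGeneric q) (i : ℤ) :
    QFree (q ^ 2) (q ^ (2 * i + 1)) := fun j => by
  rw [show (q ^ 2) ^ j = q ^ (2 * j) by rw [zpow_mul, zpow_ofNat], ← zpow_add₀ hq0]
  exact hq _ (by omega)

/-- At `j = 2i` each factorial of the kernel splits into two of base `q^2`, so that the sum is
Jackson's in base `q^2` with `c = k q^m` and `d = k q^(m+1)`. Of the two parameters `q^(-m)` and
`q^(1-m)`, the one equal to `q^(-2N)` terminates the series and the other is the balancing
parameter; the parity of `m` exchanges their roles. -/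
theorem wpKernel_even_sum {a k q : ℂ} (ha : a ≠ 0) (hk : k ≠ 0) (hq0 : q ≠ 0)
    (hq : QGeneric q) (hfa : QFree q a) (hka : QFree q (k / a)) (hk2 : QFree q (k ^ 2 / a))
    {m N : ℕ} (hm : m = 2 * N ∨ m = 2 * N + 1) :
    ∑ i ∈ Finset.range (N + 1), wpKernel a k q m (2 * i) * ((1 - a * q ^ (4 * i)) / (1 - a)
        * (qPoch a (q ^ 2) i * qPoch (a ^ 2 / k ^ 2) (q ^ 2) i
          * ((qPoch (q ^ 2) (q ^ 2) i)⁻¹ * (qPoch (q ^ 2 * k ^ 2 / a) (q ^ 2) i)⁻¹))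
        * (k / a) ^ (2 * i))
      = qPoch (k / a) q m * qPoch k q m / (qPoch q q m * qPoch (a * q) q m)
        * (qPoch (a * q ^ 2) (q ^ 2) N / qPoch (q ^ 2 * k ^ 2 / a) (q ^ 2) N
          * (qPoch (k * q / (a * q ^ m)) q (2 * N) / qPoch (a * q / (k * q ^ m)) q (2 * N))
          * (qPoch (a * q / (k ^ 2 * (q ^ m) ^ 2)) (q ^ 2) N
            / qPoch (q / (a * (q ^ m) ^ 2)) (q ^ 2) N)) := by
  obtain ⟨Q, hQ⟩ : ∃ Q, Q = q ^ m := ⟨_, rfl⟩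
  have hQ0 : Q ≠ 0 := hQ ▸ pow_ne_zero m hq0
  have q20 : q ^ 2 ≠ 0 := pow_ne_zero 2 hq0
  have hQz : Q = q ^ (m : ℤ) := by rw [zpow_natCast, hQ]
  have hfree : ∀ {x y : ℂ} (i : ℤ), QFree q x → y = x * q ^ i → QFree (q ^ 2) y :=
    fun i h e => by rw [e]; exact (h.mul_zpow hq0 i).base_sq
  have J := jackson_sum (q := q ^ 2) (b := a ^ 2 / k ^ 2) (c := k * Q) (d := k * Q * q) ha
    (div_ne_zero (pow_ne_zero 2 ha) (pow_ne_zero 2 hk)) (mul_ne_zero hk hQ0)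
    (mul_ne_zero (mul_ne_zero hk hQ0) hq0) q20 hq.sq hfa.base_sq
    (hfree 0 hk2 (by rw [zpow_zero]; field_simp))
    (hfree (-m) hka.inv (by rw [zpow_neg, ← hQz]; field_simp))
    (hfree (-m - 1) hka.inv (by rw [zpow_sub₀ hq0, zpow_neg, ← hQz, zpow_one]; field_simp))
    (hfree (-m - m - 1) hfa.inv (by
      rw [zpow_sub₀ hq0, zpow_sub₀ hq0, zpow_neg, ← hQz, zpow_one]; field_simp))
    (by
      rw [show a ^ 2 / (a ^ 2 / k ^ 2 * (k * Q) * (k * Q * q)) = q ^ (2 * (-m - 1) + 1 : ℤ) by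
        rw [show (2 * (-m - 1) + 1 : ℤ) = -m - m - 1 by ring, zpow_sub₀ hq0, zpow_sub₀ hq0,
          zpow_neg, ← hQz, zpow_one]
        field_simp]
      exact hq.free_odd hq0 _) N
  have hab : a * q ^ 2 / (a ^ 2 / k ^ 2) = q ^ 2 * k ^ 2 / a := by field_simp
  have hac : a * q ^ 2 / (k * Q) = a * q / (k * Q) * q := by field_simp
  have had : a * q ^ 2 / (k * Q * q) = a * q / (k * Q) := by field_simp
  have e : ∀ i ∈ Finset.range (N + 1), wpKernel a k q m (2 * i)
        * ((1 - a * q ^ (4 * i)) / (1 - a)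
        * (qPoch a (q ^ 2) i * qPoch (a ^ 2 / k ^ 2) (q ^ 2) i
          * ((qPoch (q ^ 2) (q ^ 2) i)⁻¹ * (qPoch (q ^ 2 * k ^ 2 / a) (q ^ 2) i)⁻¹))
        * (k / a) ^ (2 * i))
      = qPoch (k / a) q m * qPoch k q m / (qPoch q q m * qPoch (a * q) q m)
        * vwpTerm a (a ^ 2 / k ^ 2) (k * Q) (k * Q * q)
          (a ^ 2 * (q ^ 2) ^ (N + 1) / (a ^ 2 / k ^ 2 * (k * Q) * (k * Q * q)))
          ((q ^ 2) ^ N)⁻¹ (q ^ 2) i := by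
    intro i hi
    have hi : i < N + 1 := Finset.mem_range.1 hi
    have hp : (q ^ 2) ^ i = (a * q / k) ^ (2 * i) * (k / a) ^ (2 * i) := by
      rw [← mul_pow, show a * q / k * (k / a) = q by field_simp, pow_mul]
    rw [wpKernel_eq ha hk hq0 hq hka (show 2 * i ≤ m by omega), ← hQ, vwpTerm, hab, hac, had,
      ← pow_mul q 2 (2 * i), show 2 * (2 * i) = 4 * i by ring, hp,
      qPoch_two_mul (k * Q), qPoch_two_mul Q⁻¹, qPoch_two_mul (a * q / (k * Q)),
      qPoch_two_mul (a * q * Q)]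
    rcases hm with h | h
    · have hN : (q ^ 2) ^ N = Q := by rw [hQ, h, pow_mul]
      rw [show a ^ 2 * (q ^ 2) ^ (N + 1) / (a ^ 2 / k ^ 2 * (k * Q) * (k * Q * q)) = Q⁻¹ * q by
        rw [pow_succ (q ^ 2), hN]; field_simp, hN,
        show a * q ^ 2 / (Q⁻¹ * q) = a * q * Q by field_simp, div_inv_eq_mul,
        show a * q ^ 2 * Q = a * q * Q * q by ring]
      simp only [div_eq_mul_inv, mul_inv]
      ring
    · have hN : (q ^ 2) ^ N = Q / q := by rw [hQ, h, pow_succ q (2 * N), pow_mul]; field_simp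
      rw [show a ^ 2 * (q ^ 2) ^ (N + 1) / (a ^ 2 / k ^ 2 * (k * Q) * (k * Q * q)) = Q⁻¹ by
        rw [pow_succ (q ^ 2), hN]; field_simp, hN, show (Q / q)⁻¹ = Q⁻¹ * q by field_simp,
        show a * q ^ 2 / (Q⁻¹ * q) = a * q * Q by field_simp, div_inv_eq_mul,
        show a * q ^ 2 * Q = a * q * Q * q by ring]
      simp only [div_eq_mul_inv, mul_inv]
      ring
  rw [Finset.sum_congr rfl e, ← Finset.mul_sum, J, hab, hac, had, ← hQ, qPoch_two_mul, qPoch_two_mul,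
    show a * q ^ 2 / (a ^ 2 / k ^ 2 * (k * Q)) = k * q / (a * Q) * q by field_simp,
    show a * q ^ 2 / (a ^ 2 / k ^ 2 * (k * Q * q)) = k * q / (a * Q) by field_simp,
    show a * q ^ 2 / (k * Q * (k * Q * q)) = a * q / (k ^ 2 * Q ^ 2) by field_simp,
    show a * q ^ 2 / (a ^ 2 / k ^ 2 * (k * Q) * (k * Q * q)) = q / (a * Q ^ 2) by field_simp]
  simp only [div_eq_mul_inv, mul_inv]
  ring

theorem wpKernel_even_sum_of_even {a k q : ℂ} (ha : a ≠ 0) (hk : k ≠ 0) (hq0 : q ≠ 0)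
    (hfa : QFree q a) (hka : QFree q (k / a)) (hk2 : QFree q (k ^ 2 / a))
    (N : ℕ) :
    qPoch (k / a) q (2 * N) * qPoch k q (2 * N) / (qPoch q q (2 * N) * qPoch (a * q) q (2 * N))
        * (qPoch (a * q ^ 2) (q ^ 2) N / qPoch (q ^ 2 * k ^ 2 / a) (q ^ 2) N
          * (qPoch (k * q / (a * q ^ (2 * N))) q (2 * N)
            / qPoch (a * q / (k * q ^ (2 * N))) q (2 * N))
          * (qPoch (a * q / (k ^ 2 * (q ^ (2 * N)) ^ 2)) (q ^ 2) N
            / qPoch (q / (a * (q ^ (2 * N)) ^ 2)) (q ^ 2) N))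
      = qPoch k q (2 * N) * qPoch (a / k) q (2 * N) * qPoch (k ^ 2 * q / a) (q ^ 2) (2 * N)
        / (qPoch (a * q) (q ^ 2) (2 * N) * qPoch (q * k ^ 2 / a) q (2 * N) * qPoch q q (2 * N))
        * (-(k / a)) ^ (2 * N) := by
  have q20 : q ^ 2 ≠ 0 := pow_ne_zero 2 hq0
  have hqN : q ^ N ≠ 0 := pow_ne_zero N hq0
  obtain ⟨Q, hQ⟩ : ∃ Q, Q = q ^ (2 * N) := ⟨_, rfl⟩
  have hQ0 : Q ≠ 0 := hQ ▸ pow_ne_zero _ hq0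
  have hQz : Q = q ^ ((2 * N : ℕ) : ℤ) := by rw [zpow_natCast, hQ]
  have d₁ : qPoch (k / a) q (2 * N) ≠ 0 := hka.qPoch_ne_zero hq0 0 (by simp) _
  have d₂ : qPoch (a * q ^ 2) (q ^ 2) N ≠ 0 :=
    hfa.base_sq.qPoch_ne_zero q20 1 (by rw [zpow_one]) _
  have d₃ : qPoch (q * k ^ 2 / a) (q ^ 2) N ≠ 0 :=
    (hk2.mul_zpow hq0 1).base_sq.qPoch_ne_zero q20 0 (by simp; ring) _
  have r₁ := qPoch_reverse_div (u := k * q / (a * Q)) (v := a * q / (k * Q)) (x := a / k)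
    (y := k / a) (n := 2 * N) hq0 (div_ne_zero ha hk) (div_ne_zero hk ha)
    (by rw [← hQ]; field_simp) (by rw [← hQ]; field_simp)
    (hka.inv.qPoch_ne_zero hq0 (1 - (2 * N : ℕ)) (by
      rw [zpow_sub₀ hq0, ← hQz, zpow_one]; field_simp) _) d₁
  have r₂ := qPoch_reverse_div (q := q ^ 2) (u := a * q / (k ^ 2 * Q ^ 2)) (v := q / (a * Q ^ 2))
    (x := k ^ 2 * q / a * Q) (y := a * q * Q) (n := N) q20 (by simp; tauto) (by simp; tauto)
    (by rw [← pow_mul, ← hQ]; field_simp) (by rw [← pow_mul, ← hQ]; field_simp)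
    ((hfa.inv.mul_zpow hq0 1).base_sq.qPoch_ne_zero q20 (-(2 * N : ℕ)) (by
      rw [sq_zpow, zpow_neg, ← hQz, zpow_one]; field_simp) _)
    ((hfa.mul_zpow hq0 1).base_sq.qPoch_ne_zero q20 N (by
      rw [zpow_natCast, ← pow_mul, ← hQ, zpow_one]) _)
  rw [← hQ, r₁, r₂, two_mul N, qPoch_add (k ^ 2 * q / a), qPoch_add (a * q) (q ^ 2), ← two_mul,
    qPoch_two_mul (q * k ^ 2 / a), qPoch_two_mul (a * q) q, ← pow_mul, ← hQ,
    show q * k ^ 2 / a * q = q ^ 2 * k ^ 2 / a by ring, show a * q * q = a * q ^ 2 by ring,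
    show k ^ 2 * q / a = q * k ^ 2 / a by ring, Even.neg_pow (even_two_mul N),
    show (k / a) ^ (2 * N) = (k / a / (a / k)) ^ (2 * N)
      * (a * q * Q / (q * k ^ 2 / a * Q)) ^ N by
        rw [pow_mul, pow_mul, ← mul_pow]; congr 1; field_simp]
  generalize qPoch (k / a) q (2 * N) = p₁ at *
  generalize qPoch (a * q ^ 2) (q ^ 2) N = p₂ at *
  generalize qPoch (q * k ^ 2 / a) (q ^ 2) N = p₃ at *
  rw [show ∀ x y z u v w A B : ℂ, x * y * (p₃ * z) / (u * (p₃ * v) * w) * (A * B)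
      = x * y * z / (u * v * w) * (A * B) * (p₃ / p₃) from fun _ _ _ _ _ _ _ _ => by ring,
    div_self d₃, show ∀ x y z u v w A B : ℂ,
      p₁ * x / (y * (z * p₂)) * (p₂ / u * (v / p₁ * A) * (w * B))
      = x / (y * z) * (1 / u * (v * A) * (w * B)) * (p₁ / p₁) * (p₂ / p₂) from
        fun _ _ _ _ _ _ _ _ => by ring, div_self d₁, div_self d₂]
  simp only [div_eq_mul_inv, mul_inv]
  ring

/-- The closed form agrees with the one for even length. The extra sign and power come from the
factors left over by the reversal, since `(1 - k/a)/(1 - a/k) = -k/a`. -/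
theorem wpKernel_even_sum_of_odd {a k q : ℂ} (ha : a ≠ 0) (hk : k ≠ 0) (hq0 : q ≠ 0)
    (hfa : QFree q a) (hka : QFree q (k / a)) (hk2 : QFree q (k ^ 2 / a))
    (N : ℕ) :
    qPoch (k / a) q (2 * N + 1) * qPoch k q (2 * N + 1)
        / (qPoch q q (2 * N + 1) * qPoch (a * q) q (2 * N + 1))
        * (qPoch (a * q ^ 2) (q ^ 2) N / qPoch (q ^ 2 * k ^ 2 / a) (q ^ 2) N
          * (qPoch (k * q / (a * q ^ (2 * N + 1))) q (2 * N)
            / qPoch (a * q / (k * q ^ (2 * N + 1))) q (2 * N))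
          * (qPoch (a * q / (k ^ 2 * (q ^ (2 * N + 1)) ^ 2)) (q ^ 2) N
            / qPoch (q / (a * (q ^ (2 * N + 1)) ^ 2)) (q ^ 2) N))
      = qPoch k q (2 * N + 1) * qPoch (a / k) q (2 * N + 1)
          * qPoch (k ^ 2 * q / a) (q ^ 2) (2 * N + 1)
        / (qPoch (a * q) (q ^ 2) (2 * N + 1) * qPoch (q * k ^ 2 / a) q (2 * N + 1)
          * qPoch q q (2 * N + 1)) * (-(k / a)) ^ (2 * N + 1) := by
  have q20 : q ^ 2 ≠ 0 := pow_ne_zero 2 hq0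
  have hqN : q ^ N ≠ 0 := pow_ne_zero N hq0
  obtain ⟨Q, hQ⟩ : ∃ Q, Q = q ^ (2 * N) := ⟨_, rfl⟩
  have hQ0 : Q ≠ 0 := hQ ▸ pow_ne_zero _ hq0
  have hQz : Q = q ^ ((2 * N : ℕ) : ℤ) := by rw [zpow_natCast, hQ]
  have d₁ : qPoch (k / a * q) q (2 * N) ≠ 0 := hka.qPoch_ne_zero hq0 1 (by rw [zpow_one]) _
  have d₂ : qPoch (a * q ^ 2) (q ^ 2) N ≠ 0 :=
    hfa.base_sq.qPoch_ne_zero q20 1 (by rw [zpow_one]) _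
  have d₃ : qPoch (q * k ^ 2 / a) (q ^ 2) (N + 1) ≠ 0 :=
    (hk2.mul_zpow hq0 1).base_sq.qPoch_ne_zero q20 0 (by simp; ring) _
  have d₄ : 1 - a / k ≠ 0 := hka.inv.sub_ne_zero 0 (by simp)
  have r₁ := qPoch_reverse_div (u := k * q / (a * (Q * q))) (v := a * q / (k * (Q * q)))
    (x := a / k * q) (y := k / a * q) (n := 2 * N) hq0 (by simp; tauto) (by simp; tauto)
    (by rw [← hQ]; field_simp) (by rw [← hQ]; field_simp)
    (hka.inv.qPoch_ne_zero hq0 (-(2 * N : ℕ)) (by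
      rw [zpow_neg, ← hQz]; field_simp) _) d₁
  have r₂ := qPoch_reverse_div (q := q ^ 2) (u := a * q / (k ^ 2 * (Q * q) ^ 2))
    (v := q / (a * (Q * q) ^ 2))
    (x := k ^ 2 * q / a * (Q * q ^ 2)) (y := a * q * (Q * q ^ 2)) (n := N) q20
    (by simp; tauto) (by simp; tauto)
    (by rw [← pow_mul, ← hQ]; field_simp) (by rw [← pow_mul, ← hQ]; field_simp)
    ((hfa.inv.mul_zpow hq0 (-1)).base_sq.qPoch_ne_zero q20 (-(2 * N : ℕ)) (by
      rw [sq_zpow, zpow_neg_one, zpow_neg, ← hQz]; field_simp) _)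
    ((hfa.mul_zpow hq0 1).base_sq.qPoch_ne_zero q20 (N + 1) (by
      rw [zpow_add_one₀ q20, zpow_natCast, ← pow_mul, ← hQ, zpow_one]) _)
  rw [pow_succ q (2 * N), ← hQ, r₁, r₂, qPoch_succ_left (k / a), qPoch_succ_left (a / k),
    qPoch_succ (q * k ^ 2 / a), qPoch_succ (a * q) q, qPoch_two_mul (q * k ^ 2 / a),
    qPoch_two_mul (a * q) q, ← hQ,
    show qPoch (k ^ 2 * q / a) (q ^ 2) (2 * N + 1) = qPoch (q * k ^ 2 / a) (q ^ 2) (N + 1)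
        * qPoch (k ^ 2 * q / a * (Q * q ^ 2)) (q ^ 2) N by
      rw [show 2 * N + 1 = N + 1 + N by ring, qPoch_add, hQ, pow_mul, pow_succ (q ^ 2),
        show k ^ 2 * q / a = q * k ^ 2 / a by ring],
    show qPoch (a * q) (q ^ 2) (2 * N + 1) = qPoch (a * q) (q ^ 2) N * (1 - a * q * Q)
        * qPoch (a * q * (Q * q ^ 2)) (q ^ 2) N by
      rw [show 2 * N + 1 = N + 1 + N by ring, qPoch_add, qPoch_succ, hQ, pow_mul, pow_succ (q ^ 2)],
    show qPoch (q * k ^ 2 / a) (q ^ 2) N * qPoch (q * k ^ 2 / a * q) (q ^ 2) N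
        * (1 - q * k ^ 2 / a * Q) = qPoch (q * k ^ 2 / a) (q ^ 2) (N + 1)
        * qPoch (q * k ^ 2 / a * q) (q ^ 2) N by
      rw [qPoch_succ, hQ, pow_mul]; ring,
    show q * k ^ 2 / a * q = q ^ 2 * k ^ 2 / a by ring, show a * q * q = a * q ^ 2 by ring,
    show (-(k / a)) ^ (2 * N + 1) = (k / a * q / (a / k * q)) ^ (2 * N)
      * (a * q * (Q * q ^ 2) / (k ^ 2 * q / a * (Q * q ^ 2))) ^ N
        * ((1 - k / a) / (1 - a / k)) by
      rw [pow_succ, pow_mul, pow_mul, ← mul_pow]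
      congr 2
      · field_simp
      · rw [eq_div_iff d₄]; field_simp; ring]
  generalize qPoch (k / a * q) q (2 * N) = p₁ at *
  generalize qPoch (a * q ^ 2) (q ^ 2) N = p₂ at *
  generalize qPoch (q * k ^ 2 / a) (q ^ 2) (N + 1) = p₃ at *
  generalize 1 - a / k = p₄ at *
  rw [show ∀ x y z u v w A B t : ℂ,
      x * (p₄ * y) * (p₃ * z) / (u * (p₃ * v) * w) * (A * B * (t / p₄))
      = x * y * z / (u * v * w) * (A * B * t) * (p₃ / p₃) * (p₄ / p₄) from
        fun _ _ _ _ _ _ _ _ _ => by ring,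
    div_self d₃, div_self d₄, show ∀ x y z u v w A B s t : ℂ,
      s * p₁ * x / (y * (z * p₂ * t)) * (p₂ / u * (v / p₁ * A) * (w * B))
      = s * x / (y * z * t) * (1 / u * (v * A) * (w * B)) * (p₁ / p₁) * (p₂ / p₂) from
        fun _ _ _ _ _ _ _ _ _ _ => by ring, div_self d₁, div_self d₂]
  simp only [div_eq_mul_inv, mul_inv]
  ring

theorem sum_range_even {F : ℕ → ℂ} (h : ∀ i, ¬ Even i → F i = 0) (n : ℕ) :
    ∑ i ∈ Finset.range (2 * n + 1), F i = ∑ i ∈ Finset.range (n + 1), F (2 * i) := by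
  induction n with
  | zero => simp
  | succ n ih =>
    rw [show 2 * (n + 1) + 1 = 2 * n + 1 + 1 + 1 by ring, Finset.sum_range_succ,
      Finset.sum_range_succ, ih, h (2 * n + 1) (by simp), Finset.sum_range_succ _ (n + 1), add_zero]
    rfl

theorem wpPair_even {a k q : ℂ} (ha : a ≠ 0) (hk : k ≠ 0) (hq0 : q ≠ 0)
    (hq : QGeneric q) (hfa : QFree q a) (hka : QFree q (k / a)) (hk2 : QFree q (k ^ 2 / a)) :
    IsWPBaileyPair a k q
      (fun j => if Even j then (1 - a * q ^ (2 * j)) / (1 - a)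
        * (qPoch a (q ^ 2) (j / 2) * qPoch (a ^ 2 / k ^ 2) (q ^ 2) (j / 2)
          * ((qPoch (q ^ 2) (q ^ 2) (j / 2))⁻¹ * (qPoch (q ^ 2 * k ^ 2 / a) (q ^ 2) (j / 2))⁻¹))
        * (k / a) ^ j else 0)
      (fun m => qPoch k q m * qPoch (a / k) q m * qPoch (k ^ 2 * q / a) (q ^ 2) m
        / (qPoch (a * q) (q ^ 2) m * qPoch (q * k ^ 2 / a) q m * qPoch q q m)
        * (-(k / a)) ^ m) := by
  intro m
  have hα : ∀ i ∈ Finset.range (m / 2 + 1), wpKernel a k q m (2 * i) * (if Even (2 * i) then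
      (1 - a * q ^ (2 * (2 * i))) / (1 - a)
        * (qPoch a (q ^ 2) (2 * i / 2) * qPoch (a ^ 2 / k ^ 2) (q ^ 2) (2 * i / 2)
          * ((qPoch (q ^ 2) (q ^ 2) (2 * i / 2))⁻¹
            * (qPoch (q ^ 2 * k ^ 2 / a) (q ^ 2) (2 * i / 2))⁻¹))
        * (k / a) ^ (2 * i) else 0)
      = wpKernel a k q m (2 * i) * ((1 - a * q ^ (4 * i)) / (1 - a)
        * (qPoch a (q ^ 2) i * qPoch (a ^ 2 / k ^ 2) (q ^ 2) i
          * ((qPoch (q ^ 2) (q ^ 2) i)⁻¹ * (qPoch (q ^ 2 * k ^ 2 / a) (q ^ 2) i)⁻¹))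
        * (k / a) ^ (2 * i)) := fun i _ => by
    rw [if_pos (even_two_mul i), Nat.mul_div_cancel_left i two_pos, ← mul_assoc 2 2 i]; norm_num
  rcases Nat.even_or_odd' m with ⟨N, h | h⟩
  · subst h
    simp only
    rw [Nat.mul_div_cancel_left N two_pos] at hα
    rw [sum_range_even fun i hi => by rw [if_neg hi, mul_zero], Finset.sum_congr rfl hα,
      wpKernel_even_sum ha hk hq0 hq hfa hka hk2 (Or.inl rfl),
      wpKernel_even_sum_of_even ha hk hq0 hfa hka hk2]
  · subst h
    simp only
    rw [show (2 * N + 1) / 2 = N by omega] at hα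
    rw [Finset.sum_range_succ, sum_range_even fun i hi => by rw [if_neg hi, mul_zero],
      Finset.sum_congr rfl hα, if_neg (by simp), mul_zero, add_zero,
      wpKernel_even_sum ha hk hq0 hq hfa hka hk2 (Or.inr rfl),
      wpKernel_even_sum_of_odd ha hk hq0 hfa hka hk2]

/-! ### The pair whose `β` is supported on even indices -/

/-- The general term of a terminating very-well-poised series that is summable according to the
parity of its length. -/
noncomputable def parityTerm (a b q Q : ℂ) (j : ℕ) : ℂ :=
  (1 - a * q ^ (2 * j)) / (1 - a)
    * (qPoch a q j * qPoch b q j * qPoch (a * q / b) (q ^ 2) j * qPoch (a * b * Q) q j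
      * qPoch Q⁻¹ q j)
    * ((qPoch q q j)⁻¹ * (qPoch (a * q / b) q j)⁻¹ * (qPoch (a * b * q) (q ^ 2) j)⁻¹
      * (qPoch (q / (b * Q)) q j)⁻¹ * (qPoch (a * q * Q) q j)⁻¹) * (-(q / b)) ^ j

/-- The core of the certificate with all denominators cleared, for `a = b c`. -/
theorem parity_telescope_polynomial (b c q Q x : ℂ) :
    (1 - b * c * x ^ 2) * ((1 - q ^ 2 * c * Q) * (1 - q ^ 2 * Q) * (1 - b ^ 2 * c * Q * x)
          * (1 - b ^ 2 * c * Q * q * x) * (b * Q * q - x) * (b * Q - x)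
        - (1 - b ^ 2 * Q) * (1 - b ^ 2 * c * Q) * (q * q * Q - x) * (q * Q - x)
          * (1 - b * c * q * Q * x) * (1 - b * c * q * Q * q * x))
      = (b - q) * (1 - b ^ 2 * c * q ^ 2 * Q ^ 2) * Q
        * ((1 - b * c * x) * (1 - b * x) * (1 - c * q * x ^ 2) * (1 - b ^ 2 * c * Q * x)
            * (q * q * Q - x)
          + (1 - x) * (1 - c * x) * (q - b ^ 2 * c * x ^ 2) * (b * Q - x)
            * (1 - b * c * q * Q * q * x)) := by
  ring

/-- The certificate comparing the lengths `m + 2` and `m`, with `Q = q^m`. Each parameter that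
depends on `m` moves by two factors, hence the products of two quotients. They are simplified one
pair at a time before the polynomial identity is applied. -/
theorem parity_telescope {a b q Q x : ℂ} (hb : b ≠ 0) (hq : q ≠ 0)
    (hQ : Q ≠ 0) (h1 : 1 - a ≠ 0) (h2 : 1 - a * b * Q ≠ 0) (h3 : 1 - a * b * Q * q ≠ 0)
    (h4 : 1 - 1 / (b * Q * q) ≠ 0) (h5 : 1 - 1 / (b * Q) ≠ 0)
    (h7 : 1 - 1 / (q * Q) ≠ 0) (h8 : 1 - a * q * Q ≠ 0) (h9 : 1 - a * q * Q * q ≠ 0)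
    (h10 : 1 - q ^ 2 * Q ≠ 0) :
    (1 - q ^ 2 * a / b * Q) * (1 - b * Q) * (1 - b * q * Q) * (1 - a * b * Q * q)
        * ((1 - a * x ^ 2) / (1 - a)
          * ((1 - a * b * Q * x) / (1 - a * b * Q) * ((1 - a * b * Q * q * x) / (1 - a * b * Q * q)))
          * ((1 - 1 / (b * Q * q) * x) / (1 - 1 / (b * Q * q))
            * ((1 - 1 / (b * Q) * x) / (1 - 1 / (b * Q)))))
      - (1 - b ^ 2 * Q) * (1 - q * Q) * (1 - a * q * Q) * (1 - a * q * Q * q)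
        * ((1 - a * x ^ 2) / (1 - a)
          * ((1 - 1 / (q * q * Q) * x) / (1 - 1 / (q * q * Q))
            * ((1 - 1 / (q * Q) * x) / (1 - 1 / (q * Q))))
          * ((1 - a * q * Q * x) / (1 - a * q * Q)
            * ((1 - a * q * Q * q * x) / (1 - a * q * Q * q))))
    = -(b * (b - q) * (1 - a * b * q ^ 2 * Q ^ 2)) * (q * Q ^ 2)
        / ((1 - a * b * Q) * (1 - q ^ 2 * Q) * (1 - a))
      * (-(q / b) * ((1 - a * x) * (1 - b * x) * (1 - a * q / b * x ^ 2) * (1 - a * b * Q * x)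
          * (1 - 1 / (q * q * Q) * x))
        - (1 - x) * (1 - a / b * x) * (1 - a * b / q * x ^ 2) * (1 - 1 / (b * Q) * x)
          * (1 - a * q * Q * q * x)) := by
  have e1 : (1 - q * Q) * ((1 - 1 / (q * q * Q) * x) / (1 - 1 / (q * q * Q))
      * ((1 - 1 / (q * Q) * x) / (1 - 1 / (q * Q))))
      = (q * q * Q - x) * (q * Q - x) / ((q ^ 2 * Q - 1) * (q * Q - 1)) * (1 - q * Q) := by
    have n1 : q ^ 2 * Q - 1 ≠ 0 := fun h => h10 (by linear_combination -h)
    have n2 : q * Q - 1 ≠ 0 := fun h => h7 (by field_simp; rw [h, mul_zero])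
    field_simp
  have e2 : (1 - b * Q) * (1 - b * q * Q) * ((1 - 1 / (b * Q * q) * x) / (1 - 1 / (b * Q * q))
      * ((1 - 1 / (b * Q) * x) / (1 - 1 / (b * Q)))) = (b * Q * q - x) * (b * Q - x) := by
    have n1 : b * Q * q - 1 ≠ 0 := fun h => h4 (by field_simp; rw [h, mul_zero])
    have n2 : b * Q - 1 ≠ 0 := fun h => h5 (by field_simp; rw [h, mul_zero])
    field_simp
    ring
  have e3 : (q * q * Q - x) * (q * Q - x) / ((q ^ 2 * Q - 1) * (q * Q - 1)) * (1 - q * Q)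
      = (q * q * Q - x) * (q * Q - x) / (1 - q ^ 2 * Q) := by
    have n1 : q ^ 2 * Q - 1 ≠ 0 := fun h => h10 (by linear_combination -h)
    have n2 : q * Q - 1 ≠ 0 := fun h => h7 (by field_simp; rw [h, mul_zero])
    field_simp
    ring
  have e4 : (1 - a * q * Q) * (1 - a * q * Q * q) * ((1 - a * q * Q * x) / (1 - a * q * Q)
      * ((1 - a * q * Q * q * x) / (1 - a * q * Q * q)))
      = (1 - a * q * Q * x) * (1 - a * q * Q * q * x) := by
    have n1 : 1 - a * q ^ 2 * Q ≠ 0 := fun h => h9 (by linear_combination h)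
    field_simp
  have e5 : (1 - a * b * Q * q) * ((1 - a * b * Q * x) / (1 - a * b * Q)
        * ((1 - a * b * Q * q * x) / (1 - a * b * Q * q)))
      = (1 - a * b * Q * x) / (1 - a * b * Q) * (1 - a * b * Q * q * x) := by
    field_simp
  have key : (1 - q ^ 2 * a / b * Q) * ((1 - a * x ^ 2) / (1 - a)
      * ((1 - a * b * Q * x) / (1 - a * b * Q) * (1 - a * b * Q * q * x))
      * ((b * Q * q - x) * (b * Q - x)))
      - (1 - b ^ 2 * Q) * ((1 - a * x ^ 2) / (1 - a)
        * ((q * q * Q - x) * (q * Q - x) / (1 - q ^ 2 * Q))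
        * ((1 - a * q * Q * x) * (1 - a * q * Q * q * x)))
    = -(b * (b - q) * (1 - a * b * q ^ 2 * Q ^ 2)) * (q * Q ^ 2)
        / ((1 - a * b * Q) * (1 - q ^ 2 * Q) * (1 - a))
      * (-(q / b) * ((1 - a * x) * (1 - b * x) * (1 - a * q / b * x ^ 2) * (1 - a * b * Q * x)
          * (1 - 1 / (q * q * Q) * x))
        - (1 - x) * (1 - a / b * x) * (1 - a * b / q * x ^ 2) * (1 - 1 / (b * Q) * x)
          * (1 - a * q * Q * q * x)) := by
    obtain ⟨c, rfl⟩ : ∃ c, a = b * c := ⟨a / b, by field_simp⟩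
    have P := parity_telescope_polynomial b c q Q x
    rw [show q ^ 2 * (b * c) / b = q ^ 2 * c by field_simp,
      show b * c * q / b = c * q by field_simp, show b * c / b = c by field_simp,
      show b * c * b = b ^ 2 * c by ring] at *
    rw [show 1 - 1 / (q * q * Q) * x = (q * q * Q - x) / (q * q * Q) by field_simp,
      show 1 - b ^ 2 * c / q * x ^ 2 = (q - b ^ 2 * c * x ^ 2) / q by field_simp,
      show 1 - 1 / (b * Q) * x = (b * Q - x) / (b * Q) by field_simp]
    -- The linear and quadratic factors become letters, so that clearing denominators does not
    -- expand them.
    generalize 1 - b * c * x ^ 2 = f₁ at *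
    generalize 1 - q ^ 2 * c * Q = f₂ at *
    generalize 1 - q ^ 2 * Q = f₃ at *
    generalize 1 - b ^ 2 * c * Q * x = f₄ at *
    generalize 1 - b ^ 2 * c * Q * q * x = f₅ at *
    generalize b * Q * q - x = f₆ at *
    generalize b * Q - x = f₇ at *
    generalize 1 - b ^ 2 * Q = f₈ at *
    generalize 1 - b ^ 2 * c * Q = f₉ at *
    generalize q * q * Q - x = g₁ at *
    generalize q * Q - x = g₂ at *
    generalize 1 - b * c * q * Q * x = g₃ at *
    generalize 1 - b * c * q * Q * q * x = g₄ at *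
    generalize b - q = g₅ at *
    generalize 1 - b ^ 2 * c * q ^ 2 * Q ^ 2 = g₆ at *
    generalize 1 - b * c * x = g₇ at *
    generalize 1 - b * x = g₈ at *
    generalize 1 - c * q * x ^ 2 = g₉ at *
    generalize 1 - x = t₁ at *
    generalize 1 - c * x = t₂ at *
    generalize q - b ^ 2 * c * x ^ 2 = t₃ at *
    generalize 1 - b * c = t₄ at *
    have L : f₂ * (f₁ / t₄ * (f₄ / f₉ * f₅) * (f₆ * f₇))
          - f₈ * (f₁ / t₄ * (g₁ * g₂ / f₃) * (g₃ * g₄))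
        = f₁ * (f₂ * f₃ * f₄ * f₅ * f₆ * f₇ - f₈ * f₉ * g₁ * g₂ * g₃ * g₄) / (t₄ * f₉ * f₃) := by
      field_simp
    rw [L, P]
    field_simp
    ring
  rw [← key, ← e2, ← e3, ← e1, ← e4, ← e5]
  ring

theorem mul_combination' {r s A B κ C D H E F : ℂ} (h : r * A - s * B = κ * (C - D))
    (hE : E = H * (κ * C)) (hF : F = H * (κ * D)) : r * (H * A) - s * (H * B) = E - F := by
  rw [hE, hF]; linear_combination H * h

/-- The step is two because the sums vanish for odd `m`. The certificate `G` has the same shape as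
for Jackson's sum and ends at `j = m + 3`, where `(q^(-m-2); q)_j` is zero. -/
theorem parityTerm_sum_recurrence {a b q : ℂ} (ha : a ≠ 0) (hb : b ≠ 0) (hq0 : q ≠ 0)
    (hq : QGeneric q) (hfa : QFree q a) (hfb : QFree q b) (hab : QFree q (a * b))
    (hab' : QFree q (a / b)) (hab2 : QFree (q ^ 2) (a * b * q)) (m : ℕ) :
    (1 - q ^ 2 * a / b * q ^ m) * (1 - b * q ^ m) * (1 - b * q * q ^ m)
        * (1 - a * b * q ^ m * q) * ∑ j ∈ Finset.range (m + 2 + 1), parityTerm a b q (q ^ (m + 2)) j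
      = (1 - b ^ 2 * q ^ m) * (1 - q * q ^ m) * (1 - a * q * q ^ m) * (1 - a * q * q ^ m * q)
        * ∑ j ∈ Finset.range (m + 1), parityTerm a b q (q ^ m) j := by
  obtain ⟨Q, hQ⟩ : ∃ Q, Q = q ^ m := ⟨_, rfl⟩
  have hQ0 : Q ≠ 0 := hQ ▸ pow_ne_zero m hq0
  have zQ : q ^ (m : ℤ) = Q := by rw [zpow_natCast, hQ]
  have zQ1 : q ^ ((m : ℤ) + 1) = Q * q := by rw [zpow_add_one₀ hq0, zQ]
  have zQ2 : q ^ ((m : ℤ) + 1 + 1) = Q * q * q := by rw [zpow_add_one₀ hq0, zQ1]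
  have n1 : 1 - a ≠ 0 := hfa.sub_ne_zero 0 (by simp)
  have n2 : 1 - a * b * Q ≠ 0 := hab.sub_ne_zero m (by rw [zQ])
  have n3 : 1 - a * b * Q * q ≠ 0 := hab.sub_ne_zero (m + 1) (by rw [zQ1]; ring)
  have n4 : 1 - 1 / (b * Q * q) ≠ 0 := hfb.inv.sub_ne_zero (-(m + 1)) (by
    rw [zpow_neg, zQ1]; field_simp)
  have n5 : 1 - 1 / (b * Q) ≠ 0 := hfb.inv.sub_ne_zero (-m) (by rw [zpow_neg, zQ]; field_simp)
  have n6 : 1 - 1 / (q * q * Q) ≠ 0 := hq.sub_ne_zero (-(m + 1 + 1)) (by omega) (by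
    rw [zpow_neg, zQ2]; field_simp)
  have n7 : 1 - 1 / (q * Q) ≠ 0 := hq.sub_ne_zero (-(m + 1)) (by omega) (by
    rw [zpow_neg, zQ1]; field_simp)
  have n8 : 1 - a * q * Q ≠ 0 := hfa.sub_ne_zero (m + 1) (by rw [zQ1]; ring)
  have n9 : 1 - a * q * Q * q ≠ 0 := hfa.sub_ne_zero (m + 1 + 1) (by rw [zQ2]; ring)
  have n10 : 1 - q ^ 2 * Q ≠ 0 := hq.sub_ne_zero (m + 1 + 1) (by omega) (by rw [zQ2]; ring)
  obtain ⟨κ, hκ⟩ : ∃ κ, κ = -(b * (b - q) * (1 - a * b * q ^ 2 * Q ^ 2)) * (q * Q ^ 2)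
        / ((1 - a * b * Q) * (1 - q ^ 2 * Q) * (1 - a)) := ⟨_, rfl⟩
  let G : ℕ → ℂ := fun j => κ * (qPoch a q j * qPoch b q j * qPoch (a * q / b) (q ^ 2) j
      * qPoch (a * b * Q) q j * qPoch (1 / (q * q * Q)) q j)
    * ((1 - q ^ j) / qPoch q q j) * ((1 - a / b * q ^ j) / qPoch (a * q / b) q j)
    * ((1 - a * b / q * (q ^ j) ^ 2) / qPoch (a * b * q) (q ^ 2) j)
    * ((1 - 1 / (b * Q) * q ^ j) / qPoch (q / (b * Q)) q j)
    * ((1 - a * q * Q * q * q ^ j) / qPoch (a * q * Q * q * q) q j) * (-(q / b)) ^ j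
  rw [← hQ, show q ^ (m + 2) = Q * q * q by rw [hQ]; ring]
  refine sum_recurrence (G := G) (by omega) ?_ (by simp [G]) ?_ ?_
  · intro j
    obtain ⟨x, hx⟩ : ∃ x, x = q ^ j := ⟨_, rfl⟩
    have zx : q ^ (j : ℤ) = x := by rw [zpow_natCast, hx]
    have zx1 : q ^ ((j : ℤ) + 1) = x * q := by rw [zpow_add_one₀ hq0, zx]
    have hx0 : x ≠ 0 := hx ▸ pow_ne_zero j hq0
    have n4x : 1 - 1 / (b * Q * q) * x ≠ 0 := hfb.inv.sub_ne_zero (j - (m + 1)) (by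
      rw [zpow_sub₀ hq0, zQ1, zx]; field_simp)
    have n5x : 1 - 1 / (b * Q) * x ≠ 0 := hfb.inv.sub_ne_zero (j - m) (by
      rw [zpow_sub₀ hq0, zQ, zx]; field_simp)
    have n8x : 1 - a * q * Q * x ≠ 0 := hfa.sub_ne_zero (j + (m + 1)) (by
      rw [zpow_add₀ hq0, zx, zQ1]; ring)
    have n9x : 1 - a * q * Q * q * x ≠ 0 := hfa.sub_ne_zero (j + (m + 1 + 1)) (by
      rw [zpow_add₀ hq0, zx, zQ2]; ring)
    have m1 : 1 - q * x ≠ 0 := hq.sub_ne_zero (j + 1) (by omega) (by rw [zx1]; ring)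
    have m2 : 1 - a * q / b * x ≠ 0 := hab'.sub_ne_zero (j + 1) (by rw [zx1]; ring)
    have m3 : 1 - a * b * q * (q ^ 2) ^ j ≠ 0 := hab2.sub_ne_zero j (by rw [zpow_natCast])
    have m4 : 1 - q / (b * Q) * x ≠ 0 := hfb.inv.sub_ne_zero (j + 1 - m) (by
      rw [zpow_sub₀ hq0, zQ, zx1]; field_simp)
    have m5 : 1 - a * q * Q * q * q * x ≠ 0 := hfa.sub_ne_zero (j + 1 + (m + 1 + 1)) (by
      rw [zpow_add₀ hq0, zx1, zQ2]; ring)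
    have T := parity_telescope (x := x) hb hq0 hQ0 n1 n2 n3 n4 n5 n7 n8 n9 n10
    rw [← hκ] at T
    have hG : G (j + 1) = (qPoch a q j * qPoch b q j * qPoch (a * q / b) (q ^ 2) j
          * qPoch (a * b * Q) q j * qPoch (1 / (q * q * Q)) q j)
        * ((qPoch q q j)⁻¹ * (qPoch (a * q / b) q j)⁻¹ * (qPoch (a * b * q) (q ^ 2) j)⁻¹
          * (qPoch (q / (b * Q)) q j)⁻¹ * (qPoch (a * q * Q * q * q) q j)⁻¹) * (-(q / b)) ^ j
        * (κ * (-(q / b) * ((1 - a * x) * (1 - b * x) * (1 - a * q / b * x ^ 2)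
          * (1 - a * b * Q * x) * (1 - 1 / (q * q * Q) * x)))) := by
      simp only [G]
      rw [div_qPoch_succ (x := q) (by rwa [← hx]) (pow_succ' q j),
        div_qPoch_succ (x := a * q / b) (by rwa [← hx]) (by ring),
        div_qPoch_succ (x := a * b * q) m3 (by rw [pow_succ q j]; field_simp; ring),
        div_qPoch_succ (x := q / (b * Q)) (by rwa [← hx]) (by ring),
        div_qPoch_succ (x := a * q * Q * q * q) (by rwa [← hx]) (by ring)]
      simp only [qPoch_succ, ← hx, show (q ^ 2) ^ j = x ^ 2 by rw [hx]; ring, pow_succ (-(q / b))]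
      generalize 1 - a * x = f₁
      generalize 1 - b * x = f₂
      generalize 1 - a * q / b * x ^ 2 = f₃
      generalize 1 - a * b * Q * x = f₄
      generalize 1 - 1 / (q * q * Q) * x = f₅
      ring
    have hF₁ : parityTerm a b q (Q * q * q) j
        = (qPoch a q j * qPoch b q j * qPoch (a * q / b) (q ^ 2) j
          * qPoch (a * b * Q) q j * qPoch (1 / (q * q * Q)) q j)
        * ((qPoch q q j)⁻¹ * (qPoch (a * q / b) q j)⁻¹ * (qPoch (a * b * q) (q ^ 2) j)⁻¹
          * (qPoch (q / (b * Q)) q j)⁻¹ * (qPoch (a * q * Q * q * q) q j)⁻¹) * (-(q / b)) ^ j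
        * ((1 - a * x ^ 2) / (1 - a)
          * ((1 - a * b * Q * x) / (1 - a * b * Q) * ((1 - a * b * Q * q * x) / (1 - a * b * Q * q)))
          * ((1 - 1 / (b * Q * q) * x) / (1 - 1 / (b * Q * q))
            * ((1 - 1 / (b * Q) * x) / (1 - 1 / (b * Q))))) := by
      rw [parityTerm, show a * b * (Q * q * q) = a * b * Q * q * q by ring, qPoch_mul_right n3,
        qPoch_mul_right n2, show q / (b * (Q * q * q)) = 1 / (b * Q * q) by field_simp,
        inv_qPoch_of_mul_right n4 (by rwa [← hx]),
        show 1 / (b * Q * q) * q = 1 / (b * Q) by field_simp,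
        inv_qPoch_of_mul_right n5 (by rwa [← hx]), show 1 / (b * Q) * q = q / (b * Q) by ring,
        show a * q * (Q * q * q) = a * q * Q * q * q by ring,
        show (Q * q * q)⁻¹ = 1 / (q * q * Q) by field_simp, pow_mul', ← hx]
      generalize (1 - a * b * Q * x) / (1 - a * b * Q) = f₁
      generalize (1 - a * b * Q * q * x) / (1 - a * b * Q * q) = f₂
      generalize (1 - 1 / (b * Q * q) * x) / (1 - 1 / (b * Q * q)) = f₃
      generalize (1 - 1 / (b * Q) * x) / (1 - 1 / (b * Q)) = f₄
      generalize (1 - a * x ^ 2) / (1 - a) = f₅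
      ring
    have hF₀ : parityTerm a b q Q j
        = (qPoch a q j * qPoch b q j * qPoch (a * q / b) (q ^ 2) j
          * qPoch (a * b * Q) q j * qPoch (1 / (q * q * Q)) q j)
        * ((qPoch q q j)⁻¹ * (qPoch (a * q / b) q j)⁻¹ * (qPoch (a * b * q) (q ^ 2) j)⁻¹
          * (qPoch (q / (b * Q)) q j)⁻¹ * (qPoch (a * q * Q * q * q) q j)⁻¹) * (-(q / b)) ^ j
        * ((1 - a * x ^ 2) / (1 - a)
          * ((1 - 1 / (q * q * Q) * x) / (1 - 1 / (q * q * Q))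
            * ((1 - 1 / (q * Q) * x) / (1 - 1 / (q * Q))))
          * ((1 - a * q * Q * x) / (1 - a * q * Q)
            * ((1 - a * q * Q * q * x) / (1 - a * q * Q * q)))) := by
      rw [parityTerm, inv_qPoch_of_mul_right n8 (by rwa [← hx]),
        inv_qPoch_of_mul_right n9 (by rwa [← hx]), show Q⁻¹ = 1 / (q * Q) * q by field_simp,
        qPoch_mul_right n7, show 1 / (q * Q) = 1 / (q * q * Q) * q by field_simp,
        qPoch_mul_right n6, show 1 / (q * q * Q) * q = 1 / (q * Q) by field_simp, pow_mul', ← hx]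
      generalize (1 - a * q * Q * x) / (1 - a * q * Q) = f₁
      generalize (1 - a * q * Q * q * x) / (1 - a * q * Q * q) = f₂
      generalize (1 - 1 / (q * q * Q) * x) / (1 - 1 / (q * q * Q)) = f₃
      generalize (1 - 1 / (q * Q) * x) / (1 - 1 / (q * Q)) = f₄
      generalize (1 - a * x ^ 2) / (1 - a) = f₅
      ring
    rw [hF₁, hF₀, hG]
    simp only [G, ← hx]
    exact mul_combination' T rfl (by simp only [div_eq_mul_inv]; ring)
  · simp only [G]
    rw [show 1 / (q * q * Q) = (q ^ (m + 2))⁻¹ by rw [pow_add, ← hQ]; field_simp,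
      qPoch_inv_pow_eq_zero hq0 (by omega)]
    simp
  · intro j hj
    rw [parityTerm, hQ, qPoch_inv_pow_eq_zero hq0 (by omega)]; simp

/-- The value of the sums of `parityTerm`, up to the first factor of the kernel. -/
noncomputable def parityValue (a b q : ℂ) (m : ℕ) : ℂ :=
  if Even m then qPoch (a * b) (q ^ 2) (m / 2) * qPoch (b ^ 2) (q ^ 2) (m / 2)
    / (qPoch (q ^ 2) (q ^ 2) (m / 2) * qPoch (q ^ 2 * a / b) (q ^ 2) (m / 2)) else 0

theorem parityValue_add_two (a b q : ℂ) (m : ℕ) :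
    parityValue a b q (m + 2) = parityValue a b q m
      * ((1 - a * b * q ^ m) * (1 - b ^ 2 * q ^ m)
        / ((1 - q ^ 2 * q ^ m) * (1 - q ^ 2 * a / b * q ^ m))) := by
  have he : Even (m + 2) ↔ Even m := by simp [Nat.even_add]
  by_cases h : Even m
  · obtain ⟨i, rfl⟩ := even_iff_exists_two_mul.1 h
    rw [parityValue, parityValue, if_pos h, if_pos (he.2 h), Nat.mul_div_cancel_left i two_pos,
      show (2 * i + 2) / 2 = i + 1 by omega, qPoch_succ, qPoch_succ, qPoch_succ, qPoch_succ,
      ← pow_mul]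
    simp only [div_eq_mul_inv, mul_inv]
    ring
  · rw [parityValue, parityValue, if_neg h, if_neg (mt he.1 h), zero_mul]

/-- Induction in steps of two. For length one the two terms cancel, and the recurrence carries this
zero to every odd length. -/
theorem parityTerm_sum {a b q : ℂ} (ha : a ≠ 0) (hb : b ≠ 0) (hq0 : q ≠ 0)
    (hq : QGeneric q) (hfa : QFree q a) (hfb : QFree q b) (hab : QFree q (a * b))
    (hab' : QFree q (a / b)) (hab2 : QFree (q ^ 2) (a * b * q)) :
    ∀ m : ℕ, qPoch b q m * qPoch (a * b) q m / (qPoch q q m * qPoch (a * q) q m)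
        * ∑ j ∈ Finset.range (m + 1), parityTerm a b q (q ^ m) j = parityValue a b q m
  | 0 => by
    have n1 : 1 - a ≠ 0 := hfa.sub_ne_zero 0 (by simp)
    simp [parityValue, parityTerm, qPoch_zero, div_self n1]
  | 1 => by
    have n1 : 1 - a ≠ 0 := hfa.sub_ne_zero 0 (by simp)
    have n2 : b - 1 ≠ 0 := fun h => hfb.sub_ne_zero 0 (y := b) (by simp) (by linear_combination -h)
    have n3 : 1 - q ≠ 0 := hq.sub_ne_zero 1 (by omega) (by simp)
    have n4 : b - a * q ≠ 0 := fun h => hab'.sub_ne_zero 1 (y := a / b * q) (by simp) (by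
      field_simp; rw [h, mul_zero])
    have n5 : 1 - a * b * q ≠ 0 := hab.sub_ne_zero 1 (by simp)
    have n6 : 1 - a * q ^ 2 ≠ 0 := hfa.sub_ne_zero 2 (by norm_cast)
    have : ∑ j ∈ Finset.range (1 + 1), parityTerm a b q (q ^ 1) j = 0 := by
      simp only [Finset.sum_range_succ, Finset.sum_range_zero, parityTerm, qPoch_succ, qPoch_zero]
      have e : 1 - q / (b * q ^ 1) * q ^ 0 = (b - 1) / b := by field_simp
      have e' : 1 - a * q / b * q ^ 0 = (b - a * q) / b := by field_simp
      have e'' : 1 - a * q * q ^ 1 * q ^ 0 = 1 - a * q ^ 2 := by ring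
      rw [e, e', e'']
      field_simp
      ring
    rw [this, mul_zero, parityValue, if_neg (by simp)]
  | m + 2 => by
    have ih := parityTerm_sum ha hb hq0 hq hfa hfb hab hab' hab2 m
    have R := parityTerm_sum_recurrence ha hb hq0 hq hfa hfb hab hab' hab2 m
    have zQ : q ^ ((m : ℤ) + 1) = q ^ m * q := by rw [zpow_add_one₀ hq0, zpow_natCast]
    have zQ2 : q ^ ((m : ℤ) + 1 + 1) = q ^ m * q * q := by rw [zpow_add_one₀ hq0, zQ]
    have n1 : 1 - q ^ 2 * a / b * q ^ m ≠ 0 := hab'.sub_ne_zero (m + 1 + 1) (by rw [zQ2]; ring)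
    have n2 : 1 - b * q ^ m ≠ 0 := hfb.sub_ne_zero m (by rw [zpow_natCast])
    have n3 : 1 - b * q * q ^ m ≠ 0 := hfb.sub_ne_zero (m + 1) (by rw [zQ]; ring)
    have n4 : 1 - a * b * q ^ m * q ≠ 0 := hab.sub_ne_zero (m + 1) (by rw [zQ]; ring)
    have n5 : 1 - q * q ^ m ≠ 0 := hq.sub_ne_zero (m + 1) (by omega) (by rw [zQ]; ring)
    have n6 : 1 - q ^ 2 * q ^ m ≠ 0 := hq.sub_ne_zero (m + 1 + 1) (by omega) (by rw [zQ2]; ring)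
    have n7 : 1 - a * q * q ^ m ≠ 0 := hfa.sub_ne_zero (m + 1) (by rw [zQ]; ring)
    have n8 : 1 - a * q * q ^ m * q ≠ 0 := hfa.sub_ne_zero (m + 1 + 1) (by rw [zQ2]; ring)
    rw [parityValue_add_two, ← ih, eq_div_mul_of_mul_eq_mul
      (mul_ne_zero (mul_ne_zero (mul_ne_zero n1 n2) n3) n4) R]
    simp only [qPoch_succ, pow_succ q m]
    rw [show 1 - b * (q ^ m * q) = 1 - b * q * q ^ m by ring,
      show 1 - a * b * (q ^ m * q) = 1 - a * b * q ^ m * q by ring,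
      show 1 - a * q * (q ^ m * q) = 1 - a * q * q ^ m * q by ring,
      show 1 - q * (q ^ m * q) = 1 - q ^ 2 * q ^ m by ring]
    generalize 1 - b * q ^ m = p₂ at *
    generalize 1 - b * q * q ^ m = p₃ at *
    generalize 1 - a * b * q ^ m * q = p₄ at *
    generalize 1 - q * q ^ m = p₅ at *
    generalize 1 - a * q * q ^ m = p₇ at *
    generalize 1 - a * q * q ^ m * q = p₈ at *
    rw [show ∀ B A X Y s t u v w : ℂ, B * p₂ * p₃ * (A * t * p₄) / (X * p₅ * v * (Y * p₇ * p₈))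
        * (u * p₅ * p₇ * p₈ / (w * p₂ * p₃ * p₄) * s)
        = B * A / (X * Y) * s * (t * u / (v * w)) * (p₂ / p₂) * (p₃ / p₃) * (p₄ / p₄) * (p₅ / p₅)
          * (p₇ / p₇) * (p₈ / p₈) from fun _ _ _ _ _ _ _ _ _ => by ring,
      div_self n2, div_self n3, div_self n4, div_self n5, div_self n7, div_self n8]
    simp only [mul_one]

/-- The second parameter is written as `a b`, so that `b` is its quotient by `a`. The sign `(-1)^j`
turns the factor `(q/b)^j` coming from the kernel into the argument `-q/b`. -/
theorem wpPair_parity {a b q : ℂ} (ha : a ≠ 0) (hb : b ≠ 0) (hq0 : q ≠ 0)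
    (hq : QGeneric q) (hfa : QFree q a) (hfb : QFree q b) (hab : QFree q (a * b))
    (hab' : QFree q (a / b)) (hab2 : QFree (q ^ 2) (a * b * q)) :
    IsWPBaileyPair a (a * b) q
      (fun j => (1 - a * q ^ (2 * j)) / (1 - a)
        * (qPoch a q j * qPoch b q j * qPoch (a * q / b) (q ^ 2) j
          * ((qPoch q q j)⁻¹ * (qPoch (a * q / b) q j)⁻¹ * (qPoch (a * b * q) (q ^ 2) j)⁻¹))
        * (-1) ^ j)
      (parityValue a b q) := by
  intro m
  rw [← parityTerm_sum ha hb hq0 hq hfa hfb hab hab' hab2, Finset.mul_sum]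
  refine Finset.sum_congr rfl fun j hj => ?_
  have hqm : q ^ m ≠ 0 := pow_ne_zero m hq0
  have e : a * b / a = b := by field_simp
  rw [wpKernel_eq ha (mul_ne_zero ha hb) hq0 hq (by rwa [e])
    (by simpa [Nat.lt_succ_iff] using hj), e, parityTerm,
    show a * q / (a * b * q ^ m) = q / (b * q ^ m) by field_simp,
    show a * q / (a * b) = q / b by field_simp,
    show (-(q / b)) ^ j = (q / b) ^ j * (-1) ^ j by rw [← mul_pow]; ring]
  ring

/-! ### From generic to arbitrary parameters -/

section Genericity

open Filter Topology Polynomial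

/-- The absolute values of the five numbers are multiplicatively independent. -/
def NormIndep (a b c d e : ℂ) : Prop := ∀ i₁ i₂ i₃ i₄ i₅ : ℤ,
  ‖a‖ ^ i₁ * ‖b‖ ^ i₂ * ‖c‖ ^ i₃ * ‖d‖ ^ i₄ * ‖e‖ ^ i₅ = 1 →
    i₁ = 0 ∧ i₂ = 0 ∧ i₃ = 0 ∧ i₄ = 0 ∧ i₅ = 0

/-- A nontrivial relation would be a nonzero integer polynomial with root `θ`. -/
theorem Transcendental.sum_ne_zero {θ : ℝ} (hθ : Transcendental ℤ θ) {i₁ i₂ i₃ i₄ i₅ : ℤ}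
    (h : (i₁ : ℝ) + i₂ * θ + i₃ * θ ^ 2 + i₄ * θ ^ 3 + i₅ * θ ^ 4 = 0) :
    i₁ = 0 ∧ i₂ = 0 ∧ i₃ = 0 ∧ i₄ = 0 ∧ i₅ = 0 := by
  have hp := transcendental_iff.1 hθ
    (C i₁ + C i₂ * X + C i₃ * X ^ 2 + C i₄ * X ^ 3 + C i₅ * X ^ 4) (by simpa using h)
  have c := fun n => congrArg (fun p : ℤ[X] => p.coeff n) hp
  have c0 := c 0
  have c1 := c 1
  have c2 := c 2
  have c3 := c 3
  have c4 := c 4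
  simp [coeff_X, coeff_C, coeff_X_pow, -eq_intCast] at c0 c1 c2 c3 c4
  exact ⟨c0, c1, c2, c3, c4⟩

/-- Multiply the five numbers by `exp ε, exp (θ ε), …, exp (θ^4 ε)` with `θ` transcendental. A
multiplicative relation between the absolute values becomes an affine equation in `ε` whose slope is
a nonzero polynomial value in `θ`, so each exponent vector excludes one `ε`. The excluded set is
countable and its complement is dense. -/
theorem exists_frequently_normIndep {a b c d e : ℂ} (ha : a ≠ 0) (hb : b ≠ 0) (hc : c ≠ 0)
    (hd : d ≠ 0) (he : e ≠ 0) : ∃ A B C D E : ℝ → ℂ, ContinuousAt A 0 ∧ ContinuousAt B 0 ∧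
      ContinuousAt C 0 ∧ ContinuousAt D 0 ∧ ContinuousAt E 0 ∧ A 0 = a ∧ B 0 = b ∧ C 0 = c ∧
      D 0 = d ∧ E 0 = e ∧ (∃ᶠ ε in 𝓝 (0 : ℝ), NormIndep (A ε) (B ε) (C ε) (D ε) (E ε)) ∧
      ∀ ε, A ε ≠ 0 ∧ B ε ≠ 0 ∧ C ε ≠ 0 ∧ D ε ≠ 0 ∧ E ε ≠ 0 := by
  obtain ⟨θ, hθ⟩ : ∃ θ : ℝ, Transcendental ℤ θ :=
    ⟨_, transcendental_liouvilleNumber (m := 2) le_rfl⟩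
  have hcont : ∀ (z : ℂ) (t : ℝ), ContinuousAt (fun ε : ℝ => z * Complex.exp (t * ε)) 0 :=
    fun z t => by fun_prop
  refine ⟨fun ε => a * Complex.exp ((1 : ℝ) * ε), fun ε => b * Complex.exp (θ * ε),
    fun ε => c * Complex.exp ((θ ^ 2 : ℝ) * ε), fun ε => d * Complex.exp ((θ ^ 3 : ℝ) * ε),
    fun ε => e * Complex.exp ((θ ^ 4 : ℝ) * ε), hcont _ _, hcont _ _, hcont _ _, hcont _ _,
    hcont _ _, by simp, by simp, by simp, by simp, by simp, ?_, by simp; tauto⟩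
  -- The only `ε` at which the relation with exponents `i` can hold; the zero vector merely adds one
  -- more excluded point.
  let bad : ℤ × ℤ × ℤ × ℤ × ℤ → ℝ := fun i =>
    -(i.1 * Real.log ‖a‖ + i.2.1 * Real.log ‖b‖ + i.2.2.1 * Real.log ‖c‖
      + i.2.2.2.1 * Real.log ‖d‖ + i.2.2.2.2 * Real.log ‖e‖)
    / (i.1 + i.2.1 * θ + i.2.2.1 * θ ^ 2 + i.2.2.2.1 * θ ^ 3 + i.2.2.2.2 * θ ^ 4)
  have hdense : Dense (Set.range bad)ᶜ := (Set.countable_range bad).dense_compl ℝ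
  refine (mem_closure_iff_frequently.1 (hdense 0)).mono fun ε hε i₁ i₂ i₃ i₄ i₅ h => ?_
  by_contra hne
  have hP := mt hθ.sum_ne_zero hne
  refine hε ⟨(i₁, i₂, i₃, i₄, i₅), ?_⟩
  have hn : ∀ (z : ℂ) (t : ℝ), z ≠ 0 → ‖z * Complex.exp (t * ε)‖ ≠ 0 := fun z t hz => by simp [hz]
  have hl : ∀ (z : ℂ) (t : ℝ), z ≠ 0 →
      Real.log ‖z * Complex.exp (t * ε)‖ = Real.log ‖z‖ + t * ε := fun z t hz => by
    rw [norm_mul, Real.log_mul (norm_ne_zero_iff.2 hz) (by simp), ← Complex.ofReal_mul,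
      Complex.norm_exp_ofReal, Real.log_exp]
  have L := congrArg Real.log h
  have n₁ := zpow_ne_zero i₁ (hn a 1 ha)
  have n₂ := zpow_ne_zero i₂ (hn b θ hb)
  have n₃ := zpow_ne_zero i₃ (hn c (θ ^ 2) hc)
  have n₄ := zpow_ne_zero i₄ (hn d (θ ^ 3) hd)
  have n₅ := zpow_ne_zero i₅ (hn e (θ ^ 4) he)
  rw [Real.log_mul (mul_ne_zero (mul_ne_zero (mul_ne_zero n₁ n₂) n₃) n₄) n₅,
    Real.log_mul (mul_ne_zero (mul_ne_zero n₁ n₂) n₃) n₄,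
    Real.log_mul (mul_ne_zero n₁ n₂) n₃, Real.log_mul n₁ n₂, Real.log_zpow, Real.log_zpow,
    Real.log_zpow, Real.log_zpow, Real.log_zpow, Real.log_one, hl a 1 ha, hl b θ hb,
    hl c (θ ^ 2) hc, hl d (θ ^ 3) hd, hl e (θ ^ 4) he] at L
  simp only [bad]
  rw [div_eq_iff hP]
  linear_combination -L

namespace NormIndep

variable {a b q d e : ℂ}

theorem qGeneric (h : NormIndep a b q d e) : QGeneric q := fun i hi hqi => by
  have := (h 0 0 i 0 0 (by rw [← norm_zpow q, hqi]; simp)).2.2.1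
  exact hi this

/-- Multiplication by `q^i` changes only the exponent of `q`, so a nonzero exponent elsewhere keeps
the absolute value away from `1`. Absolute values ignore signs, which is why the same argument
covers `-y`. -/
theorem qFree (h : NormIndep a b q d e) (hq : q ≠ 0) (i₁ i₂ i₃ i₄ i₅ : ℤ)
    (hi : i₁ ≠ 0 ∨ i₂ ≠ 0 ∨ i₄ ≠ 0 ∨ i₅ ≠ 0) {y : ℂ}
    (hy : y = a ^ i₁ * b ^ i₂ * q ^ i₃ * d ^ i₄ * e ^ i₅) : QFree q y := fun i hyi => by
  have := h i₁ i₂ (i₃ + i) i₄ i₅ (by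
    rw [hy] at hyi
    rw [zpow_add₀ (norm_ne_zero_iff.2 hq)]
    have := congrArg norm hyi
    simp only [norm_mul, norm_zpow, norm_one] at this
    linear_combination this)
  tauto

theorem qFree_neg (h : NormIndep a b q d e) (hq : q ≠ 0) (i₁ i₂ i₃ i₄ i₅ : ℤ)
    (hi : i₁ ≠ 0 ∨ i₂ ≠ 0 ∨ i₄ ≠ 0 ∨ i₅ ≠ 0) {y : ℂ}
    (hy : y = a ^ i₁ * b ^ i₂ * q ^ i₃ * d ^ i₄ * e ^ i₅) : QFree q (-y) := fun i hyi => by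
  have := h i₁ i₂ (i₃ + i) i₄ i₅ (by
    rw [hy] at hyi
    rw [zpow_add₀ (norm_ne_zero_iff.2 hq)]
    have := congrArg norm hyi
    simp only [norm_mul, norm_neg, norm_zpow, norm_one] at this
    linear_combination this)
  tauto

end NormIndep

theorem ContinuousAt.qPoch {X : Type*} [TopologicalSpace X] {f g : X → ℂ} {x : X}
    (hf : ContinuousAt f x) (hg : ContinuousAt g x) (n : ℕ) :
    ContinuousAt (fun y => qPoch (f y) (g y) n) x := by
  unfold _root_.qPoch
  exact tendsto_finsetProd _ fun i _ => (continuousAt_const.sub (hf.mul (hg.pow i)))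
attribute [fun_prop] ContinuousAt.qPoch

theorem continuousAt_rhsFactor {A K Q : ℝ → ℂ} (hA : ContinuousAt A 0) (hK : ContinuousAt K 0)
    (hQ : ContinuousAt Q 0) (hA0 : A 0 ≠ 0) (hK0 : K 0 ≠ 0) {n : ℕ}
    (h : RhsRegular (A 0) (K 0) (Q 0) n) :
    ContinuousAt (fun ε => rhsFactor (A ε) (K ε) (Q ε) n) 0 := by
  obtain ⟨h₁, h₂, -, -⟩ := h
  simp only [rhsFactor, qPochs_two] at h₁ ⊢
  fun_prop (disch := (repeat' (first | assumption | apply pow_ne_zero | apply mul_ne_zero | dsimp only)))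

theorem continuousAt_rhsWeight {A K Q : ℝ → ℂ} (hA : ContinuousAt A 0) (hK : ContinuousAt K 0)
    (hQ : ContinuousAt Q 0) (hA0 : A 0 ≠ 0) (hQ0 : Q 0 ≠ 0) {n j : ℕ} (hj : j ≤ n)
    (h : RhsRegular (A 0) (K 0) (Q 0) n) :
    ContinuousAt (fun ε => rhsWeight (A ε) (K ε) (Q ε) n j) 0 := by
  obtain ⟨-, -, h₃, h₄⟩ := h
  simp only [rhsWeight, qPochs_two] at h₄ ⊢
  have h₅ := qPoch_ne_zero_of_le (left_ne_zero_of_mul h₄) hj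
  have h₆ := qPoch_ne_zero_of_le (right_ne_zero_of_mul h₄) hj
  have hz : ∀ i : ℤ, ContinuousAt (fun ε => Q ε ^ i) 0 := fun i => hQ.zpow₀ i (Or.inl hQ0)
  have hz₁ := hz (-2 * (n : ℤ))
  have hz₂ := hz (2 - 2 * (n : ℤ))
  fun_prop (disch := (repeat' (first | assumption | apply pow_ne_zero | apply mul_ne_zero | dsimp only)))

theorem continuousAt_lhsWeight {A K Q : ℝ → ℂ} (hA : ContinuousAt A 0) (hK : ContinuousAt K 0)
    (hQ : ContinuousAt Q 0) (hK0 : K 0 ≠ 0) (hQ0 : Q 0 ≠ 0) {n j : ℕ} (hj : j ≤ n)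
    (h : qPoch (A 0 ^ 2 * Q 0 ^ (2 - 2 * (n : ℤ)) / K 0) (Q 0 ^ 2) n
      * qPoch (A 0 ^ 2 * Q 0 ^ (2 * n + 2)) (Q 0 ^ 2) n ≠ 0) :
    ContinuousAt (fun ε => lhsWeight (A ε) (K ε) (Q ε) n j) 0 := by
  simp only [lhsWeight]
  have h₅ := qPoch_ne_zero_of_le (left_ne_zero_of_mul h) hj
  have h₆ := qPoch_ne_zero_of_le (right_ne_zero_of_mul h) hj
  have hz : ∀ i : ℤ, ContinuousAt (fun ε => Q ε ^ i) 0 := fun i => hQ.zpow₀ i (Or.inl hQ0)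
  have hz₁ := hz (-2 * (n : ℤ))
  have hz₂ := hz (2 - 2 * (n : ℤ))
  fun_prop (disch := (repeat' (first | assumption | apply pow_ne_zero | apply mul_ne_zero | dsimp only)))

/-- For fixed `n` both sides are finite sums of functions of `ε` that are continuous at `0`, and two
such functions that agree at points accumulating at `0` agree there. Only the denominators at `ε =
0` have to be nonzero. -/
theorem transformation_closure {A K Q : ℝ → ℂ} (hA : ContinuousAt A 0) (hK : ContinuousAt K 0)
    (hQ : ContinuousAt Q 0) (hA0 : A 0 ≠ 0) (hK0 : K 0 ≠ 0) (hQ0 : Q 0 ≠ 0) {n : ℕ}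
    (hr : RhsRegular (A 0) (K 0) (Q 0) n)
    (hl : qPoch (A 0 ^ 2 * Q 0 ^ (2 - 2 * (n : ℤ)) / K 0) (Q 0 ^ 2) n
      * qPoch (A 0 ^ 2 * Q 0 ^ (2 * n + 2)) (Q 0 ^ 2) n ≠ 0)
    {α β : ℝ → ℕ → ℂ} (hα : ∀ j ≤ n, ContinuousAt (fun ε => α ε j) 0)
    (hβ : ∀ j ≤ n, ContinuousAt (fun ε => β ε j) 0)
    (hfreq : ∃ᶠ ε in 𝓝 (0 : ℝ),
      ∑ j ∈ Finset.range (n + 1), lhsWeight (A ε) (K ε) (Q ε) n j * α ε j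
        = rhsFactor (A ε) (K ε) (Q ε) n
          * ∑ j ∈ Finset.range (n + 1), rhsWeight (A ε) (K ε) (Q ε) n j * β ε j) :
    ∑ j ∈ Finset.range (n + 1), lhsWeight (A 0) (K 0) (Q 0) n j * α 0 j
      = rhsFactor (A 0) (K 0) (Q 0) n
        * ∑ j ∈ Finset.range (n + 1), rhsWeight (A 0) (K 0) (Q 0) n j * β 0 j := by
  have hm : ∀ j ∈ Finset.range (n + 1), j ≤ n := fun j hj => by
    simpa [Nat.lt_succ_iff] using hj
  exact tendsto_nhds_unique_of_frequently_eq
    (tendsto_finsetSum _ fun j hj =>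
      (continuousAt_lhsWeight hA hK hQ hK0 hQ0 (hm j hj) hl).mul (hα j (hm j hj)))
    ((continuousAt_rhsFactor hA hK hQ hA0 hK0 hr).mul (tendsto_finsetSum _ fun j hj =>
      (continuousAt_rhsWeight hA hK hQ hA0 hQ0 (hm j hj) hr).mul (hβ j (hm j hj)))) hfreq

/-! ### Identities from pairs: normal forms and terminating series -/

/-- The quotient on the right is the limiting form compatible with the factors `±√a` of the
statements: it involves only denominators that are assumed nonzero, whereas `1 - a` may vanish when
`n = 0`. -/
theorem vwp_quotient {a q : ℂ} {j : ℕ} (h : 1 - a ≠ 0) (h' : qPoch a (q ^ 2) j ≠ 0) :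
    (1 - a * q ^ (2 * j)) / (1 - a) = qPoch (a * q ^ 2) (q ^ 2) j / qPoch a (q ^ 2) j := by
  rw [div_eq_div_iff h h', pow_mul, mul_comm, ← qPoch_shift, mul_comm]

theorem sum_eq_of_wpPair {a k q : ℂ} (ha : a ≠ 0) (hk : k ≠ 0) (hq0 : q ≠ 0)
    (hq : QGeneric q) (hfa : QFree q a) (hfa' : QFree q (-a)) (hK : QFree q (k / a))
    (hK' : QFree q (-(k / a))) (hB : QFree q (k / a ^ 2)) {α β α' β' : ℕ → ℂ}
    (hβ : IsWPBaileyPair a (k / a) q α β) (hα' : ∀ j, (q ^ 2 * a ^ 2 / k) ^ j * α j = α' j)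
    (hβ' : ∀ j, β j * q ^ j = β' j) (n : ℕ) :
    ∑ j ∈ Finset.range (n + 1), lhsWeight a k q n j * α' j
      = rhsFactor a k q n * ∑ j ∈ Finset.range (n + 1), rhsWeight a k q n j * β' j := by
  simpa only [mul_assoc, hα', hβ'] using wpBailey_transformation ha hk hq0 hq hfa hfa' hK hK' hB hβ n

theorem NormIndep.sum_eq_of_wpPair {a k q d e : ℂ} (h : NormIndep a k q d e) (ha : a ≠ 0)
    (hk : k ≠ 0) (hq0 : q ≠ 0) {α β α' β' : ℕ → ℂ}
    (hβ : IsWPBaileyPair a (k / a) q α β) (hα' : ∀ j, (q ^ 2 * a ^ 2 / k) ^ j * α j = α' j)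
    (hβ' : ∀ j, β j * q ^ j = β' j) (n : ℕ) :
    ∑ j ∈ Finset.range (n + 1), lhsWeight a k q n j * α' j
      = rhsFactor a k q n * ∑ j ∈ Finset.range (n + 1), rhsWeight a k q n j * β' j :=
  _root_.sum_eq_of_wpPair ha hk hq0 h.qGeneric
    (h.qFree hq0 1 0 0 0 0 (by simp) (by field_simp))
    (h.qFree_neg hq0 1 0 0 0 0 (by simp) (by field_simp))
    (h.qFree hq0 (-1) 1 0 0 0 (by simp) (by field_simp))
    (h.qFree_neg hq0 (-1) 1 0 0 0 (by simp) (by field_simp))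
    (h.qFree hq0 (-2) 1 0 0 0 (by simp) (by field_simp)) hβ hα' hβ' n

theorem qPochs_eq_zero {as : List ℂ} {x q : ℂ} {j : ℕ} (hx : x ∈ as) (h : qPoch x q j = 0) :
    qPochs as q j = 0 :=
  List.prod_eq_zero (List.mem_map.2 ⟨x, hx, h⟩)

/-- Beyond the termination index the numerator is zero, so the term is zero even where its
denominator vanishes too, division by zero giving zero. -/
theorem basicHyp_eq_sum {as bs : List ℂ} {q z : ℂ} {n : ℕ} (hlen : as.length = bs.length + 1)
    (h : ∀ j, n < j → qPochs as q j = 0) :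
    basicHyp as bs q z
      = ∑ j ∈ Finset.range (n + 1), qPochs as q j / (qPoch q q j * qPochs bs q j) * z ^ j := by
  rw [basicHyp, tsum_eq_sum (s := Finset.range (n + 1)) fun j hj => by
    rw [h j (by simpa using hj)]; simp]
  refine Finset.sum_congr rfl fun j _ => ?_
  rw [show 1 + (bs.length : ℤ) - (as.length : ℤ) = 0 by rw [hlen]; push_cast; ring, zpow_zero,
    mul_one]

theorem basicHyp_eq_sum_of_mem {as bs : List ℂ} {q z : ℂ} {n : ℕ} (hq : q ≠ 0)
    (hlen : as.length = bs.length + 1) (h : q ^ (-(n : ℤ)) ∈ as) :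
    basicHyp as bs q z
      = ∑ j ∈ Finset.range (n + 1), qPochs as q j / (qPoch q q j * qPochs bs q j) * z ^ j :=
  basicHyp_eq_sum hlen fun _ hj => qPochs_eq_zero h (qPoch_eq_zero hq hj)

theorem qPoch_sq_of_eq {x y q : ℂ} (h : y = x ^ 2) (j : ℕ) :
    qPoch y (q ^ 2) j = qPoch x q j * qPoch (-x) q j := by
  rw [h, qPoch_mul_neg]

theorem lhsWeight_denominators {a t k q : ℂ} (ht : t ^ 2 = k) (n j : ℕ) :
    qPoch (a ^ 2 * q ^ (2 - 2 * (n : ℤ)) / k) (q ^ 2) j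
        * qPoch (a ^ 2 * q ^ (2 * n + 2)) (q ^ 2) j
      = qPoch (a * q ^ (1 - (n : ℤ)) / t) q j * qPoch (-(a * q ^ (1 - (n : ℤ)) / t)) q j
        * (qPoch (a * q ^ (n + 1)) q j * qPoch (-(a * q ^ (n + 1))) q j) := by
  rw [qPoch_mul_neg, qPoch_mul_neg, ← ht, div_pow, mul_pow, mul_pow, ← pow_mul,
    ← zpow_natCast (q ^ (1 - (n : ℤ))), ← zpow_mul]
  congr 4
  · push_cast; ring_nf
  · ring

/-- Translates the weight from base `q^2` into the parameters `±√k q^n`, `±q^(-n)` and their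
denominators, as they appear in the series of base `q`. -/
theorem lhsWeight_eq_of_sq {a t k q : ℂ} (ht : t ^ 2 = k) (n j : ℕ) :
    lhsWeight a k q n j
      = qPoch (t * q ^ n) q j * qPoch (-(t * q ^ n)) q j
          * (qPoch (q ^ (-(n : ℤ))) q j * qPoch (-(q ^ (-(n : ℤ)))) q j)
        / (qPoch (a * q ^ (1 - (n : ℤ)) / t) q j * qPoch (-(a * q ^ (1 - (n : ℤ)) / t)) q j
          * (qPoch (a * q ^ (n + 1)) q j * qPoch (-(a * q ^ (n + 1))) q j)) := by
  rw [← lhsWeight_denominators ht, lhsWeight, qPoch_mul_neg, qPoch_mul_neg, ← ht, mul_pow, ← pow_mul,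
    mul_comm n 2, ← zpow_natCast (q ^ (-(n : ℤ))), ← zpow_mul]
  congr 4
  push_cast; ring

/-! ### The identity with two free parameters -/

/-- Free of square roots, so that `a` and `k` can be perturbed without choosing branches; the given
roots are put back only at the point itself. -/
noncomputable def singhAlpha (a k q ρ₁ ρ₂ : ℂ) (j : ℕ) : ℂ :=
  qPoch (a * q ^ 2) (q ^ 2) j / qPoch a (q ^ 2) j
    * (qPoch a q j * qPoch ρ₁ q j * qPoch ρ₂ q j * qPoch (a ^ 3 * q / (k * ρ₁ * ρ₂)) q j
      / (qPoch q q j * qPoch (a * q / ρ₁) q j * qPoch (a * q / ρ₂) q j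
        * qPoch (k * ρ₁ * ρ₂ / a ^ 2) q j)) * (q ^ 2) ^ j

noncomputable def singhBeta (a k q ρ₁ ρ₂ : ℂ) (j : ℕ) : ℂ :=
  qPoch (k * ρ₁ / a ^ 2) q j * qPoch (k * ρ₂ / a ^ 2) q j * qPoch (k / a) q j
      * qPoch (a * q / (ρ₁ * ρ₂)) q j
    / (qPoch (a * q / ρ₁) q j * qPoch (a * q / ρ₂) q j * qPoch (k * ρ₁ * ρ₂ / a ^ 2) q j
      * qPoch q q j) * q ^ j

theorem NormIndep.singh {a k q ρ₁ ρ₂ : ℂ} (h : NormIndep a k q ρ₁ ρ₂) (ha : a ≠ 0) (hk : k ≠ 0)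
    (hq : q ≠ 0) (h₁ : ρ₁ ≠ 0) (h₂ : ρ₂ ≠ 0) (n : ℕ) :
    ∑ j ∈ Finset.range (n + 1), lhsWeight a k q n j * singhAlpha a k q ρ₁ ρ₂ j
      = rhsFactor a k q n
        * ∑ j ∈ Finset.range (n + 1), rhsWeight a k q n j * singhBeta a k q ρ₁ ρ₂ j := by
  have hfa : QFree q a := h.qFree hq 1 0 0 0 0 (by simp) (by field_simp)
  have P := wpPair_singh (ρ₁ := ρ₁) (ρ₂ := ρ₂) ha (div_ne_zero hk ha) hq h₁ h₂ h.qGeneric hfa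
    (h.qFree hq (-1) 1 0 0 0 (by simp) (by field_simp))
    (h.qFree hq (-2) 1 0 0 0 (by simp) (by field_simp))
    (h.qFree hq 1 0 0 (-1) 0 (by simp) (by field_simp))
    (h.qFree hq 1 0 0 0 (-1) (by simp) (by field_simp))
    (h.qFree hq (-2) 1 0 1 1 (by simp) (by field_simp))
  refine h.sum_eq_of_wpPair ha hk hq P (fun j => ?_) (fun j => ?_) n
  · rw [singhAlpha, vwp_quotient (hfa.sub_ne_zero 0 (by simp))
        (hfa.base_sq.qPoch_ne_zero (pow_ne_zero 2 hq) 0 (by simp) _),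
      show k / a * ρ₁ * ρ₂ / a = k * ρ₁ * ρ₂ / a ^ 2 by field_simp,
      show a ^ 2 * q / (k / a * ρ₁ * ρ₂) = a ^ 3 * q / (k * ρ₁ * ρ₂) by field_simp,
      show (q ^ 2) ^ j = (q ^ 2 * a ^ 2 / k) ^ j * (k / a / a) ^ j by
        rw [← mul_pow]; congr 1; field_simp]
    simp only [div_eq_mul_inv, mul_inv]
    ring
  · rw [singhBeta, show k / a * ρ₁ * ρ₂ / a = k * ρ₁ * ρ₂ / a ^ 2 by field_simp,
      show k / a * ρ₁ / a = k * ρ₁ / a ^ 2 by field_simp,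
      show k / a * ρ₂ / a = k * ρ₂ / a ^ 2 by field_simp]

theorem singh_transformation {a k q ρ₁ ρ₂ : ℂ} (ha : a ≠ 0) (hk : k ≠ 0) (hq : q ≠ 0)
    (h₁ : ρ₁ ≠ 0) (h₂ : ρ₂ ≠ 0) {n : ℕ} (hr : RhsRegular a k q n)
    (hl : qPoch (a ^ 2 * q ^ (2 - 2 * (n : ℤ)) / k) (q ^ 2) n
      * qPoch (a ^ 2 * q ^ (2 * n + 2)) (q ^ 2) n ≠ 0)
    (hd₁ : qPoch a (q ^ 2) n ≠ 0) (hd₂ : qPoch q q n ≠ 0) (hd₃ : qPoch (a * q / ρ₁) q n ≠ 0)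
    (hd₄ : qPoch (a * q / ρ₂) q n ≠ 0) (hd₅ : qPoch (k * ρ₁ * ρ₂ / a ^ 2) q n ≠ 0) :
    ∑ j ∈ Finset.range (n + 1), lhsWeight a k q n j * singhAlpha a k q ρ₁ ρ₂ j
      = rhsFactor a k q n
        * ∑ j ∈ Finset.range (n + 1), rhsWeight a k q n j * singhBeta a k q ρ₁ ρ₂ j := by
  obtain ⟨A, K, Q, R, S, hA, hK, hQ, hR, hS, rfl, rfl, rfl, rfl, rfl, hf, hne⟩ :=
    exists_frequently_normIndep ha hk hq h₁ h₂
  refine transformation_closure (α := fun ε => singhAlpha (A ε) (K ε) (Q ε) (R ε) (S ε))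
    (β := fun ε => singhBeta (A ε) (K ε) (Q ε) (R ε) (S ε)) hA hK hQ ha hk hq hr hl
    (fun j hj => ?_) (fun j hj => ?_) (hf.mono fun ε hε => by
      obtain ⟨hA0, hK0, hQ0, hR0, hS0⟩ := hne ε
      exact hε.singh hA0 hK0 hQ0 hR0 hS0 n)
  all_goals
    replace hd₁ := qPoch_ne_zero_of_le hd₁ hj
    replace hd₂ := qPoch_ne_zero_of_le hd₂ hj
    replace hd₃ := qPoch_ne_zero_of_le hd₃ hj
    replace hd₄ := qPoch_ne_zero_of_le hd₄ hj
    replace hd₅ := qPoch_ne_zero_of_le hd₅ hj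
    simp only [singhAlpha, singhBeta]
    fun_prop (disch := (repeat' (first
      | assumption | apply pow_ne_zero | apply mul_ne_zero | dsimp only)))

theorem singh_identity {a k q s t ρ₁ ρ₂ : ℂ} (ha : a ≠ 0) (hk : k ≠ 0) (hq : q ≠ 0)
    (hs : s ^ 2 = a) (ht : t ^ 2 = k) (h₁ : ρ₁ ≠ 0) (h₂ : ρ₂ ≠ 0) {n : ℕ}
    (hr : RhsRegular a k q n)
    (hd : qPochs [q, s, -s, a * q / ρ₁, a * q / ρ₂, k * ρ₁ * ρ₂ / a ^ 2,
        a * q ^ (1 - (n : ℤ)) / t, -(a * q ^ (1 - (n : ℤ)) / t),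
        a * q ^ (n + 1), -(a * q ^ (n + 1))] q n ≠ 0) :
      basicHyp
        [a, q * s, -(q * s), ρ₁, ρ₂, a ^ 3 * q / (k * ρ₁ * ρ₂), t * q ^ n, -(t * q ^ n),
          q ^ (-(n : ℤ)), -(q ^ (-(n : ℤ)))]
        [s, -s, a * q / ρ₁, a * q / ρ₂, k * ρ₁ * ρ₂ / a ^ 2,
          a * q ^ (1 - (n : ℤ)) / t, -(a * q ^ (1 - (n : ℤ)) / t),
          a * q ^ (n + 1), -(a * q ^ (n + 1))]
        q (q ^ 2)
      = rhsFactor a k q n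
          * ∑ j ∈ Finset.range (n + 1),
            rhsWeight a k q n j
              * (qPochs [k * ρ₁ / a ^ 2, k * ρ₂ / a ^ 2, k / a, a * q / (ρ₁ * ρ₂)] q j
                / qPochs [a * q / ρ₁, a * q / ρ₂, k * ρ₁ * ρ₂ / a ^ 2, q] q j)
              * q ^ j := by
  simp only [qPochs, List.map_cons, List.map_nil, List.prod_cons, List.prod_nil, mul_one, ne_eq,
    mul_eq_zero, not_or] at hd
  obtain ⟨d₁, d₂, d₃, d₄, d₅, d₆, d₇, d₈, d₉, d₁₀⟩ := hd
  have T := singh_transformation ha hk hq h₁ h₂ hr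
    (by
      rw [lhsWeight_denominators ht]
      exact mul_ne_zero (mul_ne_zero d₇ d₈) (mul_ne_zero d₉ d₁₀))
    (by rw [qPoch_sq_of_eq hs.symm]; exact mul_ne_zero d₂ d₃) d₁ d₄ d₅ d₆
  rw [basicHyp_eq_sum_of_mem (n := n) hq rfl (by simp)]
  refine Eq.trans (Finset.sum_congr rfl fun j _ => ?_) (T.trans (congrArg _
    (Finset.sum_congr rfl fun j _ => ?_)))
  · rw [lhsWeight_eq_of_sq ht, singhAlpha, qPoch_sq_of_eq hs.symm,
      qPoch_sq_of_eq (x := q * s) (y := a * q ^ 2) (by rw [← hs]; ring)]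
    simp only [qPochs, List.map_cons, List.map_nil, List.prod_cons, List.prod_nil, mul_one,
      div_eq_mul_inv, mul_inv]
    ring
  · rw [singhBeta]
    simp only [qPochs, List.map_cons, List.map_nil, List.prod_cons, List.prod_nil, mul_one,
      div_eq_mul_inv, mul_inv]
    ring

/-! ### The identity from the unit pair -/

noncomputable def bressoudAlpha (a k q : ℂ) (j : ℕ) : ℂ :=
  qPoch (a * q ^ 2) (q ^ 2) j / qPoch a (q ^ 2) j
    * (qPoch a q j * qPoch (k / (a ^ 2 * q)) q j * qPoch (q * a ^ 3 / k) q (2 * j)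
      / (qPoch q q j * qPoch (a ^ 3 * q ^ 2 / k) q j * qPoch (k / a) q (2 * j))) * (q ^ 2) ^ j

noncomputable def bressoudBeta (a k q : ℂ) (j : ℕ) : ℂ :=
  qPoch (k ^ 2 / (q * a ^ 4)) q j / qPoch q q j * q ^ j

theorem NormIndep.bressoud {a k q d e : ℂ} (h : NormIndep a k q d e) (ha : a ≠ 0) (hk : k ≠ 0)
    (hq : q ≠ 0) (hd : d ≠ 0) (n : ℕ) :
    ∑ j ∈ Finset.range (n + 1), lhsWeight a k q n j * bressoudAlpha a k q j
      = rhsFactor a k q n * ∑ j ∈ Finset.range (n + 1), rhsWeight a k q n j * bressoudBeta a k q j := by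
  have hfa : QFree q a := h.qFree hq 1 0 0 0 0 (by simp) (by field_simp)
  -- The auxiliary parameter of the pair is a spare generic coordinate; it does not occur in the
  -- result.
  have P := wpPair_bressoud (ρ := d) ha (div_ne_zero hk ha) hq hd h.qGeneric hfa
    (h.qFree hq (-1) 1 0 0 0 (by simp) (by field_simp))
    (h.qFree hq 2 (-1) 0 0 0 (by simp) (by field_simp))
    (h.qFree hq 3 (-1) 0 0 0 (by simp) (by field_simp))
    (h.qFree hq (-4) 2 0 0 0 (by simp) (by field_simp))
    (h.qFree hq 0 0 0 1 0 (by simp) (by field_simp))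
    (h.qFree hq 1 0 0 (-1) 0 (by simp) (by field_simp))
  refine h.sum_eq_of_wpPair ha hk hq P (fun j => ?_) (fun j => ?_) n
  · rw [bressoudAlpha, vwp_quotient (hfa.sub_ne_zero 0 (by simp))
        (hfa.base_sq.qPoch_ne_zero (pow_ne_zero 2 hq) 0 (by simp) _),
      show k / a / (a * q) = k / (a ^ 2 * q) by field_simp,
      show q * a ^ 2 / (k / a) = q * a ^ 3 / k by field_simp,
      show a ^ 2 * q ^ 2 / (k / a) = a ^ 3 * q ^ 2 / k by field_simp,
      show (q ^ 2) ^ j = (q ^ 2 * a ^ 2 / k) ^ j * (k / a / a) ^ j by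
        rw [← mul_pow]; congr 1; field_simp]
    ring
  · rw [bressoudBeta, show (k / a) ^ 2 / (q * a ^ 2) = k ^ 2 / (q * a ^ 4) by field_simp]

theorem bressoud_transformation {a k q : ℂ} (ha : a ≠ 0) (hk : k ≠ 0) (hq : q ≠ 0) {n : ℕ}
    (hr : RhsRegular a k q n)
    (hl : qPoch (a ^ 2 * q ^ (2 - 2 * (n : ℤ)) / k) (q ^ 2) n
      * qPoch (a ^ 2 * q ^ (2 * n + 2)) (q ^ 2) n ≠ 0)
    (hd₁ : qPoch a (q ^ 2) n ≠ 0) (hd₂ : qPoch q q n ≠ 0)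
    (hd₃ : qPoch (a ^ 3 * q ^ 2 / k) q n ≠ 0) (hd₄ : qPoch (k / a) q (2 * n) ≠ 0) :
    ∑ j ∈ Finset.range (n + 1), lhsWeight a k q n j * bressoudAlpha a k q j
      = rhsFactor a k q n * ∑ j ∈ Finset.range (n + 1), rhsWeight a k q n j * bressoudBeta a k q j := by
  -- The last two coordinates are spare, so their base point `1` is arbitrary.
  obtain ⟨A, K, Q, R, S, hA, hK, hQ, -, -, rfl, rfl, rfl, -, -, hf, hne⟩ :=
    exists_frequently_normIndep ha hk hq one_ne_zero one_ne_zero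
  refine transformation_closure (α := fun ε => bressoudAlpha (A ε) (K ε) (Q ε))
    (β := fun ε => bressoudBeta (A ε) (K ε) (Q ε)) hA hK hQ ha hk hq hr hl
    (fun j hj => ?_) (fun j hj => ?_) (hf.mono fun ε hε => by
      obtain ⟨hA0, hK0, hQ0, hR0, -⟩ := hne ε
      exact hε.bressoud hA0 hK0 hQ0 hR0 n)
  all_goals
    replace hd₁ := qPoch_ne_zero_of_le hd₁ hj
    replace hd₂ := qPoch_ne_zero_of_le hd₂ hj
    replace hd₃ := qPoch_ne_zero_of_le hd₃ hj
    replace hd₄ := qPoch_ne_zero_of_le hd₄ (Nat.mul_le_mul_left 2 hj)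
    simp only [bressoudAlpha, bressoudBeta]
    fun_prop (disch := (repeat' (first
      | assumption | apply pow_ne_zero | apply mul_ne_zero | dsimp only)))

theorem bressoud_identity {a k q s : ℂ} (ha : a ≠ 0) (hk : k ≠ 0) (hq : q ≠ 0)
    (hs : s ^ 2 = a) {n : ℕ} (hr : RhsRegular a k q n)
    (hd : qPochs [s, -s, q, a ^ 3 * q ^ 2 / k] q n ≠ 0)
    (hl : qPochs [a ^ 2 * q ^ (2 - 2 * (n : ℤ)) / k, a ^ 2 * q ^ (2 * n + 2)] (q ^ 2) n ≠ 0)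
    (hd₄ : qPoch (k / a) q (2 * n) ≠ 0) :
      ∑ j ∈ Finset.range (n + 1),
        qPochs [a, q * s, -(q * s), k / (a ^ 2 * q)] q j
            * qPochs [q ^ (-2 * (n : ℤ)), k * q ^ (2 * n)] (q ^ 2) j
            * qPoch (q * a ^ 3 / k) q (2 * j)
          / (qPochs [s, -s, q, a ^ 3 * q ^ 2 / k] q j
            * qPochs [a ^ 2 * q ^ (2 - 2 * (n : ℤ)) / k,
                a ^ 2 * q ^ (2 * n + 2)] (q ^ 2) j
            * qPoch (k / a) q (2 * j))
          * q ^ (2 * j)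
      = rhsFactor a k q n
          * ∑ j ∈ Finset.range (n + 1),
            rhsWeight a k q n j * (qPoch (k ^ 2 / (q * a ^ 4)) q j / qPoch q q j)
              * q ^ j := by
  simp only [qPochs, List.map_cons, List.map_nil, List.prod_cons, List.prod_nil, mul_one, ne_eq,
    mul_eq_zero, not_or] at hd
  obtain ⟨d₁, d₂, d₃, d₄⟩ := hd
  have T := bressoud_transformation ha hk hq hr (by rwa [← qPochs_two])
    (by rw [qPoch_sq_of_eq hs.symm]; exact mul_ne_zero d₁ d₂) d₃ d₄ hd₄
  refine Eq.trans (Finset.sum_congr rfl fun j _ => ?_) (T.trans (congrArg _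
    (Finset.sum_congr rfl fun j _ => ?_)))
  · rw [lhsWeight, bressoudAlpha, qPoch_sq_of_eq hs.symm,
      qPoch_sq_of_eq (x := q * s) (y := a * q ^ 2) (by rw [← hs]; ring), ← pow_mul q 2 j]
    simp only [qPochs, List.map_cons, List.map_nil, List.prod_cons, List.prod_nil, mul_one,
      div_eq_mul_inv, mul_inv]
    ring
  · rw [bressoudBeta, mul_assoc]

/-! ### The identity containing the square root of `k/a` -/

/-- This root occurs by itself and cannot be squared away. Hence `a` and `r` are taken as
coordinates and `k = r^2 a`, which keeps the root continuous under perturbation. -/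
noncomputable def sqrtAlpha (a r q : ℂ) (j : ℕ) : ℂ :=
  qPoch (a * q ^ 2) (q ^ 2) j / qPoch a (q ^ 2) j
    * (qPoch a q j * qPoch (a ^ 2 * q / r ^ 2) (q ^ 2) j * qPoch (a / r) q j
        * qPoch (-(a * q / r)) q j * qPoch (r ^ 2 / a) q j
      / (qPoch q q j * qPoch (r ^ 2 * q) (q ^ 2) j * qPoch (q * r) q j * qPoch (-r) q j
        * qPoch (q * a ^ 2 / r ^ 2) q j)) * (q ^ 2) ^ j

noncomputable def sqrtBeta (a r q : ℂ) (j : ℕ) : ℂ :=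
  qPoch r q j * qPoch (r ^ 4 / a ^ 2) q j / (qPoch (q * r) q j * qPoch q q j) * q ^ j

theorem NormIndep.sqrt {a r q d e : ℂ} (h : NormIndep a r q d e) (ha : a ≠ 0) (hr : r ≠ 0)
    (hq : q ≠ 0) (n : ℕ) :
    ∑ j ∈ Finset.range (n + 1), lhsWeight a (r ^ 2 * a) q n j * sqrtAlpha a r q j
      = rhsFactor a (r ^ 2 * a) q n
        * ∑ j ∈ Finset.range (n + 1), rhsWeight a (r ^ 2 * a) q n j * sqrtBeta a r q j := by
  have hfa : QFree q a := h.qFree hq 1 0 0 0 0 (by simp) (by field_simp)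
  have e : r ^ 2 * a / a = r ^ 2 := by field_simp
  have hr2 : QFree q (r ^ 2) := h.qFree hq 0 2 0 0 0 (by simp) (by field_simp)
  have P := wpPair_sqrt ha hr hq h.qGeneric hfa
    (h.qFree hq 0 1 0 0 0 (by simp) (by field_simp)) hr2
    (h.qFree hq (-1) 2 0 0 0 (by simp) (by field_simp))
    (h.qFree hq 2 (-2) 0 0 0 (by simp) (by field_simp))
    (h.qFree hq 1 (-1) 0 0 0 (by simp) (by field_simp))
    (h.qFree hq (-2) 4 0 0 0 (by simp) (by field_simp))
  rw [← e] at P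
  refine _root_.sum_eq_of_wpPair ha (mul_ne_zero (pow_ne_zero 2 hr) ha) hq h.qGeneric hfa
    (h.qFree_neg hq 1 0 0 0 0 (by simp) (by field_simp)) (by rwa [e])
    (by rw [e]; exact h.qFree_neg hq 0 2 0 0 0 (by simp) (by field_simp))
    (h.qFree hq (-1) 2 0 0 0 (by simp) (by field_simp)) P (fun j => ?_) (fun j => ?_) n
  · simp only [e]
    rw [sqrtAlpha, vwp_quotient (hfa.sub_ne_zero 0 (by simp))
        (hfa.base_sq.qPoch_ne_zero (pow_ne_zero 2 hq) 0 (by simp) _),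
      show (q ^ 2) ^ j = (q ^ 2 * a ^ 2 / (r ^ 2 * a)) ^ j * (r ^ 2 / a) ^ j by
        rw [← mul_pow]; congr 1; field_simp]
    ring
  · rw [sqrtBeta]

theorem sqrt_transformation {a r q : ℂ} (ha : a ≠ 0) (hr0 : r ≠ 0) (hq : q ≠ 0) {n : ℕ}
    (hr : RhsRegular a (r ^ 2 * a) q n)
    (hl : qPoch (a ^ 2 * q ^ (2 - 2 * (n : ℤ)) / (r ^ 2 * a)) (q ^ 2) n
      * qPoch (a ^ 2 * q ^ (2 * n + 2)) (q ^ 2) n ≠ 0)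
    (hd₁ : qPoch a (q ^ 2) n ≠ 0) (hd₂ : qPoch q q n ≠ 0)
    (hd₃ : qPoch (r ^ 2 * q) (q ^ 2) n ≠ 0) (hd₄ : qPoch (q * r) q n ≠ 0)
    (hd₅ : qPoch (-r) q n ≠ 0) (hd₆ : qPoch (q * a ^ 2 / r ^ 2) q n ≠ 0) :
    ∑ j ∈ Finset.range (n + 1), lhsWeight a (r ^ 2 * a) q n j * sqrtAlpha a r q j
      = rhsFactor a (r ^ 2 * a) q n
        * ∑ j ∈ Finset.range (n + 1), rhsWeight a (r ^ 2 * a) q n j * sqrtBeta a r q j := by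
  obtain ⟨A, R, Q, S, T, hA, hR, hQ, -, -, rfl, rfl, rfl, -, -, hf, hne⟩ :=
    exists_frequently_normIndep ha hr0 hq one_ne_zero one_ne_zero
  refine transformation_closure (K := fun ε => R ε ^ 2 * A ε)
    (α := fun ε => sqrtAlpha (A ε) (R ε) (Q ε))
    (β := fun ε => sqrtBeta (A ε) (R ε) (Q ε)) hA ((hR.pow 2).mul hA) hQ ha
    (mul_ne_zero (pow_ne_zero 2 hr0) ha) hq hr hl
    (fun j hj => ?_) (fun j hj => ?_) (hf.mono fun ε hε => by
      obtain ⟨hA0, hR0, hQ0, -⟩ := hne ε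
      exact hε.sqrt hA0 hR0 hQ0 n)
  all_goals
    replace hd₁ := qPoch_ne_zero_of_le hd₁ hj
    replace hd₂ := qPoch_ne_zero_of_le hd₂ hj
    replace hd₃ := qPoch_ne_zero_of_le hd₃ hj
    replace hd₄ := qPoch_ne_zero_of_le hd₄ hj
    replace hd₅ := qPoch_ne_zero_of_le hd₅ hj
    replace hd₆ := qPoch_ne_zero_of_le hd₆ hj
    simp only [sqrtAlpha, sqrtBeta]
    fun_prop (disch := (repeat' (first
      | assumption | apply pow_ne_zero | apply mul_ne_zero | dsimp only)))

theorem sqrt_identity {a k q s t r v w : ℂ} (ha : a ≠ 0) (hk : k ≠ 0) (hq : q ≠ 0)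
    (hs : s ^ 2 = a) (ht : t ^ 2 = k) (hrk : r ^ 2 = k / a) (hv : v ^ 2 = q * a / k)
    (hw : w ^ 2 = k * q / a) {n : ℕ} (hr : RhsRegular a k q n)
    (hd : qPochs [q, s, -s, w, -w, q * r, -r, q * a ^ 3 / k,
        a * q ^ (1 - (n : ℤ)) / t, -(a * q ^ (1 - (n : ℤ)) / t),
        a * q ^ (n + 1), -(a * q ^ (n + 1))] q n ≠ 0) :
      basicHyp
        [a, q * s, -(q * s), a * v, -(a * v), a * r⁻¹, -(a * q * r⁻¹), k / a ^ 2,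
          q ^ (-(n : ℤ)), -(q ^ (-(n : ℤ))), t * q ^ n, -(t * q ^ n)]
        [s, -s, w, -w, q * r, -r, q * a ^ 3 / k,
          a * q ^ (1 - (n : ℤ)) / t, -(a * q ^ (1 - (n : ℤ)) / t),
          a * q ^ (n + 1), -(a * q ^ (n + 1))]
        q (q ^ 2)
      = rhsFactor a k q n
          * ∑ j ∈ Finset.range (n + 1),
            rhsWeight a k q n j
              * (qPochs [r, k ^ 2 / a ^ 4] q j / qPochs [q * r, q] q j)
              * q ^ j := by
  obtain rfl : k = r ^ 2 * a := by rw [hrk]; field_simp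
  have hr0 : r ≠ 0 := fun h => hk (by simp [h])
  have e₁ : q * a ^ 3 / (r ^ 2 * a) = q * a ^ 2 / r ^ 2 := by field_simp
  have e₂ : r ^ 2 * a / a ^ 2 = r ^ 2 / a := by field_simp
  have e₃ : (r ^ 2 * a) ^ 2 / a ^ 4 = r ^ 4 / a ^ 2 := by field_simp
  have hw' : r ^ 2 * q = w ^ 2 := by rw [hw]; field_simp
  have hv' : a ^ 2 * q / r ^ 2 = (a * v) ^ 2 := by rw [mul_pow, hv]; field_simp
  rw [e₁] at hd ⊢
  rw [e₂]
  simp only [qPochs, List.map_cons, List.map_nil, List.prod_cons, List.prod_nil, mul_one, ne_eq,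
    mul_eq_zero, not_or] at hd
  obtain ⟨d₁, d₂, d₃, d₄, d₅, d₆, d₇, d₈, d₉, d₁₀, d₁₁, d₁₂⟩ := hd
  have T := sqrt_transformation ha hr0 hq hr
    (by
      rw [lhsWeight_denominators ht]
      exact mul_ne_zero (mul_ne_zero d₉ d₁₀) (mul_ne_zero d₁₁ d₁₂))
    (by rw [qPoch_sq_of_eq hs.symm]; exact mul_ne_zero d₂ d₃) d₁
    (by rw [qPoch_sq_of_eq hw']; exact mul_ne_zero d₄ d₅) d₆ d₇ d₈
  rw [basicHyp_eq_sum_of_mem (n := n) hq rfl (by simp)]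
  refine Eq.trans (Finset.sum_congr rfl fun j _ => ?_) (T.trans (congrArg _
    (Finset.sum_congr rfl fun j _ => ?_)))
  · rw [lhsWeight_eq_of_sq ht, sqrtAlpha, qPoch_sq_of_eq hs.symm,
      qPoch_sq_of_eq (x := q * s) (y := a * q ^ 2) (by rw [← hs]; ring),
      qPoch_sq_of_eq hw', qPoch_sq_of_eq hv', div_eq_mul_inv a r, div_eq_mul_inv (a * q) r]
    generalize r⁻¹ = r'
    simp only [qPochs, List.map_cons, List.map_nil, List.prod_cons, List.prod_nil, mul_one,
      div_eq_mul_inv, mul_inv]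
    ring
  · rw [sqrtBeta, e₃]
    simp only [qPochs, List.map_cons, List.map_nil, List.prod_cons, List.prod_nil, mul_one]
    ring

/-! ### The identity with `α` on even indices -/

noncomputable def evenAlpha (a k q : ℂ) (j : ℕ) : ℂ :=
  if Even j then qPoch (a * q ^ 4) (q ^ 4) (j / 2) / qPoch a (q ^ 4) (j / 2)
    * (qPoch a (q ^ 2) (j / 2) * qPoch (a ^ 4 / k ^ 2) (q ^ 2) (j / 2)
      / (qPoch (q ^ 2) (q ^ 2) (j / 2) * qPoch (q ^ 2 * k ^ 2 / a ^ 3) (q ^ 2) (j / 2)))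
    * (q ^ 2) ^ j else 0

noncomputable def evenBeta (a k q : ℂ) (j : ℕ) : ℂ :=
  qPoch (k / a) q j * qPoch (a ^ 2 / k) q j * qPoch (k ^ 2 * q / a ^ 3) (q ^ 2) j
    / (qPoch (a * q) (q ^ 2) j * qPoch (q * k ^ 2 / a ^ 3) q j * qPoch q q j)
    * (-k * q / a ^ 2) ^ j

theorem NormIndep.even {a k q d e : ℂ} (h : NormIndep a k q d e) (ha : a ≠ 0) (hk : k ≠ 0)
    (hq : q ≠ 0) (n : ℕ) :
    ∑ j ∈ Finset.range (n + 1), lhsWeight a k q n j * evenAlpha a k q j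
      = rhsFactor a k q n * ∑ j ∈ Finset.range (n + 1), rhsWeight a k q n j * evenBeta a k q j := by
  have hfa : QFree q a := h.qFree hq 1 0 0 0 0 (by simp) (by field_simp)
  have P := wpPair_even ha (div_ne_zero hk ha) hq h.qGeneric hfa
    (h.qFree hq (-2) 1 0 0 0 (by simp) (by field_simp))
    (h.qFree hq (-3) 2 0 0 0 (by simp) (by field_simp))
  have q20 : q ^ 2 ≠ 0 := pow_ne_zero 2 hq
  refine h.sum_eq_of_wpPair ha hk hq P (fun j => ?_) (fun j => ?_) n
  · rw [evenAlpha]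
    split_ifs with hj
    · obtain ⟨i, rfl⟩ := even_iff_exists_two_mul.1 hj
      rw [Nat.mul_div_cancel_left i two_pos, pow_mul q 2 (2 * i),
        vwp_quotient (hfa.sub_ne_zero 0 (by simp))
          (hfa.base_sq.base_sq.qPoch_ne_zero (pow_ne_zero 2 q20) 0 (by simp) _), ← pow_mul q 2 2,
        show q ^ 2 * (k / a) ^ 2 / a = q ^ 2 * k ^ 2 / a ^ 3 by field_simp,
        show a ^ 2 / (k / a) ^ 2 = a ^ 4 / k ^ 2 by field_simp,
        show (q ^ 2) ^ (2 * i) = (q ^ 2 * a ^ 2 / k) ^ (2 * i) * (k / a / a) ^ (2 * i) by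
          rw [← mul_pow]; congr 1; field_simp]
      simp only [div_eq_mul_inv, mul_inv]
      ring
    · simp
  · rw [evenBeta, show a / (k / a) = a ^ 2 / k by field_simp,
      show (k / a) ^ 2 * q / a = k ^ 2 * q / a ^ 3 by field_simp,
      show q * (k / a) ^ 2 / a = q * k ^ 2 / a ^ 3 by field_simp, mul_assoc, ← mul_pow]
    congr 2
    field_simp

theorem even_transformation {a k q : ℂ} (ha : a ≠ 0) (hk : k ≠ 0) (hq : q ≠ 0) {n : ℕ}
    (hr : RhsRegular a k q (2 * n))
    (hl : qPoch (a ^ 2 * q ^ (2 - 2 * ((2 * n : ℕ) : ℤ)) / k) (q ^ 2) (2 * n)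
      * qPoch (a ^ 2 * q ^ (2 * (2 * n) + 2)) (q ^ 2) (2 * n) ≠ 0)
    (hd₁ : qPoch a (q ^ 4) n ≠ 0) (hd₂ : qPoch (q ^ 2) (q ^ 2) n ≠ 0)
    (hd₃ : qPoch (q ^ 2 * k ^ 2 / a ^ 3) (q ^ 2) n ≠ 0)
    (hd₄ : qPoch (a * q) (q ^ 2) (2 * n) ≠ 0) (hd₅ : qPoch (q * k ^ 2 / a ^ 3) q (2 * n) ≠ 0)
    (hd₆ : qPoch q q (2 * n) ≠ 0) :
    ∑ j ∈ Finset.range (2 * n + 1), lhsWeight a k q (2 * n) j * evenAlpha a k q j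
      = rhsFactor a k q (2 * n)
        * ∑ j ∈ Finset.range (2 * n + 1), rhsWeight a k q (2 * n) j * evenBeta a k q j := by
  obtain ⟨A, K, Q, R, S, hA, hK, hQ, -, -, rfl, rfl, rfl, -, -, hf, hne⟩ :=
    exists_frequently_normIndep ha hk hq one_ne_zero one_ne_zero
  refine transformation_closure (α := fun ε => evenAlpha (A ε) (K ε) (Q ε))
    (β := fun ε => evenBeta (A ε) (K ε) (Q ε)) hA hK hQ ha hk hq hr hl
    (fun j hj => ?_) (fun j hj => ?_) (hf.mono fun ε hε => by
      obtain ⟨hA0, hK0, hQ0, -⟩ := hne ε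
      exact hε.even hA0 hK0 hQ0 _)
  all_goals
    have hj' : j / 2 ≤ n := by omega
    replace hd₁ := qPoch_ne_zero_of_le hd₁ hj'
    replace hd₂ := qPoch_ne_zero_of_le hd₂ hj'
    replace hd₃ := qPoch_ne_zero_of_le hd₃ hj'
    replace hd₄ := qPoch_ne_zero_of_le hd₄ hj
    replace hd₅ := qPoch_ne_zero_of_le hd₅ hj
    replace hd₆ := qPoch_ne_zero_of_le hd₆ hj
    simp only [evenAlpha, evenBeta]
    try split_ifs
    all_goals fun_prop (disch := (repeat' (first
      | assumption | apply pow_ne_zero | apply mul_ne_zero | dsimp only)))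

theorem even_identity {a k q s p : ℂ} (ha : a ≠ 0) (hk : k ≠ 0) (hq : q ≠ 0)
    (hs : s ^ 2 = a) (hp : p ^ 2 = a * q) {n : ℕ} (hr : RhsRegular a k q (2 * n))
    (hl : qPochs [a ^ 2 * q ^ (2 - 4 * (n : ℤ)) / k, a ^ 2 * q ^ (4 * n + 2)]
        (q ^ 2) (2 * n) ≠ 0)
    (hd : qPochs [q ^ 2, s, -s, q ^ 2 * k ^ 2 / a ^ 3] (q ^ 2) n ≠ 0)
    (hd' : qPochs [p, -p, q * k ^ 2 / a ^ 3, q] q (2 * n) ≠ 0) :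
      ∑ j ∈ Finset.range (n + 1),
        qPochs [q ^ (-4 * (n : ℤ)), k * q ^ (4 * n)] (q ^ 2) (2 * j)
            * qPochs [a, q ^ 2 * s, -(q ^ 2 * s), a ^ 4 / k ^ 2] (q ^ 2) j
          / (qPochs [a ^ 2 * q ^ (2 - 4 * (n : ℤ)) / k,
                a ^ 2 * q ^ (4 * n + 2)] (q ^ 2) (2 * j)
            * qPochs [q ^ 2, s, -s, q ^ 2 * k ^ 2 / a ^ 3] (q ^ 2) j)
          * q ^ (4 * j)
      = rhsFactor a k q (2 * n)
          * ∑ j ∈ Finset.range (2 * n + 1),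
            rhsWeight a k q (2 * n) j
              * (qPochs [k / a, k * p / a ^ 2, -(k * p / a ^ 2), a ^ 2 / k] q j
                / qPochs [p, -p, q * k ^ 2 / a ^ 3, q] q j)
              * (-k * q / a ^ 2) ^ j := by
  have z₁ : 2 - 2 * ((2 * n : ℕ) : ℤ) = 2 - 4 * n := by push_cast; ring
  have z₂ : 2 * (2 * n) = 4 * n := by ring
  have z₃ : -2 * ((2 * n : ℕ) : ℤ) = -4 * n := by push_cast; ring
  have hs4 : ∀ j, qPoch a (q ^ 4) j = qPoch s (q ^ 2) j * qPoch (-s) (q ^ 2) j := fun j => by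
    rw [← qPoch_sq_of_eq hs.symm, ← pow_mul]
  simp only [qPochs, List.map_cons, List.map_nil, List.prod_cons, List.prod_nil, mul_one, ne_eq,
    mul_eq_zero, not_or] at hd hd'
  obtain ⟨d₁, d₂, d₃, d₄⟩ := hd
  obtain ⟨d₅, d₆, d₇, d₈⟩ := hd'
  have T := even_transformation ha hk hq hr (by rwa [z₁, z₂, ← qPochs_two])
    (by rw [hs4]; exact mul_ne_zero d₂ d₃) d₁ d₄
    (by rw [qPoch_sq_of_eq hp.symm]; exact mul_ne_zero d₅ d₆) d₇ d₈
  -- Only even indices contribute on the left, which halves its range of summation.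
  rw [sum_range_even fun i hi => by rw [evenAlpha, if_neg hi, mul_zero]] at T
  refine Eq.trans (Finset.sum_congr rfl fun j _ => ?_) (T.trans (congrArg _
    (Finset.sum_congr rfl fun j _ => ?_)))
  · rw [lhsWeight, evenAlpha, if_pos (even_two_mul j), Nat.mul_div_cancel_left j two_pos, z₁, z₂, z₃,
      hs4, show qPoch (a * q ^ 4) (q ^ 4) j
        = qPoch (q ^ 2 * s) (q ^ 2) j * qPoch (-(q ^ 2 * s)) (q ^ 2) j by
        rw [← qPoch_sq_of_eq (y := a * q ^ 4) (by rw [← hs]; ring), ← pow_mul],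
      ← pow_mul q 2 (2 * j), show 2 * (2 * j) = 4 * j by ring]
    simp only [qPochs, List.map_cons, List.map_nil, List.prod_cons, List.prod_nil, mul_one,
      div_eq_mul_inv, mul_inv]
    ring
  · rw [evenBeta, qPoch_sq_of_eq hp.symm, qPoch_sq_of_eq (x := k * p / a ^ 2)
      (y := k ^ 2 * q / a ^ 3) (by rw [div_pow, mul_pow, hp]; field_simp)]
    simp only [qPochs, List.map_cons, List.map_nil, List.prod_cons, List.prod_nil, mul_one,
      div_eq_mul_inv, mul_inv]
    ring

/-! ### The two quadratic identities -/

theorem lhsWeight_base_sq (a k q : ℂ) (n j : ℕ) :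
    lhsWeight a k (q ^ 2) n j
      = qPoch (k * q ^ (4 * n)) (q ^ 4) j * qPoch (q ^ (-4 * (n : ℤ))) (q ^ 4) j
        / (qPoch (a ^ 2 * q ^ (4 - 4 * (n : ℤ)) / k) (q ^ 4) j
          * qPoch (a ^ 2 * q ^ (4 * n + 4)) (q ^ 4) j) := by
  have z : ∀ i : ℤ, (q ^ 2) ^ i = q ^ (2 * i) := fun i => by rw [zpow_mul, zpow_ofNat]
  rw [lhsWeight, z, z, ← pow_mul, ← pow_mul, ← pow_mul, show 2 * (2 * n) = 4 * n by ring,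
    show 2 * (2 * n + 2) = 4 * n + 4 by ring, show 2 * (-2 * (n : ℤ)) = -4 * n by ring,
    show 2 * (2 - 2 * (n : ℤ)) = 4 - 4 * n by ring]

theorem lhsWeight_base_sq_denominators (a k q : ℂ) (n j : ℕ) :
    qPoch (a ^ 2 * (q ^ 2) ^ (2 - 2 * (n : ℤ)) / k) ((q ^ 2) ^ 2) j
        * qPoch (a ^ 2 * (q ^ 2) ^ (2 * n + 2)) ((q ^ 2) ^ 2) j
      = qPochs [a ^ 2 * q ^ (4 - 4 * (n : ℤ)) / k, a ^ 2 * q ^ (4 * n + 4)] (q ^ 4) j := by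
  have z : ∀ i : ℤ, (q ^ 2) ^ i = q ^ (2 * i) := fun i => by rw [zpow_mul, zpow_ofNat]
  rw [qPochs_two, z, ← pow_mul, ← pow_mul, show 2 * (2 * n + 2) = 4 * n + 4 by ring,
    show 2 * (2 - 2 * (n : ℤ)) = 4 - 4 * n by ring]

/-- Here `s = √a` and `q` are the independent coordinates, while the transformation is applied to
`s^2` and base `q^2`. -/
theorem NormIndep.sum_eq_of_wpPair_base_sq {s k q d e : ℂ} (h : NormIndep s k q d e) (hs : s ≠ 0)
    (hk : k ≠ 0) (hq : q ≠ 0) {α β α' β' : ℕ → ℂ}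
    (hβ : IsWPBaileyPair (s ^ 2) (k / s ^ 2) (q ^ 2) α β)
    (hα' : ∀ j, ((q ^ 2) ^ 2 * (s ^ 2) ^ 2 / k) ^ j * α j = α' j)
    (hβ' : ∀ j, β j * (q ^ 2) ^ j = β' j) (n : ℕ) :
    ∑ j ∈ Finset.range (n + 1), lhsWeight (s ^ 2) k (q ^ 2) n j * α' j
      = rhsFactor (s ^ 2) k (q ^ 2) n
        * ∑ j ∈ Finset.range (n + 1), rhsWeight (s ^ 2) k (q ^ 2) n j * β' j :=
  _root_.sum_eq_of_wpPair (pow_ne_zero 2 hs) hk (pow_ne_zero 2 hq) h.qGeneric.sq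
    (h.qFree hq 2 0 0 0 0 (by simp) (by field_simp)).base_sq
    (h.qFree_neg hq 2 0 0 0 0 (by simp) (by field_simp)).base_sq
    (h.qFree hq (-2) 1 0 0 0 (by simp) (by field_simp)).base_sq
    (h.qFree_neg hq (-2) 1 0 0 0 (by simp) (by field_simp)).base_sq
    (h.qFree hq (-4) 1 0 0 0 (by simp) (by field_simp)).base_sq hβ hα' hβ' n

noncomputable def quadraticAlpha (s k q : ℂ) (j : ℕ) : ℂ :=
  (1 - s * q ^ (2 * j)) / (1 - s) * (qPoch s q j * qPoch (s ^ 4 * q / k) q j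
    / (qPoch q q j * qPoch (k / s ^ 3) q j)) * q ^ (3 * j)

noncomputable def quadraticBeta (s k q : ℂ) (j : ℕ) : ℂ :=
  qPoch (k / s ^ 2) (q ^ 2) j * qPoch (s ^ 4 * q ^ 2 / k) (q ^ 2) j
      * qPoch (-(k / s ^ 3)) q (2 * j)
    / (qPoch (q ^ 2) (q ^ 2) j * qPoch (k ^ 2 / s ^ 6) (q ^ 2) j * qPoch (-(q * s)) q (2 * j))
    * (k * q / s ^ 4) ^ j

theorem NormIndep.quadratic {s k q d e : ℂ} (h : NormIndep s k q d e) (hs : s ≠ 0) (hk : k ≠ 0)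
    (hq : q ≠ 0) (n : ℕ) :
    ∑ j ∈ Finset.range (n + 1), lhsWeight (s ^ 2) k (q ^ 2) n j * quadraticAlpha s k q j
      = rhsFactor (s ^ 2) k (q ^ 2) n
        * ∑ j ∈ Finset.range (n + 1), rhsWeight (s ^ 2) k (q ^ 2) n j * quadraticBeta s k q j := by
  have P := wpPair_quadratic hs (div_ne_zero hk (pow_ne_zero 2 hs)) hq h.qGeneric
    (h.qFree hq 1 0 0 0 0 (by simp) (by field_simp))
    (h.qFree_neg hq 1 0 0 0 0 (by simp) (by field_simp))
    (h.qFree hq (-3) 1 0 0 0 (by simp) (by field_simp))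
    (h.qFree_neg hq (-3) 1 0 0 0 (by simp) (by field_simp))
    (h.qFree hq (-4) 1 0 0 0 (by simp) (by field_simp))
  refine h.sum_eq_of_wpPair_base_sq hs hk hq P (fun j => ?_) (fun j => ?_) n
  · rw [quadraticAlpha, show s ^ 2 * q / (k / s ^ 2) = s ^ 4 * q / k by field_simp,
      show k / s ^ 2 / s = k / s ^ 3 by field_simp, pow_mul q 3,
      show (q ^ 3) ^ j
        = ((q ^ 2) ^ 2 * (s ^ 2) ^ 2 / k) ^ j * (k / s ^ 2 / (s ^ 2 * q)) ^ j by
        rw [← mul_pow]; congr 1; field_simp]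
    simp only [div_eq_mul_inv, mul_inv]
    ring
  · rw [quadraticBeta, show s ^ 2 * q ^ 2 / (k / s ^ 2) = s ^ 4 * q ^ 2 / k by field_simp,
      show k / s ^ 2 / s = k / s ^ 3 by field_simp,
      show (k / s ^ 2) ^ 2 / s ^ 2 = k ^ 2 / s ^ 6 by field_simp, mul_assoc, ← mul_pow,
      show k / s ^ 2 / (s ^ 2 * q) * q ^ 2 = k * q / s ^ 4 by field_simp]

theorem quadratic_transformation {s k q : ℂ} (hs : s ≠ 0) (hk : k ≠ 0) (hq : q ≠ 0) {n : ℕ}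
    (hr : RhsRegular (s ^ 2) k (q ^ 2) n)
    (hl : qPochs [(s ^ 2) ^ 2 * q ^ (4 - 4 * (n : ℤ)) / k, (s ^ 2) ^ 2 * q ^ (4 * n + 4)]
      (q ^ 4) n ≠ 0) (hd₁ : 1 - s ≠ 0) (hd₂ : qPoch q q n ≠ 0) (hd₃ : qPoch (k / s ^ 3) q n ≠ 0)
    (hd₄ : qPoch (q ^ 2) (q ^ 2) n ≠ 0) (hd₅ : qPoch (k ^ 2 / s ^ 6) (q ^ 2) n ≠ 0)
    (hd₆ : qPoch (-(q * s)) q (2 * n) ≠ 0) :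
    ∑ j ∈ Finset.range (n + 1), lhsWeight (s ^ 2) k (q ^ 2) n j * quadraticAlpha s k q j
      = rhsFactor (s ^ 2) k (q ^ 2) n
        * ∑ j ∈ Finset.range (n + 1), rhsWeight (s ^ 2) k (q ^ 2) n j * quadraticBeta s k q j := by
  rw [← lhsWeight_base_sq_denominators] at hl
  obtain ⟨A, K, Q, R, S, hA, hK, hQ, -, -, rfl, rfl, rfl, -, -, hf, hne⟩ :=
    exists_frequently_normIndep hs hk hq one_ne_zero one_ne_zero
  refine transformation_closure (A := fun ε => A ε ^ 2) (Q := fun ε => Q ε ^ 2)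
    (α := fun ε => quadraticAlpha (A ε) (K ε) (Q ε))
    (β := fun ε => quadraticBeta (A ε) (K ε) (Q ε)) (hA.pow 2) hK (hQ.pow 2) (pow_ne_zero 2 hs) hk
    (pow_ne_zero 2 hq) hr hl (fun j hj => ?_) (fun j hj => ?_) (hf.mono fun ε hε => by
      obtain ⟨hA0, hK0, hQ0, -⟩ := hne ε
      exact hε.quadratic hA0 hK0 hQ0 n)
  all_goals
    replace hd₂ := qPoch_ne_zero_of_le hd₂ hj
    replace hd₃ := qPoch_ne_zero_of_le hd₃ hj
    replace hd₄ := qPoch_ne_zero_of_le hd₄ hj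
    replace hd₅ := qPoch_ne_zero_of_le hd₅ hj
    replace hd₆ := qPoch_ne_zero_of_le hd₆ (Nat.mul_le_mul_left 2 hj)
    simp only [quadraticAlpha, quadraticBeta]
    fun_prop (disch := (repeat' (first
      | assumption | apply pow_ne_zero | apply mul_ne_zero | dsimp only)))

theorem quadratic_identity {a k q s : ℂ} (ha : a ≠ 0) (hk : k ≠ 0) (hq : q ≠ 0)
    (hs : s ^ 2 = a) {n : ℕ} (hr : RhsRegular a k (q ^ 2) n) (hs1 : 1 - s ≠ 0)
    (hl : qPochs [a ^ 2 * q ^ (4 - 4 * (n : ℤ)) / k, a ^ 2 * q ^ (4 * n + 4)] (q ^ 4) n ≠ 0)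
    (hd : qPochs [q, k * s / a ^ 2] q n ≠ 0) (hd' : qPochs [q ^ 2, k ^ 2 / a ^ 3] (q ^ 2) n ≠ 0)
    (hd'' : qPoch (-q * s) q (2 * n) ≠ 0) :
      ∑ j ∈ Finset.range (n + 1),
        (1 - s * q ^ (2 * j))
            * qPochs [q ^ (-4 * (n : ℤ)), k * q ^ (4 * n)] (q ^ 4) j
            * qPochs [s, a ^ 2 * q / k] q j
          / ((1 - s)
            * qPochs [a ^ 2 * q ^ (4 - 4 * (n : ℤ)) / k,
                a ^ 2 * q ^ (4 * n + 4)] (q ^ 4) j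
            * qPochs [q, k * s / a ^ 2] q j)
          * q ^ (3 * j)
      = rhsFactor a k (q ^ 2) n
          * ∑ j ∈ Finset.range (n + 1),
            rhsWeight a k (q ^ 2) n j
              * (qPochs [k / a, a ^ 2 * q ^ 2 / k] (q ^ 2) j
                  * qPoch (-k * s / a ^ 2) q (2 * j)
                / (qPochs [q ^ 2, k ^ 2 / a ^ 3] (q ^ 2) j
                  * qPoch (-q * s) q (2 * j)))
              * (k * q / a ^ 2) ^ j := by
  subst hs
  have hs0 : s ≠ 0 := fun h => ha (by simp [h])
  have e₁ : k * s / (s ^ 2) ^ 2 = k / s ^ 3 := by field_simp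
  have e₂ : k ^ 2 / (s ^ 2) ^ 3 = k ^ 2 / s ^ 6 := by rw [← pow_mul]
  have e₃ : -k * s / (s ^ 2) ^ 2 = -(k / s ^ 3) := by field_simp
  have e₄ : -q * s = -(q * s) := by ring
  rw [qPochs_two, e₁] at hd
  rw [qPochs_two, e₂] at hd'
  rw [e₄] at hd''
  rw [e₁, e₂, e₃, e₄]
  have T := quadratic_transformation hs0 hk hq hr hl hs1 (left_ne_zero_of_mul hd)
    (right_ne_zero_of_mul hd) (left_ne_zero_of_mul hd') (right_ne_zero_of_mul hd') hd''
  refine Eq.trans (Finset.sum_congr rfl fun j _ => ?_) (T.trans (congrArg _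
    (Finset.sum_congr rfl fun j _ => ?_)))
  · rw [lhsWeight_base_sq, quadraticAlpha, ← pow_mul s 2 2]
    simp only [qPochs_two, div_eq_mul_inv, mul_inv]
    ring
  · rw [quadraticBeta, ← pow_mul s 2 2]
    simp only [qPochs_two, div_eq_mul_inv, mul_inv]
    ring

noncomputable def quadraticSqAlpha (s k q : ℂ) (j : ℕ) : ℂ :=
  (1 - s ^ 2 * q ^ (4 * j)) / (1 - s ^ 2) * (qPoch s q j * qPoch (s ^ 4 / k) q j
    / (qPoch q q j * qPoch (k * q / s ^ 3) q j)) * q ^ (3 * j)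

noncomputable def quadraticSqBeta (s k q : ℂ) (j : ℕ) : ℂ :=
  qPoch (k / s ^ 2) (q ^ 2) j * qPoch (s ^ 4 / k) (q ^ 2) j
      * qPoch (-(k * q / s ^ 3)) q (2 * j)
    / (qPoch (q ^ 2) (q ^ 2) j * qPoch (q ^ 2 * k ^ 2 / s ^ 6) (q ^ 2) j * qPoch (-s) q (2 * j))
    * (k * q / s ^ 4) ^ j

theorem NormIndep.quadraticSq {s k q d e : ℂ} (h : NormIndep s k q d e) (hs : s ≠ 0) (hk : k ≠ 0)
    (hq : q ≠ 0) (n : ℕ) :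
    ∑ j ∈ Finset.range (n + 1), lhsWeight (s ^ 2) k (q ^ 2) n j * quadraticSqAlpha s k q j
      = rhsFactor (s ^ 2) k (q ^ 2) n
        * ∑ j ∈ Finset.range (n + 1), rhsWeight (s ^ 2) k (q ^ 2) n j * quadraticSqBeta s k q j := by
  have P := wpPair_quadratic_sq hs (div_ne_zero hk (pow_ne_zero 2 hs)) hq h.qGeneric
    (h.qFree hq 1 0 0 0 0 (by simp) (by field_simp))
    (h.qFree_neg hq 1 0 0 0 0 (by simp) (by field_simp))
    (h.qFree hq (-3) 1 0 0 0 (by simp) (by field_simp))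
    (h.qFree_neg hq (-3) 1 0 0 0 (by simp) (by field_simp))
    (h.qFree hq (-4) 1 0 0 0 (by simp) (by field_simp))
  refine h.sum_eq_of_wpPair_base_sq hs hk hq P (fun j => ?_) (fun j => ?_) n
  · rw [quadraticSqAlpha, show s ^ 2 / (k / s ^ 2) = s ^ 4 / k by field_simp,
      show k / s ^ 2 * q / s = k * q / s ^ 3 by field_simp, pow_mul q 3,
      show (q ^ 3) ^ j
        = ((q ^ 2) ^ 2 * (s ^ 2) ^ 2 / k) ^ j * (k / s ^ 2 / (s ^ 2 * q)) ^ j by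
        rw [← mul_pow]; congr 1; field_simp]
    simp only [div_eq_mul_inv, mul_inv]
    ring
  · rw [quadraticSqBeta, show s ^ 2 / (k / s ^ 2) = s ^ 4 / k by field_simp,
      show k / s ^ 2 * q / s = k * q / s ^ 3 by field_simp,
      show q ^ 2 * (k / s ^ 2) ^ 2 / s ^ 2 = q ^ 2 * k ^ 2 / s ^ 6 by field_simp, mul_assoc,
      ← mul_pow (k / s ^ 2 / (s ^ 2 * q)) (q ^ 2) j,
      show k / s ^ 2 / (s ^ 2 * q) * q ^ 2 = k * q / s ^ 4 by field_simp]

theorem quadraticSq_transformation {s k q : ℂ} (hs : s ≠ 0) (hk : k ≠ 0) (hq : q ≠ 0) {n : ℕ}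
    (hr : RhsRegular (s ^ 2) k (q ^ 2) n)
    (hl : qPochs [(s ^ 2) ^ 2 * q ^ (4 - 4 * (n : ℤ)) / k, (s ^ 2) ^ 2 * q ^ (4 * n + 4)]
      (q ^ 4) n ≠ 0) (hd₁ : 1 - s ^ 2 ≠ 0) (hd₂ : qPoch q q n ≠ 0)
    (hd₃ : qPoch (k * q / s ^ 3) q n ≠ 0) (hd₄ : qPoch (q ^ 2) (q ^ 2) n ≠ 0)
    (hd₅ : qPoch (q ^ 2 * k ^ 2 / s ^ 6) (q ^ 2) n ≠ 0) (hd₆ : qPoch (-s) q (2 * n) ≠ 0) :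
    ∑ j ∈ Finset.range (n + 1), lhsWeight (s ^ 2) k (q ^ 2) n j * quadraticSqAlpha s k q j
      = rhsFactor (s ^ 2) k (q ^ 2) n
        * ∑ j ∈ Finset.range (n + 1), rhsWeight (s ^ 2) k (q ^ 2) n j * quadraticSqBeta s k q j := by
  rw [← lhsWeight_base_sq_denominators] at hl
  obtain ⟨A, K, Q, R, S, hA, hK, hQ, -, -, rfl, rfl, rfl, -, -, hf, hne⟩ :=
    exists_frequently_normIndep hs hk hq one_ne_zero one_ne_zero
  refine transformation_closure (A := fun ε => A ε ^ 2) (Q := fun ε => Q ε ^ 2)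
    (α := fun ε => quadraticSqAlpha (A ε) (K ε) (Q ε))
    (β := fun ε => quadraticSqBeta (A ε) (K ε) (Q ε)) (hA.pow 2) hK (hQ.pow 2) (pow_ne_zero 2 hs) hk
    (pow_ne_zero 2 hq) hr hl (fun j hj => ?_) (fun j hj => ?_) (hf.mono fun ε hε => by
      obtain ⟨hA0, hK0, hQ0, -⟩ := hne ε
      exact hε.quadraticSq hA0 hK0 hQ0 n)
  all_goals
    replace hd₂ := qPoch_ne_zero_of_le hd₂ hj
    replace hd₃ := qPoch_ne_zero_of_le hd₃ hj
    replace hd₄ := qPoch_ne_zero_of_le hd₄ hj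
    replace hd₅ := qPoch_ne_zero_of_le hd₅ hj
    replace hd₆ := qPoch_ne_zero_of_le hd₆ (Nat.mul_le_mul_left 2 hj)
    simp only [quadraticSqAlpha, quadraticSqBeta]
    fun_prop (disch := (repeat' (first
      | assumption | apply pow_ne_zero | apply mul_ne_zero | dsimp only)))

theorem quadraticSq_identity {a k q s : ℂ} (ha : a ≠ 0) (hk : k ≠ 0) (hq : q ≠ 0)
    (hs : s ^ 2 = a) {n : ℕ} (hr : RhsRegular a k (q ^ 2) n) (ha1 : 1 - a ≠ 0)
    (hl : qPochs [a ^ 2 * q ^ (4 - 4 * (n : ℤ)) / k, a ^ 2 * q ^ (4 * n + 4)] (q ^ 4) n ≠ 0)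
    (hd : qPochs [q, k * q * s / a ^ 2] q n ≠ 0)
    (hd' : qPochs [q ^ 2, q ^ 2 * k ^ 2 / a ^ 3, -s, -q * s] (q ^ 2) n ≠ 0) :
      ∑ j ∈ Finset.range (n + 1),
        (1 - a * q ^ (4 * j))
            * qPochs [q ^ (-4 * (n : ℤ)), k * q ^ (4 * n)] (q ^ 4) j
            * qPochs [s, a ^ 2 / k] q j
          / ((1 - a)
            * qPochs [a ^ 2 * q ^ (4 - 4 * (n : ℤ)) / k,
                a ^ 2 * q ^ (4 * n + 4)] (q ^ 4) j
            * qPochs [q, k * q * s / a ^ 2] q j)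
          * q ^ (3 * j)
      = rhsFactor a k (q ^ 2) n
          * ∑ j ∈ Finset.range (n + 1),
            rhsWeight a k (q ^ 2) n j
              * (qPochs [k / a, a ^ 2 / k, -(k * q * s / a ^ 2),
                    -(k * q ^ 2 * s / a ^ 2)] (q ^ 2) j
                / qPochs [q ^ 2, q ^ 2 * k ^ 2 / a ^ 3, -s, -q * s] (q ^ 2) j)
              * (k * q / a ^ 2) ^ j := by
  subst hs
  have hs0 : s ≠ 0 := fun h => ha (by simp [h])
  have e₁ : k * q * s / (s ^ 2) ^ 2 = k * q / s ^ 3 := by field_simp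
  have e₂ : q ^ 2 * k ^ 2 / (s ^ 2) ^ 3 = q ^ 2 * k ^ 2 / s ^ 6 := by rw [← pow_mul]
  have e₃ : k * q ^ 2 * s / (s ^ 2) ^ 2 = k * q / s ^ 3 * q := by field_simp
  have e₄ : -q * s = -s * q := by ring
  rw [qPochs_two, e₁] at hd
  rw [e₂, e₄] at hd'
  rw [e₁, e₂, e₃, e₄]
  simp only [qPochs, List.map_cons, List.map_nil, List.prod_cons, List.prod_nil, mul_one, ne_eq,
    mul_eq_zero, not_or] at hd'
  obtain ⟨d₁, d₂, d₃, d₄⟩ := hd'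
  have T := quadraticSq_transformation hs0 hk hq hr hl ha1 (left_ne_zero_of_mul hd)
    (right_ne_zero_of_mul hd) d₁ d₂ (by rw [qPoch_two_mul]; exact mul_ne_zero d₃ d₄)
  refine Eq.trans (Finset.sum_congr rfl fun j _ => ?_) (T.trans (congrArg _
    (Finset.sum_congr rfl fun j _ => ?_)))
  · rw [lhsWeight_base_sq, quadraticSqAlpha, ← pow_mul s 2 2]
    simp only [qPochs_two, div_eq_mul_inv, mul_inv]
    ring
  · rw [quadraticSqBeta, ← pow_mul s 2 2, qPoch_two_mul, qPoch_two_mul, ← neg_mul (k * q / s ^ 3)]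
    simp only [qPochs, List.map_cons, List.map_nil, List.prod_cons, List.prod_nil, mul_one,
      div_eq_mul_inv, mul_inv]
    ring

/-! ### The identity from the Saalschütz pair -/

noncomputable def saalschuetzAlpha (a k q : ℂ) (j : ℕ) : ℂ :=
  qPoch (q * a ^ 4 / k ^ 2) q j / qPoch q q j * (q ^ 2) ^ j

noncomputable def saalschuetzBeta (a k q : ℂ) (j : ℕ) : ℂ :=
  qPoch (q * a ^ 2 / k) q j * qPoch (k / a) q j * qPoch (k ^ 2 / a ^ 3) q (2 * j)
    / (qPoch (k ^ 2 / a ^ 3) q j * qPoch q q j * qPoch (a * q) q (2 * j)) * q ^ j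

theorem NormIndep.saalschuetz {a k q d e : ℂ} (h : NormIndep a k q d e) (ha : a ≠ 0) (hk : k ≠ 0)
    (hq : q ≠ 0) (n : ℕ) :
    ∑ j ∈ Finset.range (n + 1), lhsWeight a k q n j * saalschuetzAlpha a k q j
      = rhsFactor a k q n
        * ∑ j ∈ Finset.range (n + 1), rhsWeight a k q n j * saalschuetzBeta a k q j := by
  have P := wpPair_saalschuetz ha (div_ne_zero hk ha) hq h.qGeneric
    (h.qFree hq 1 0 0 0 0 (by simp) (by field_simp))
    (h.qFree hq (-2) 1 0 0 0 (by simp) (by field_simp))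
    (h.qFree hq (-3) 2 0 0 0 (by simp) (by field_simp))
  refine h.sum_eq_of_wpPair ha hk hq P (fun j => ?_) (fun j => ?_) n
  · rw [saalschuetzAlpha, show q * a ^ 2 / (k / a) ^ 2 = q * a ^ 4 / k ^ 2 by field_simp,
      show (q ^ 2) ^ j = (q ^ 2 * a ^ 2 / k) ^ j * (k / a / a) ^ j by
        rw [← mul_pow]; congr 1; field_simp]
    ring
  · rw [saalschuetzBeta, show q * a / (k / a) = q * a ^ 2 / k by field_simp,
      show (k / a) ^ 2 / a = k ^ 2 / a ^ 3 by field_simp]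

theorem saalschuetz_transformation {a k q : ℂ} (ha : a ≠ 0) (hk : k ≠ 0) (hq : q ≠ 0) {n : ℕ}
    (hr : RhsRegular a k q n)
    (hl : qPoch (a ^ 2 * q ^ (2 - 2 * (n : ℤ)) / k) (q ^ 2) n
      * qPoch (a ^ 2 * q ^ (2 * n + 2)) (q ^ 2) n ≠ 0)
    (hd₁ : qPoch q q n ≠ 0) (hd₂ : qPoch (k ^ 2 / a ^ 3) q n ≠ 0)
    (hd₃ : qPoch (a * q) q (2 * n) ≠ 0) :
    ∑ j ∈ Finset.range (n + 1), lhsWeight a k q n j * saalschuetzAlpha a k q j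
      = rhsFactor a k q n
        * ∑ j ∈ Finset.range (n + 1), rhsWeight a k q n j * saalschuetzBeta a k q j := by
  obtain ⟨A, K, Q, R, S, hA, hK, hQ, -, -, rfl, rfl, rfl, -, -, hf, hne⟩ :=
    exists_frequently_normIndep ha hk hq one_ne_zero one_ne_zero
  refine transformation_closure (α := fun ε => saalschuetzAlpha (A ε) (K ε) (Q ε))
    (β := fun ε => saalschuetzBeta (A ε) (K ε) (Q ε)) hA hK hQ ha hk hq hr hl
    (fun j hj => ?_) (fun j hj => ?_) (hf.mono fun ε hε => by
      obtain ⟨hA0, hK0, hQ0, -⟩ := hne ε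
      exact hε.saalschuetz hA0 hK0 hQ0 n)
  all_goals
    replace hd₁ := qPoch_ne_zero_of_le hd₁ hj
    replace hd₂ := qPoch_ne_zero_of_le hd₂ hj
    replace hd₃ := qPoch_ne_zero_of_le hd₃ (Nat.mul_le_mul_left 2 hj)
    simp only [saalschuetzAlpha, saalschuetzBeta]
    fun_prop (disch := (repeat' (first
      | assumption | apply pow_ne_zero | apply mul_ne_zero | dsimp only)))

theorem saalschuetz_identity {a k q t : ℂ} (ha : a ≠ 0) (hk : k ≠ 0) (hq : q ≠ 0)
    (ht : t ^ 2 = k) {n : ℕ} (hr : RhsRegular a k q n)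
    (hd : qPochs [q, a * q ^ (1 - (n : ℤ)) / t, -(a * q ^ (1 - (n : ℤ)) / t),
        a * q ^ (n + 1), -(a * q ^ (n + 1))] q n ≠ 0)
    (hd' : qPoch (k ^ 2 / a ^ 3) q n ≠ 0) (hd'' : qPoch (a * q) q (2 * n) ≠ 0) :
      basicHyp
        [q * a ^ 4 / k ^ 2, q ^ (-(n : ℤ)), -(q ^ (-(n : ℤ))), t * q ^ n, -(t * q ^ n)]
        [a * q ^ (1 - (n : ℤ)) / t, -(a * q ^ (1 - (n : ℤ)) / t),
          a * q ^ (n + 1), -(a * q ^ (n + 1))]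
        q (q ^ 2)
      = rhsFactor a k q n
          * ∑ j ∈ Finset.range (n + 1),
            rhsWeight a k q n j
              * (qPochs [q * a ^ 2 / k, k / a] q j * qPoch (k ^ 2 / a ^ 3) q (2 * j)
                / (qPochs [k ^ 2 / a ^ 3, q] q j * qPoch (a * q) q (2 * j)))
              * q ^ j := by
  simp only [qPochs, List.map_cons, List.map_nil, List.prod_cons, List.prod_nil, mul_one, ne_eq,
    mul_eq_zero, not_or] at hd
  obtain ⟨d₁, d₂, d₃, d₄, d₅⟩ := hd
  have T := saalschuetz_transformation ha hk hq hr
    (by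
      rw [lhsWeight_denominators ht]
      exact mul_ne_zero (mul_ne_zero d₂ d₃) (mul_ne_zero d₄ d₅)) d₁ hd' hd''
  rw [basicHyp_eq_sum_of_mem (n := n) hq rfl (by simp)]
  refine Eq.trans (Finset.sum_congr rfl fun j _ => ?_) (T.trans (congrArg _
    (Finset.sum_congr rfl fun j _ => ?_)))
  · rw [lhsWeight_eq_of_sq ht, saalschuetzAlpha]
    simp only [qPochs, List.map_cons, List.map_nil, List.prod_cons, List.prod_nil, mul_one,
      div_eq_mul_inv, mul_inv]
    ring
  · rw [saalschuetzBeta]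
    simp only [qPochs_two, div_eq_mul_inv, mul_inv]
    ring

/-! ### The identity with `β` on even indices -/

noncomputable def parityAlpha (a k q : ℂ) (j : ℕ) : ℂ :=
  qPoch (a * q ^ 2) (q ^ 2) j / qPoch a (q ^ 2) j
    * (qPoch a q j * qPoch (k / a ^ 2) q j * qPoch (a ^ 3 * q / k) (q ^ 2) j
      / (qPoch q q j * qPoch (q * a ^ 3 / k) q j * qPoch (q * k / a) (q ^ 2) j))
    * (-q ^ 2 * a ^ 2 / k) ^ j

noncomputable def parityBeta (a k q : ℂ) (j : ℕ) : ℂ :=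
  if Even j then qPoch (k / a) (q ^ 2) (j / 2) * qPoch (k ^ 2 / a ^ 4) (q ^ 2) (j / 2)
    / (qPoch (q ^ 2) (q ^ 2) (j / 2) * qPoch (q ^ 2 * a ^ 3 / k) (q ^ 2) (j / 2)) * q ^ j else 0

theorem NormIndep.parity {a k q d e : ℂ} (h : NormIndep a k q d e) (ha : a ≠ 0) (hk : k ≠ 0)
    (hq : q ≠ 0) (n : ℕ) :
    ∑ j ∈ Finset.range (n + 1), lhsWeight a k q n j * parityAlpha a k q j
      = rhsFactor a k q n * ∑ j ∈ Finset.range (n + 1), rhsWeight a k q n j * parityBeta a k q j := by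
  have hfa : QFree q a := h.qFree hq 1 0 0 0 0 (by simp) (by field_simp)
  have e : a * (k / a ^ 2) = k / a := by field_simp
  have P := wpPair_parity (b := k / a ^ 2) ha (div_ne_zero hk (pow_ne_zero 2 ha)) hq h.qGeneric hfa
    (h.qFree hq (-2) 1 0 0 0 (by simp) (by field_simp))
    (h.qFree hq (-1) 1 0 0 0 (by simp) (by field_simp))
    (h.qFree hq 3 (-1) 0 0 0 (by simp) (by field_simp))
    (h.qFree hq (-1) 1 1 0 0 (by simp) (by field_simp)).base_sq
  rw [e] at P
  refine h.sum_eq_of_wpPair ha hk hq P (fun j => ?_) (fun j => ?_) n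
  · rw [parityAlpha, vwp_quotient (hfa.sub_ne_zero 0 (by simp))
        (hfa.base_sq.qPoch_ne_zero (pow_ne_zero 2 hq) 0 (by simp) _),
      show a * q / (k / a ^ 2) = a ^ 3 * q / k by field_simp,
      show q * a ^ 3 / k = a ^ 3 * q / k by ring, show q * k / a = k / a * q by ring,
      show (-q ^ 2 * a ^ 2 / k) ^ j = (q ^ 2 * a ^ 2 / k) ^ j * (-1) ^ j by
        rw [← mul_pow]; ring]
    simp only [div_eq_mul_inv, mul_inv]
    ring
  · rw [parityBeta, parityValue, e, show (k / a ^ 2) ^ 2 = k ^ 2 / a ^ 4 by field_simp,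
      show q ^ 2 * a / (k / a ^ 2) = q ^ 2 * a ^ 3 / k by field_simp, ite_mul, zero_mul]

theorem parity_transformation {a k q : ℂ} (ha : a ≠ 0) (hk : k ≠ 0) (hq : q ≠ 0) {n : ℕ}
    (hr : RhsRegular a k q (2 * n))
    (hl : qPoch (a ^ 2 * q ^ (2 - 2 * ((2 * n : ℕ) : ℤ)) / k) (q ^ 2) (2 * n)
      * qPoch (a ^ 2 * q ^ (2 * (2 * n) + 2)) (q ^ 2) (2 * n) ≠ 0)
    (hd₁ : qPoch a (q ^ 2) (2 * n) ≠ 0) (hd₂ : qPoch q q (2 * n) ≠ 0)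
    (hd₃ : qPoch (q * a ^ 3 / k) q (2 * n) ≠ 0) (hd₄ : qPoch (q * k / a) (q ^ 2) (2 * n) ≠ 0)
    (hd₅ : qPoch (q ^ 2) (q ^ 2) n ≠ 0) (hd₆ : qPoch (q ^ 2 * a ^ 3 / k) (q ^ 2) n ≠ 0) :
    ∑ j ∈ Finset.range (2 * n + 1), lhsWeight a k q (2 * n) j * parityAlpha a k q j
      = rhsFactor a k q (2 * n)
        * ∑ j ∈ Finset.range (2 * n + 1), rhsWeight a k q (2 * n) j * parityBeta a k q j := by
  obtain ⟨A, K, Q, R, S, hA, hK, hQ, -, -, rfl, rfl, rfl, -, -, hf, hne⟩ :=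
    exists_frequently_normIndep ha hk hq one_ne_zero one_ne_zero
  refine transformation_closure (α := fun ε => parityAlpha (A ε) (K ε) (Q ε))
    (β := fun ε => parityBeta (A ε) (K ε) (Q ε)) hA hK hQ ha hk hq hr hl
    (fun j hj => ?_) (fun j hj => ?_) (hf.mono fun ε hε => by
      obtain ⟨hA0, hK0, hQ0, -⟩ := hne ε
      exact hε.parity hA0 hK0 hQ0 _)
  all_goals
    have hj' : j / 2 ≤ n := by omega
    replace hd₁ := qPoch_ne_zero_of_le hd₁ hj
    replace hd₂ := qPoch_ne_zero_of_le hd₂ hj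
    replace hd₃ := qPoch_ne_zero_of_le hd₃ hj
    replace hd₄ := qPoch_ne_zero_of_le hd₄ hj
    replace hd₅ := qPoch_ne_zero_of_le hd₅ hj'
    replace hd₆ := qPoch_ne_zero_of_le hd₆ hj'
    simp only [parityAlpha, parityBeta]
    try split_ifs
    all_goals fun_prop (disch := (repeat' (first
      | assumption | apply pow_ne_zero | apply mul_ne_zero | dsimp only)))

theorem parity_identity {a k q s t v w : ℂ} (ha : a ≠ 0) (hk : k ≠ 0) (hq : q ≠ 0)
    (hs : s ^ 2 = a) (ht : t ^ 2 = k) (hv : v ^ 2 = a * q / k) (hw : w ^ 2 = q * k / a) {n : ℕ}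
    (hr : RhsRegular a k q (2 * n))
    (hd : qPochs [q, s, -s, q * a ^ 3 / k, w, -w,
        a * q ^ (1 - 2 * (n : ℤ)) / t, -(a * q ^ (1 - 2 * (n : ℤ)) / t),
        a * q ^ (2 * n + 1), -(a * q ^ (2 * n + 1))] q (2 * n) ≠ 0)
    (hd' : qPochs [q ^ 2, q ^ 2 * a ^ 3 / k] (q ^ 2) n ≠ 0) :
      basicHyp
        [a, q * s, -(q * s), k / a ^ 2, a * v, -(a * v),
          q ^ (-2 * (n : ℤ)), -(q ^ (-2 * (n : ℤ))), t * q ^ (2 * n), -(t * q ^ (2 * n))]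
        [s, -s, q * a ^ 3 / k, w, -w,
          a * q ^ (1 - 2 * (n : ℤ)) / t, -(a * q ^ (1 - 2 * (n : ℤ)) / t),
          a * q ^ (2 * n + 1), -(a * q ^ (2 * n + 1))]
        q (-q ^ 2 * a ^ 2 / k)
      = rhsFactor a k q (2 * n)
          * ∑ j ∈ Finset.range (n + 1),
            rhsWeight a k q (2 * n) (2 * j)
              * (qPochs [k / a, k ^ 2 / a ^ 4] (q ^ 2) j
                / qPochs [q ^ 2, q ^ 2 * a ^ 3 / k] (q ^ 2) j)
              * q ^ (2 * j) := by
  have z₁ : 1 - 2 * (n : ℤ) = 1 - ((2 * n : ℕ) : ℤ) := by push_cast; ring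
  have z₂ : -2 * (n : ℤ) = -((2 * n : ℕ) : ℤ) := by push_cast; ring
  have hv' : a ^ 3 * q / k = (a * v) ^ 2 := by rw [mul_pow, hv]; ring
  rw [z₁] at hd ⊢
  rw [z₂]
  rw [qPochs_two] at hd'
  simp only [qPochs, List.map_cons, List.map_nil, List.prod_cons, List.prod_nil, mul_one, ne_eq,
    mul_eq_zero, not_or] at hd
  obtain ⟨d₁, d₂, d₃, d₄, d₅, d₆, d₇, d₈, d₉, d₁₀⟩ := hd
  have T := parity_transformation ha hk hq hr
    (by
      rw [lhsWeight_denominators ht]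
      exact mul_ne_zero (mul_ne_zero d₇ d₈) (mul_ne_zero d₉ d₁₀))
    (by rw [qPoch_sq_of_eq hs.symm]; exact mul_ne_zero d₂ d₃) d₁ d₄
    (by rw [qPoch_sq_of_eq hw.symm]; exact mul_ne_zero d₅ d₆)
    (left_ne_zero_of_mul hd') (right_ne_zero_of_mul hd')
  -- Now the right-hand side is supported on even indices, while the left-hand series runs over all
  -- `j ≤ 2n`.
  rw [sum_range_even (F := fun j => rhsWeight a k q (2 * n) j * parityBeta a k q j) fun i hi => by
    rw [parityBeta, if_neg hi, mul_zero]] at T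
  rw [basicHyp_eq_sum_of_mem (n := 2 * n) hq rfl (by simp)]
  refine Eq.trans (Finset.sum_congr rfl fun j _ => ?_) (T.trans (congrArg _
    (Finset.sum_congr rfl fun j _ => ?_)))
  · rw [lhsWeight_eq_of_sq ht, parityAlpha, qPoch_sq_of_eq hs.symm,
      qPoch_sq_of_eq (x := q * s) (y := a * q ^ 2) (by rw [← hs]; ring),
      qPoch_sq_of_eq hw.symm, qPoch_sq_of_eq hv']
    simp only [qPochs, List.map_cons, List.map_nil, List.prod_cons, List.prod_nil, mul_one,
      div_eq_mul_inv, mul_inv]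
    ring
  · rw [parityBeta, if_pos (even_two_mul j), Nat.mul_div_cancel_left j two_pos]
    simp only [qPochs_two]
    ring

end Genericity

theorem mainTheorem12 (a k q : ℂ) (ha : a ≠ 0) (hk : k ≠ 0) (hq : q ≠ 0) (n : ℕ) :
    -- (1)
    (∀ s t ρ₁ ρ₂ : ℂ, s ^ 2 = a → t ^ 2 = k → ρ₁ ≠ 0 → ρ₂ ≠ 0 →
      RhsRegular a k q n →
      qPochs [q, s, -s, a * q / ρ₁, a * q / ρ₂, k * ρ₁ * ρ₂ / a ^ 2,
        a * q ^ (1 - (n : ℤ)) / t, -(a * q ^ (1 - (n : ℤ)) / t),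
        a * q ^ (n + 1), -(a * q ^ (n + 1))] q n ≠ 0 →
      basicHyp
        [a, q * s, -(q * s), ρ₁, ρ₂, a ^ 3 * q / (k * ρ₁ * ρ₂), t * q ^ n, -(t * q ^ n),
          q ^ (-(n : ℤ)), -(q ^ (-(n : ℤ)))]
        [s, -s, a * q / ρ₁, a * q / ρ₂, k * ρ₁ * ρ₂ / a ^ 2,
          a * q ^ (1 - (n : ℤ)) / t, -(a * q ^ (1 - (n : ℤ)) / t),
          a * q ^ (n + 1), -(a * q ^ (n + 1))]
        q (q ^ 2)
      = rhsFactor a k q n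
          * ∑ j ∈ Finset.range (n + 1),
            rhsWeight a k q n j
              * (qPochs [k * ρ₁ / a ^ 2, k * ρ₂ / a ^ 2, k / a, a * q / (ρ₁ * ρ₂)] q j
                / qPochs [a * q / ρ₁, a * q / ρ₂, k * ρ₁ * ρ₂ / a ^ 2, q] q j)
              * q ^ j) ∧
    -- (2)
    (∀ s : ℂ, s ^ 2 = a →
      RhsRegular a k q n →
      qPochs [s, -s, q, a ^ 3 * q ^ 2 / k] q n ≠ 0 →
      qPochs [a ^ 2 * q ^ (2 - 2 * (n : ℤ)) / k, a ^ 2 * q ^ (2 * n + 2)] (q ^ 2) n ≠ 0 →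
      qPoch (k / a) q (2 * n) ≠ 0 →
      ∑ j ∈ Finset.range (n + 1),
        qPochs [a, q * s, -(q * s), k / (a ^ 2 * q)] q j
            * qPochs [q ^ (-2 * (n : ℤ)), k * q ^ (2 * n)] (q ^ 2) j
            * qPoch (q * a ^ 3 / k) q (2 * j)
          / (qPochs [s, -s, q, a ^ 3 * q ^ 2 / k] q j
            * qPochs [a ^ 2 * q ^ (2 - 2 * (n : ℤ)) / k,
                a ^ 2 * q ^ (2 * n + 2)] (q ^ 2) j
            * qPoch (k / a) q (2 * j))
          * q ^ (2 * j)
      = rhsFactor a k q n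
          * ∑ j ∈ Finset.range (n + 1),
            rhsWeight a k q n j * (qPoch (k ^ 2 / (q * a ^ 4)) q j / qPoch q q j)
              * q ^ j) ∧
    -- (3), with `r = √(k/a)`, `r⁻¹ = √(a/k)`, `v = √(qa/k)`, `w = √(kq/a)`
    (∀ s t r v w : ℂ, s ^ 2 = a → t ^ 2 = k → r ^ 2 = k / a → v ^ 2 = q * a / k →
      w ^ 2 = k * q / a →
      RhsRegular a k q n →
      qPochs [q, s, -s, w, -w, q * r, -r, q * a ^ 3 / k,
        a * q ^ (1 - (n : ℤ)) / t, -(a * q ^ (1 - (n : ℤ)) / t),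
        a * q ^ (n + 1), -(a * q ^ (n + 1))] q n ≠ 0 →
      basicHyp
        [a, q * s, -(q * s), a * v, -(a * v), a * r⁻¹, -(a * q * r⁻¹), k / a ^ 2,
          q ^ (-(n : ℤ)), -(q ^ (-(n : ℤ))), t * q ^ n, -(t * q ^ n)]
        [s, -s, w, -w, q * r, -r, q * a ^ 3 / k,
          a * q ^ (1 - (n : ℤ)) / t, -(a * q ^ (1 - (n : ℤ)) / t),
          a * q ^ (n + 1), -(a * q ^ (n + 1))]
        q (q ^ 2)
      = rhsFactor a k q n
          * ∑ j ∈ Finset.range (n + 1),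
            rhsWeight a k q n j
              * (qPochs [r, k ^ 2 / a ^ 4] q j / qPochs [q * r, q] q j)
              * q ^ j) ∧
    -- (4), with `p = √(aq)`
    (∀ s p : ℂ, s ^ 2 = a → p ^ 2 = a * q →
      RhsRegular a k q (2 * n) →
      qPochs [a ^ 2 * q ^ (2 - 4 * (n : ℤ)) / k, a ^ 2 * q ^ (4 * n + 2)]
        (q ^ 2) (2 * n) ≠ 0 →
      qPochs [q ^ 2, s, -s, q ^ 2 * k ^ 2 / a ^ 3] (q ^ 2) n ≠ 0 →
      qPochs [p, -p, q * k ^ 2 / a ^ 3, q] q (2 * n) ≠ 0 →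
      ∑ j ∈ Finset.range (n + 1),
        qPochs [q ^ (-4 * (n : ℤ)), k * q ^ (4 * n)] (q ^ 2) (2 * j)
            * qPochs [a, q ^ 2 * s, -(q ^ 2 * s), a ^ 4 / k ^ 2] (q ^ 2) j
          / (qPochs [a ^ 2 * q ^ (2 - 4 * (n : ℤ)) / k,
                a ^ 2 * q ^ (4 * n + 2)] (q ^ 2) (2 * j)
            * qPochs [q ^ 2, s, -s, q ^ 2 * k ^ 2 / a ^ 3] (q ^ 2) j)
          * q ^ (4 * j)
      = rhsFactor a k q (2 * n)
          * ∑ j ∈ Finset.range (2 * n + 1),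
            rhsWeight a k q (2 * n) j
              * (qPochs [k / a, k * p / a ^ 2, -(k * p / a ^ 2), a ^ 2 / k] q j
                / qPochs [p, -p, q * k ^ 2 / a ^ 3, q] q j)
              * (-k * q / a ^ 2) ^ j) ∧
    -- (5)
    (∀ s : ℂ, s ^ 2 = a →
      RhsRegular a k (q ^ 2) n →
      1 - s ≠ 0 →
      qPochs [a ^ 2 * q ^ (4 - 4 * (n : ℤ)) / k, a ^ 2 * q ^ (4 * n + 4)] (q ^ 4) n ≠ 0 →
      qPochs [q, k * s / a ^ 2] q n ≠ 0 →
      qPochs [q ^ 2, k ^ 2 / a ^ 3] (q ^ 2) n ≠ 0 →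
      qPoch (-q * s) q (2 * n) ≠ 0 →
      ∑ j ∈ Finset.range (n + 1),
        (1 - s * q ^ (2 * j))
            * qPochs [q ^ (-4 * (n : ℤ)), k * q ^ (4 * n)] (q ^ 4) j
            * qPochs [s, a ^ 2 * q / k] q j
          / ((1 - s)
            * qPochs [a ^ 2 * q ^ (4 - 4 * (n : ℤ)) / k,
                a ^ 2 * q ^ (4 * n + 4)] (q ^ 4) j
            * qPochs [q, k * s / a ^ 2] q j)
          * q ^ (3 * j)
      = rhsFactor a k (q ^ 2) n
          * ∑ j ∈ Finset.range (n + 1),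
            rhsWeight a k (q ^ 2) n j
              * (qPochs [k / a, a ^ 2 * q ^ 2 / k] (q ^ 2) j
                  * qPoch (-k * s / a ^ 2) q (2 * j)
                / (qPochs [q ^ 2, k ^ 2 / a ^ 3] (q ^ 2) j
                  * qPoch (-q * s) q (2 * j)))
              * (k * q / a ^ 2) ^ j) ∧
    -- (6)
    (∀ s : ℂ, s ^ 2 = a →
      RhsRegular a k (q ^ 2) n →
      1 - a ≠ 0 →
      qPochs [a ^ 2 * q ^ (4 - 4 * (n : ℤ)) / k, a ^ 2 * q ^ (4 * n + 4)] (q ^ 4) n ≠ 0 →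
      qPochs [q, k * q * s / a ^ 2] q n ≠ 0 →
      qPochs [q ^ 2, q ^ 2 * k ^ 2 / a ^ 3, -s, -q * s] (q ^ 2) n ≠ 0 →
      ∑ j ∈ Finset.range (n + 1),
        (1 - a * q ^ (4 * j))
            * qPochs [q ^ (-4 * (n : ℤ)), k * q ^ (4 * n)] (q ^ 4) j
            * qPochs [s, a ^ 2 / k] q j
          / ((1 - a)
            * qPochs [a ^ 2 * q ^ (4 - 4 * (n : ℤ)) / k,
                a ^ 2 * q ^ (4 * n + 4)] (q ^ 4) j
            * qPochs [q, k * q * s / a ^ 2] q j)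
          * q ^ (3 * j)
      = rhsFactor a k (q ^ 2) n
          * ∑ j ∈ Finset.range (n + 1),
            rhsWeight a k (q ^ 2) n j
              * (qPochs [k / a, a ^ 2 / k, -(k * q * s / a ^ 2),
                    -(k * q ^ 2 * s / a ^ 2)] (q ^ 2) j
                / qPochs [q ^ 2, q ^ 2 * k ^ 2 / a ^ 3, -s, -q * s] (q ^ 2) j)
              * (k * q / a ^ 2) ^ j) ∧
    -- (7)
    (∀ t : ℂ, t ^ 2 = k →
      RhsRegular a k q n →
      qPochs [q, a * q ^ (1 - (n : ℤ)) / t, -(a * q ^ (1 - (n : ℤ)) / t),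
        a * q ^ (n + 1), -(a * q ^ (n + 1))] q n ≠ 0 →
      qPoch (k ^ 2 / a ^ 3) q n ≠ 0 →
      qPoch (a * q) q (2 * n) ≠ 0 →
      basicHyp
        [q * a ^ 4 / k ^ 2, q ^ (-(n : ℤ)), -(q ^ (-(n : ℤ))), t * q ^ n, -(t * q ^ n)]
        [a * q ^ (1 - (n : ℤ)) / t, -(a * q ^ (1 - (n : ℤ)) / t),
          a * q ^ (n + 1), -(a * q ^ (n + 1))]
        q (q ^ 2)
      = rhsFactor a k q n
          * ∑ j ∈ Finset.range (n + 1),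
            rhsWeight a k q n j
              * (qPochs [q * a ^ 2 / k, k / a] q j * qPoch (k ^ 2 / a ^ 3) q (2 * j)
                / (qPochs [k ^ 2 / a ^ 3, q] q j * qPoch (a * q) q (2 * j)))
              * q ^ j) ∧
    -- (8), with `v = √(aq/k)`, `w = √(qk/a)`
    (∀ s t v w : ℂ, s ^ 2 = a → t ^ 2 = k → v ^ 2 = a * q / k → w ^ 2 = q * k / a →
      RhsRegular a k q (2 * n) →
      qPochs [q, s, -s, q * a ^ 3 / k, w, -w,
        a * q ^ (1 - 2 * (n : ℤ)) / t, -(a * q ^ (1 - 2 * (n : ℤ)) / t),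
        a * q ^ (2 * n + 1), -(a * q ^ (2 * n + 1))] q (2 * n) ≠ 0 →
      qPochs [q ^ 2, q ^ 2 * a ^ 3 / k] (q ^ 2) n ≠ 0 →
      basicHyp
        [a, q * s, -(q * s), k / a ^ 2, a * v, -(a * v),
          q ^ (-2 * (n : ℤ)), -(q ^ (-2 * (n : ℤ))), t * q ^ (2 * n), -(t * q ^ (2 * n))]
        [s, -s, q * a ^ 3 / k, w, -w,
          a * q ^ (1 - 2 * (n : ℤ)) / t, -(a * q ^ (1 - 2 * (n : ℤ)) / t),
          a * q ^ (2 * n + 1), -(a * q ^ (2 * n + 1))]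
        q (-q ^ 2 * a ^ 2 / k)
      = rhsFactor a k q (2 * n)
          * ∑ j ∈ Finset.range (n + 1),
            rhsWeight a k q (2 * n) (2 * j)
              * (qPochs [k / a, k ^ 2 / a ^ 4] (q ^ 2) j
                / qPochs [q ^ 2, q ^ 2 * a ^ 3 / k] (q ^ 2) j)
              * q ^ (2 * j)) :=
  ⟨fun _ _ _ _ hs ht h₁ h₂ hr hd => singh_identity ha hk hq hs ht h₁ h₂ hr hd,
    fun _ hs hr hd hl hd₄ => bressoud_identity ha hk hq hs hr hd hl hd₄,
    fun _ _ _ _ _ hs ht hrk hv hw hr hd => sqrt_identity ha hk hq hs ht hrk hv hw hr hd,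
    fun _ _ hs hp hr hl hd hd' => even_identity ha hk hq hs hp hr hl hd hd',
    fun _ hs hr hs1 hl hd hd' hd'' => quadratic_identity ha hk hq hs hr hs1 hl hd hd' hd'',
    fun _ hs hr ha1 hl hd hd' => quadraticSq_identity ha hk hq hs hr ha1 hl hd hd',
    fun _ ht hr hd hd' hd'' => saalschuetz_identity ha hk hq ht hr hd hd' hd'',
    fun _ _ _ _ hs ht hv hw hr hd hd' => parity_identity ha hk hq hs ht hv hw hr hd hd'⟩
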